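/- Conventions. A diagram $D$ is an oriented diagram without boundary built from arcs, positive crossings, negative crossings and MOY vertices (4-valent vertices with two incoming edges $x_1,x_2$ and two outgoing edges $y_1,y_2$; with the strands going up, $x_1,x_2$ are the bottom left and right ends and $y_1,y_2$ the top left and right ends; at a positive crossing the strand from $x_1$ to $y_2$ passes over, at a negative crossing the strand from $x_2$ to $y_1$). Oriented link diagrams in the plane are diagrams without MOY vertices; diagrams with no crossings are MOY graphs. Diagrams are taken combinatorially, up to the way in which the ends of the pieces are joined, and may be non-planar: a virtual crossing is a permutation of two strands carrying no further data. Cut $D$ by marks into elementary pieces and let $E^t$ be the polynomial ring over $\mathbb{Q}$ on the marks, all variables of degree $q^2$. To the pieces one assigns bicomplexes of free $E^t$-modules, where $q^ia^jt^k$ denotes a shift of the quantum, Hochschild and homological degree: $$C(\text{arc}\ x\to y)=\bigl(q^2aE^t\xrightarrow{\,y-x\,}E^t\bigr),\qquad C(\text{MOY vertex})=\text{Koszul complex of } \bigl(y_1+y_2-x_1-x_2,\ (y_1-x_1)(y_1-x_2)\bigr),$$ $$C(\text{positive crossing})=\bigl(C(\text{arcs})\xrightarrow{\chi_i}tq^{-2}C(\text{MOY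 vertex})\bigr),\qquad C(\text{negative crossing})=\bigl(t^{-1}C(\text{MOY vertex})\xrightarrow{\chi_o}C(\text{arcs})\bigr),$$ where "arcs" are the two arcs $x_1\to y_1$, $x_2\to y_2$. Explicitly, write the two Koszul complexes as $$C(\text{arcs}):\ a^2q^4E^t\xrightarrow{\binom{y_1-x_1}{y_2-x_2}}aq^2E^t\oplus aq^2E^t\xrightarrow{(x_2-y_2\ \ y_1-x_1)}E^t,$$ $$C(\text{MOY vertex}):\ a^2q^6E^t\xrightarrow{\binom{(y_1-x_1)(y_1-x_2)}{y_1+y_2-x_1-x_2}}aq^2E^t\oplus aq^4E^t\xrightarrow{(x_1+x_2-y_1-y_2\ \ (y_1-x_1)(y_1-x_2))}E^t.$$ In Hochschild degrees $2,1,0$ the map $\chi_i$ is $1$, $\begin{pmatrix}y_1-x_2&0\\1&1\end{pmatrix}$, $y_1-x_2$, and $\chi_o$ is $y_1-x_2$, $\begin{pmatrix}1&0\\-1&y_1-x_2\end{pmatrix}$, $1$. Let $C(D)$ be the tensor product over $E^t$ of the bicomplexes of all pieces, with vertical differential $d_g$ (Koszul) and horizontal differential $d_c$ (from $\chi_i,\chi_o$),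 and let $\mathcal H(D)=H_{d_{c*}}(H_{d_g}(C(D)))$, a triply graded $\mathbb{Q}$-vector space. Put $$P^b(D)=\Bigl.\sum_{i,j,k\in\mathbb{Z}}\dim_{\mathbb{Q}}\mathcal H(D)_{i,j,k}\,q^ia^jt^k\Bigr|_{t=-1}.$$ Two diagrams are braidlike isotopic if they are related by a finite sequence of planar isotopies, additions and removals of marks, and the oriented Reidemeister moves $\sigma_1\sigma_1^{-1}\sim1$, $\sigma_1^{-1}\sigma_1\sim1$, $\sigma_1\sigma_2\sigma_1\sim\sigma_2\sigma_1\sigma_2$ performed locally on parallel oriented strands ($\sigma_i$ a positive crossing). In the combinatorial description planar isotopy only renames the marks and reorders the pieces. **Theorem.** Let $D$ be a diagram. All $\mathcal H(D)_{i,j,k}$ are finite-dimensional, for each $i$ only finitely many of them are nonzero, and $P^b(D)$ is (the expansion at $q=0$ of) an element of $\mathbb{Z}(q,a)$. 1. If $D$ and $D'$ are braidlike isotopic, then $P^b(D)=P^b(D')$. 2. If $D_+$, $D_-$, $D_0$ agree except in a neighbourhood of one point, where $D_+$ is a positive crossing, $D_-$ a negative crossing and $D_0$ the oriented smoothing (two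 parallel arcs), then $$q\,P^b(D_+)-q^{-1}P^b(D_-)=(q-q^{-1})P^b(D_0).$$ 3. $P^b$ satisfies the following relations between diagrams which agree outside a small disc. * If $D_\bullet$ has a MOY vertex in the place of the crossing of $D_\pm$, then $P^b(D_+)=P^b(D_0)-q^{-2}P^b(D_\bullet)$ and $P^b(D_-)=P^b(D_0)-P^b(D_\bullet)$. * (MOY 0) For the circle, $P^b(O)=\frac{1+aq^2}{1-q^2}$, and $P^b(D\sqcup O)=\frac{1+aq^2}{1-q^2}P^b(D)$. * (MOY I) A MOY vertex whose right outgoing edge is joined to its right incoming edge by an arc equals $\frac{1+aq^4}{1-q^2}$ times a single arc. * (MOY IIa) Two MOY vertices stacked on two parallel strands equal $(1+q^2)$ times one MOY vertex. * (MOY IIb*) Place side by side a MOY vertex pointing up and a MOY vertex pointing down, with the right outgoing edge of the left one entering the right one and the adjacent outgoing edge of the right one entering the left one. This equals the same graph with the left vertex replaced by a virtual crossing, plus $\frac{q^2+aq^6}{1-q^2}$ times two antiparallel arcs (the left one up, the right one down). * (MOY III) On three parallel strands, let $b_i$ be a MOY vertex on strands $i,i+1$. Then $P^b(b_1b_2b_1)+q^2P^b(b_2)=q^2P^b(b_1)+P^b(b_2b_1b_2)$.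 -/

import Mathlib

open Matrix
open scoped Kronecker

namespace HomflyPT

/-! ## Marked oriented diagrams -/

/-- An elementary piece of a marked oriented diagram, its endpoints labelled by marks in `M`.
For the 4-valent pieces, drawn with both strands going up, the arguments `x₁ x₂ y₁ y₂` are the
bottom left, bottom right, top left and top right endpoint (the `x`'s come in, the `y`'s go out).
* `arc x y`: an arc from `x` to `y`;
* `pos x₁ x₂ y₁ y₂`: a positive crossing (the strand from `x₁` to `y₂` passes over);
* `neg x₁ x₂ y₁ y₂`: a negative crossing (the strand from `x₂` to `y₁` passes over);
* `wide x₁ x₂ y₁ y₂`: a MOY vertex. -/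
inductive Piece (M : Type) : Type
  | arc (x y : M) : Piece M
  | pos (x₁ x₂ y₁ y₂ : M) : Piece M
  | neg (x₁ x₂ y₁ y₂ : M) : Piece M
  | wide (x₁ x₂ y₁ y₂ : M) : Piece M

namespace Piece

variable {M N : Type}

/-- The marks at which a piece begins. -/
def ins : Piece M → List M
  | arc x _ => [x]
  | pos x₁ x₂ _ _ => [x₁, x₂]
  | neg x₁ x₂ _ _ => [x₁, x₂]
  | wide x₁ x₂ _ _ => [x₁, x₂]

/-- The marks at which a piece ends. -/
def outs : Piece M → List M
  | arc _ y => [y]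
  | pos _ _ y₁ y₂ => [y₁, y₂]
  | neg _ _ y₁ y₂ => [y₁, y₂]
  | wide _ _ y₁ y₂ => [y₁, y₂]

/-- Relabelling of marks. -/
def map (f : M → N) : Piece M → Piece N
  | arc x y => arc (f x) (f y)
  | pos x₁ x₂ y₁ y₂ => pos (f x₁) (f x₂) (f y₁) (f y₂)
  | neg x₁ x₂ y₁ y₂ => neg (f x₁) (f x₂) (f y₁) (f y₂)
  | wide x₁ x₂ y₁ y₂ => wide (f x₁) (f x₂) (f y₁) (f y₂)

end Piece

/-- A list of pieces glued at their common marks has no boundary: every mark is the endpoint of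
exactly one piece end coming in and of exactly one piece end going out. -/
structure Closed {M : Type} (L : List (Piece M)) : Prop where
  ins_nodup : (L.flatMap Piece.ins).Nodup
  outs_nodup : (L.flatMap Piece.outs).Nodup
  mem_ins : ∀ m, m ∈ L.flatMap Piece.ins
  mem_outs : ∀ m, m ∈ L.flatMap Piece.outs

/-- A marked oriented diagram without boundary, cut by its marks into elementary pieces, in
combinatorial form. A diagram with `arc`, `pos` and `neg` pieces only is an oriented link diagram;
one with `arc` and `wide` pieces only is a MOY graph. An oriented link diagram in the plane is
recorded by its crossings, with their four ends in the cyclic order of the plane, and by the way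
in which the ends are joined. No planarity is imposed: strands joined in a nonplanar way are
strands that meet in virtual crossings, which are permutations of strands with no crossing data. -/
structure Diagram where
  Mark : Type
  pieces : List (Piece Mark)
  closed : Closed pieces

/-- A virtual crossing (bottom left, bottom right, top left, top right): two arcs. -/
def virt {M : Type} (x₁ x₂ y₁ y₂ : M) : List (Piece M) := [.arc x₂ y₁, .arc x₁ y₂]

/-- Elementary steps of braidlike isotopy. `relabel` and `mark` change only the presentation of
the diagram (names of marks, order of the pieces, an additional mark on an edge), and planar
isotopic diagrams are related by them. The others are the braidlike Reidemeister moves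
`σ₁σ₁⁻¹ ∼ 1`, `σ₁⁻¹σ₁ ∼ 1` and `σ₁σ₂σ₁ ∼ σ₂σ₁σ₂`, on diagrams which agree elsewhere (`L`), the
marks `Sum.inr _` being the internal marks of the tangle in which the move takes place. -/
inductive BraidlikeStep : Diagram → Diagram → Prop
  | relabel (D D' : Diagram) (e : D.Mark ≃ D'.Mark)
      (h : List.Perm D'.pieces (D.pieces.map (Piece.map e))) : BraidlikeStep D D'
  | mark {M : Type} (m : M) (L : List (Piece (Option M)))
      (h : Closed (Piece.arc (some m) none :: L))
      (h' : Closed (L.map (Piece.map fun z => z.getD m))) :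
      BraidlikeStep ⟨Option M, _, h⟩ ⟨M, _, h'⟩
  | reidIIa_pos_neg {M : Type} (x₁ x₂ y₁ y₂ : M) (L : List (Piece M))
      (h : Closed (Piece.pos (Sum.inl x₁) (Sum.inl x₂) (Sum.inr 0) (Sum.inr 1) ::
        Piece.neg (Sum.inr 0) (Sum.inr 1) (Sum.inl y₁) (Sum.inl y₂) ::
        L.map (Piece.map (Sum.inl : M → M ⊕ Fin 2))))
      (h' : Closed (Piece.arc x₁ y₁ :: Piece.arc x₂ y₂ :: L)) :
      BraidlikeStep ⟨M ⊕ Fin 2, _, h⟩ ⟨M, _, h'⟩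
  | reidIIa_neg_pos {M : Type} (x₁ x₂ y₁ y₂ : M) (L : List (Piece M))
      (h : Closed (Piece.neg (Sum.inl x₁) (Sum.inl x₂) (Sum.inr 0) (Sum.inr 1) ::
        Piece.pos (Sum.inr 0) (Sum.inr 1) (Sum.inl y₁) (Sum.inl y₂) ::
        L.map (Piece.map (Sum.inl : M → M ⊕ Fin 2))))
      (h' : Closed (Piece.arc x₁ y₁ :: Piece.arc x₂ y₂ :: L)) :
      BraidlikeStep ⟨M ⊕ Fin 2, _, h⟩ ⟨M, _, h'⟩
  | reidIII {M : Type} (x₁ x₂ x₃ y₁ y₂ y₃ : M) (L : List (Piece M))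
      (h : Closed (Piece.pos (Sum.inl x₁) (Sum.inl x₂) (Sum.inr 0) (Sum.inr 1) ::
        Piece.pos (Sum.inr 1) (Sum.inl x₃) (Sum.inr 2) (Sum.inl y₃) ::
        Piece.pos (Sum.inr 0) (Sum.inr 2) (Sum.inl y₁) (Sum.inl y₂) ::
        L.map (Piece.map (Sum.inl : M → M ⊕ Fin 3))))
      (h' : Closed (Piece.pos (Sum.inl x₂) (Sum.inl x₃) (Sum.inr 0) (Sum.inr 1) ::
        Piece.pos (Sum.inl x₁) (Sum.inr 0) (Sum.inl y₁) (Sum.inr 2) ::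
        Piece.pos (Sum.inr 2) (Sum.inr 1) (Sum.inl y₂) (Sum.inl y₃) ::
        L.map (Piece.map (Sum.inl : M → M ⊕ Fin 3)))) :
      BraidlikeStep ⟨M ⊕ Fin 3, _, h⟩ ⟨M ⊕ Fin 3, _, h'⟩

/-- Braidlike isotopy: a finite sequence of elementary steps and their inverses. -/
def BraidlikeIsotopic (D D' : Diagram) : Prop := Relation.EqvGen BraidlikeStep D D'

/-! ## Bicomplexes of free graded modules over the polynomial ring on the marks -/

/-- The total ring `ℚ[M]`. -/
abbrev TotalRing (M : Type) : Type := MvPolynomial M ℚ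

/-- The quantum degree on `ℚ[M]`: every variable has degree 2. -/
abbrev IsQHomogeneous {M : Type} (p : TotalRing M) (d : ℤ) : Prop :=
  MvPolynomial.IsWeightedHomogeneous (fun _ : M => (2 : ℤ)) p d

/-- A triply graded bicomplex of finitely generated free `ℚ[M]`-modules with a chosen homogeneous
basis `G`. The generator `g` has quantum degree `qdeg g`, Hochschild degree `adeg g` and
homological degree `tdeg g`. The differentials act on column vectors; they commute, preserve the
quantum degree, and `dg` lowers the Hochschild degree by one while `dc` raises the homological
degree by one. -/
structure FreeBicomplex (M : Type) where
  G : Type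
  [fintype : Fintype G]
  [decEq : DecidableEq G]
  qdeg : G → ℤ
  adeg : G → ℤ
  tdeg : G → ℤ
  dg : Matrix G G (TotalRing M)
  dc : Matrix G G (TotalRing M)
  dg_qdeg : ∀ g h, IsQHomogeneous (dg g h) (qdeg h - qdeg g)
  dc_qdeg : ∀ g h, IsQHomogeneous (dc g h) (qdeg h - qdeg g)
  dg_deg : ∀ g h, dg g h ≠ 0 → adeg h = adeg g + 1 ∧ tdeg h = tdeg g
  dc_deg : ∀ g h, dc g h ≠ 0 → adeg h = adeg g ∧ tdeg g = tdeg h + 1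
  dg_sq : dg * dg = 0
  dc_sq : dc * dc = 0
  comm : dg * dc = dc * dg

attribute [instance] FreeBicomplex.fintype FreeBicomplex.decEq

namespace FreeBicomplex

variable {M : Type}

/-- The diagonal matrix of signs `(-1)^{f g}`. -/
noncomputable def signs {G : Type} [DecidableEq G] (f : G → ℤ) : Matrix G G (TotalRing M) :=
  Matrix.diagonal fun g => (((Int.negOnePow (f g) : ℤˣ) : ℤ) : TotalRing M)

theorem signs_sq {G : Type} [Fintype G] [DecidableEq G] (f : G → ℤ) :
    (signs f : Matrix G G (TotalRing M)) * signs f = 1 := by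
  rw [signs, Matrix.diagonal_mul_diagonal, ← Matrix.diagonal_one]
  congr 1
  funext g
  rw [← Int.cast_mul, ← Units.val_mul, ← Int.negOnePow_add, Int.negOnePow_even _ ⟨f g, rfl⟩]
  simp

theorem signs_anticomm {G : Type} [Fintype G] [DecidableEq G] (f : G → ℤ)
    (A : Matrix G G (TotalRing M)) (hA : ∀ g h, A g h ≠ 0 → f h = f g + 1 ∨ f g = f h + 1) :
    A * signs f + signs f * A = 0 := by
  ext1 g h
  rw [Matrix.add_apply, signs, Matrix.mul_diagonal, Matrix.diagonal_mul, Matrix.zero_apply]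
  by_cases h0 : A g h = 0
  · simp [h0]
  · rcases hA g h h0 with h1 | h1 <;> rw [h1, Int.negOnePow_succ] <;> push_cast <;> ring

theorem signs_comm {G : Type} [Fintype G] [DecidableEq G] (f : G → ℤ)
    (A : Matrix G G (TotalRing M)) (hA : ∀ g h, A g h ≠ 0 → f h = f g) :
    A * signs f = signs f * A := by
  ext1 g h
  rw [signs, Matrix.mul_diagonal, Matrix.diagonal_mul]
  by_cases h0 : A g h = 0
  · simp [h0]
  · rw [hA g h h0]; ring

/-- `A ⊗ 1 + (-1)^f ⊗ B`, the differential of a tensor product. -/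
noncomputable def tensorD {G H : Type} [DecidableEq G] [DecidableEq H] (f : G → ℤ)
    (A : Matrix G G (TotalRing M)) (B : Matrix H H (TotalRing M)) :
    Matrix (G × H) (G × H) (TotalRing M) :=
  A ⊗ₖ (1 : Matrix H H (TotalRing M)) + signs f ⊗ₖ B

theorem tensorD_sq {G H : Type} [Fintype G] [Fintype H] [DecidableEq G] [DecidableEq H]
    (f : G → ℤ) (A : Matrix G G (TotalRing M)) (B : Matrix H H (TotalRing M))
    (hA : ∀ g h, A g h ≠ 0 → f h = f g + 1 ∨ f g = f h + 1) (hA2 : A * A = 0) (hB2 : B * B = 0) :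
    tensorD f A B * tensorD f A B = 0 := by
  have h := signs_anticomm f A hA
  simp only [tensorD, add_mul, mul_add, ← Matrix.mul_kronecker_mul, hA2, hB2, Matrix.one_mul,
    Matrix.mul_one, Matrix.zero_kronecker, Matrix.kronecker_zero, zero_add, add_zero]
  rw [← Matrix.add_kronecker, add_comm, h, Matrix.zero_kronecker]

theorem tensorD_apply_ne {G H : Type} [DecidableEq G] [DecidableEq H]
    {f : G → ℤ} {A : Matrix G G (TotalRing M)} {B : Matrix H H (TotalRing M)} {x y : G × H}
    (h : tensorD f A B x y ≠ 0) :
    (A x.1 y.1 ≠ 0 ∧ x.2 = y.2) ∨ (x.1 = y.1 ∧ B x.2 y.2 ≠ 0) := by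
  by_contra hc
  push Not at hc
  apply h
  rw [tensorD, Matrix.add_apply, Matrix.kronecker_apply, Matrix.kronecker_apply]
  have h1 : A x.1 y.1 * (1 : Matrix H H (TotalRing M)) x.2 y.2 = 0 := by
    by_cases h0 : A x.1 y.1 = 0
    · simp [h0]
    · rw [Matrix.one_apply_ne (hc.1 h0), mul_zero]
  have h2 : (signs f : Matrix G G (TotalRing M)) x.1 y.1 * B x.2 y.2 = 0 := by
    by_cases h0 : x.1 = y.1
    · rw [hc.2 h0, mul_zero]
    · rw [signs, Matrix.diagonal_apply_ne _ h0, zero_mul]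
  rw [h1, h2, add_zero]

theorem tensorD_qdeg {G H : Type} [DecidableEq G] [DecidableEq H]
    {f qG : G → ℤ} {qH : H → ℤ} {A : Matrix G G (TotalRing M)} {B : Matrix H H (TotalRing M)}
    (hA : ∀ g h, IsQHomogeneous (A g h) (qG h - qG g))
    (hB : ∀ g h, IsQHomogeneous (B g h) (qH h - qH g)) (x y : G × H) :
    IsQHomogeneous (tensorD f A B x y) (qG y.1 + qH y.2 - (qG x.1 + qH x.2)) := by
  rw [tensorD, Matrix.add_apply, Matrix.kronecker_apply, Matrix.kronecker_apply]
  refine Submodule.add_mem (MvPolynomial.weightedHomogeneousSubmodule ℚ _ _) ?_ ?_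
  · by_cases h : x.2 = y.2
    · rw [h, Matrix.one_apply_eq, mul_one, add_sub_add_right_eq_sub]
      exact hA _ _
    · rw [Matrix.one_apply_ne h, mul_zero]
      exact Submodule.zero_mem _
  · by_cases h : x.1 = y.1
    · rw [h, signs, Matrix.diagonal_apply_eq, add_sub_add_left_eq_sub, ← zsmul_eq_mul]
      exact Submodule.smul_of_tower_mem _ _ (hB _ _)
    · rw [signs, Matrix.diagonal_apply_ne _ h, zero_mul]
      exact Submodule.zero_mem _

/-- The bicomplex `ℚ[M]` concentrated in degree `q⁰a⁰t⁰`. -/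
noncomputable def unit (M : Type) : FreeBicomplex M where
  G := Unit
  qdeg _ := 0
  adeg _ := 0
  tdeg _ := 0
  dg := 0
  dc := 0
  dg_qdeg _ _ := Submodule.zero_mem (MvPolynomial.weightedHomogeneousSubmodule ℚ _ _)
  dc_qdeg _ _ := Submodule.zero_mem (MvPolynomial.weightedHomogeneousSubmodule ℚ _ _)
  dg_deg _ _ h := absurd rfl h
  dc_deg _ _ h := absurd rfl h
  dg_sq := Matrix.mul_zero _
  dc_sq := Matrix.mul_zero _
  comm := rfl

/-- Tensor product over `ℚ[M]`, for each of the two differentials the usual tensor product of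
chain complexes. -/
noncomputable def tensor (B C : FreeBicomplex M) : FreeBicomplex M where
  G := B.G × C.G
  qdeg x := B.qdeg x.1 + C.qdeg x.2
  adeg x := B.adeg x.1 + C.adeg x.2
  tdeg x := B.tdeg x.1 + C.tdeg x.2
  dg := tensorD B.adeg B.dg C.dg
  dc := tensorD B.tdeg B.dc C.dc
  dg_qdeg := tensorD_qdeg B.dg_qdeg C.dg_qdeg
  dc_qdeg := tensorD_qdeg B.dc_qdeg C.dc_qdeg
  dg_deg x y h := by
    rcases tensorD_apply_ne h with ⟨h1, h2⟩ | ⟨h1, h2⟩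
    · have := B.dg_deg _ _ h1
      rw [h2]; omega
    · have := C.dg_deg _ _ h2
      rw [h1]; omega
  dc_deg x y h := by
    rcases tensorD_apply_ne h with ⟨h1, h2⟩ | ⟨h1, h2⟩
    · have := B.dc_deg _ _ h1
      rw [h2]; omega
    · have := C.dc_deg _ _ h2
      rw [h1]; omega
  dg_sq := tensorD_sq _ _ _ (fun g h hne => Or.inl (B.dg_deg g h hne).1) B.dg_sq C.dg_sq
  dc_sq := tensorD_sq _ _ _ (fun g h hne => Or.inr (B.dc_deg g h hne).2) B.dc_sq C.dc_sq
  comm := by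
    have h1 : B.dg * signs B.tdeg = signs B.tdeg * B.dg :=
      signs_comm _ _ fun g h hne => (B.dg_deg g h hne).2
    have h2 : B.dc * signs B.adeg = signs B.adeg * B.dc :=
      signs_comm _ _ fun g h hne => (B.dc_deg g h hne).1
    have h3 : (signs B.adeg : Matrix B.G B.G (TotalRing M)) * signs B.tdeg =
        signs B.tdeg * signs B.adeg := by
      rw [signs, signs, Matrix.diagonal_mul_diagonal, Matrix.diagonal_mul_diagonal]
      simp only [mul_comm]
    simp only [tensorD, add_mul, mul_add, ← Matrix.mul_kronecker_mul, Matrix.one_mul,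
      Matrix.mul_one, B.comm, C.comm, h1, h2, h3]
    abel

end FreeBicomplex

/-! ## The bicomplexes of the elementary pieces -/

section Local

variable {M : Type}

open MvPolynomial in
/-- `C(arc) : q²a E ⟶ E`, multiplication by `y - x`. -/
noncomputable def arcD (x y : M) : Matrix (Fin 2) (Fin 2) (TotalRing M) :=
  !![0, X y - X x;
     0, 0]

open MvPolynomial in
/-- The Koszul complex of two parallel arcs `x₁ → y₁`, `x₂ → y₂`, in the form
`a²q⁴E ⟶ aq²E ⊕ aq²E ⟶ E`. Basis `0` has Hochschild degree 0, bases `1, 2` have Hochschild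
degree 1, basis `3` has Hochschild degree 2. -/
noncomputable def arcsD (x₁ x₂ y₁ y₂ : M) : Matrix (Fin 4) (Fin 4) (TotalRing M) :=
  !![0, X x₂ - X y₂, X y₁ - X x₁, 0;
     0, 0, 0, X y₁ - X x₁;
     0, 0, 0, X y₂ - X x₂;
     0, 0, 0, 0]

open MvPolynomial in
/-- The Koszul complex of the MOY vertex, in the form `a²q⁶E ⟶ aq²E ⊕ aq⁴E ⟶ E`. -/
noncomputable def wideD (x₁ x₂ y₁ y₂ : M) : Matrix (Fin 4) (Fin 4) (TotalRing M) :=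
  !![0, X x₁ + X x₂ - X y₁ - X y₂, (X y₁ - X x₁) * (X y₁ - X x₂), 0;
     0, 0, 0, (X y₁ - X x₁) * (X y₁ - X x₂);
     0, 0, 0, X y₁ + X y₂ - X x₁ - X x₂;
     0, 0, 0, 0]

open MvPolynomial in
/-- The map `χᵢ : C(arcs) ⟶ q⁻²C(wide)`. -/
noncomputable def chiIn (x₂ y₁ : M) : Matrix (Fin 4) (Fin 4) (TotalRing M) :=
  !![X y₁ - X x₂, 0, 0, 0;
     0, X y₁ - X x₂, 0, 0;
     0, 1, 1, 0;
     0, 0, 0, 1]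

open MvPolynomial in
/-- The map `χₒ : C(wide) ⟶ C(arcs)`. -/
noncomputable def chiOut (x₂ y₁ : M) : Matrix (Fin 4) (Fin 4) (TotalRing M) :=
  !![1, 0, 0, 0;
     0, 1, 0, 0;
     0, -1, X y₁ - X x₂, 0;
     0, 0, 0, X y₁ - X x₂]

/-- Hochschild degrees of a Koszul complex with two rows. -/
def koszulA : Fin 4 → ℤ := ![0, 1, 1, 2]

/-- Quantum degrees for two parallel arcs. -/
def arcsQ : Fin 4 → ℤ := ![0, 2, 2, 4]

/-- Quantum degrees for the MOY vertex. -/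
def wideQ : Fin 4 → ℤ := ![0, 2, 4, 6]

theorem isQHomogeneous_X (x : M) : IsQHomogeneous (MvPolynomial.X x) 2 :=
  MvPolynomial.isWeightedHomogeneous_X ℚ _ x

theorem isQHomogeneous_zero (d : ℤ) : IsQHomogeneous (0 : TotalRing M) d :=
  MvPolynomial.isWeightedHomogeneous_zero ℚ _ d

theorem isQHomogeneous_one : IsQHomogeneous (1 : TotalRing M) 0 :=
  MvPolynomial.isWeightedHomogeneous_one ℚ _

theorem IsQHomogeneous.add {p r : TotalRing M} {d : ℤ} (hp : IsQHomogeneous p d)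
    (hr : IsQHomogeneous r d) : IsQHomogeneous (p + r) d :=
  MvPolynomial.IsWeightedHomogeneous.add hp hr

theorem IsQHomogeneous.neg {p : TotalRing M} {d : ℤ} (hp : IsQHomogeneous p d) :
    IsQHomogeneous (-p) d :=
  Submodule.neg_mem (MvPolynomial.weightedHomogeneousSubmodule ℚ _ _) hp

theorem IsQHomogeneous.sub {p r : TotalRing M} {d : ℤ} (hp : IsQHomogeneous p d)
    (hr : IsQHomogeneous r d) : IsQHomogeneous (p - r) d :=
  Submodule.sub_mem (MvPolynomial.weightedHomogeneousSubmodule ℚ _ _) hp hr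

theorem arcD_qdeg (x y : M) (g h : Fin 2) :
    IsQHomogeneous (arcD x y g h) ((![0, 2] : Fin 2 → ℤ) h - (![0, 2] : Fin 2 → ℤ) g) := by
  have hd := (isQHomogeneous_X y).sub (isQHomogeneous_X x)
  fin_cases g <;> fin_cases h <;> first | exact isQHomogeneous_zero _ | exact hd

theorem arcsD_qdeg (x₁ x₂ y₁ y₂ : M) (g h : Fin 4) :
    IsQHomogeneous (arcsD x₁ x₂ y₁ y₂ g h) (arcsQ h - arcsQ g) := by
  have h1 := (isQHomogeneous_X x₂).sub (isQHomogeneous_X y₂)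
  have h2 := (isQHomogeneous_X y₁).sub (isQHomogeneous_X x₁)
  have h3 := (isQHomogeneous_X y₂).sub (isQHomogeneous_X x₂)
  fin_cases g <;> fin_cases h <;>
    first | exact isQHomogeneous_zero _ | exact h1 | exact h2 | exact h3

theorem wideD_qdeg (x₁ x₂ y₁ y₂ : M) (g h : Fin 4) :
    IsQHomogeneous (wideD x₁ x₂ y₁ y₂ g h) (wideQ h - wideQ g) := by
  have h1 := (((isQHomogeneous_X x₁).add (isQHomogeneous_X x₂)).sub (isQHomogeneous_X y₁)).sub
    (isQHomogeneous_X y₂)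
  have h2 := (((isQHomogeneous_X y₁).add (isQHomogeneous_X y₂)).sub (isQHomogeneous_X x₁)).sub
    (isQHomogeneous_X x₂)
  have h3 : IsQHomogeneous _ (2 + 2) := MvPolynomial.IsWeightedHomogeneous.mul
    ((isQHomogeneous_X y₁).sub (isQHomogeneous_X x₁))
    ((isQHomogeneous_X y₁).sub (isQHomogeneous_X x₂))
  fin_cases g <;> fin_cases h <;>
    first | exact isQHomogeneous_zero _ | exact h1 | exact h2 | exact h3

theorem chiIn_qdeg (x₂ y₁ : M) (g h : Fin 4) :
    IsQHomogeneous (chiIn x₂ y₁ g h) (arcsQ h - (wideQ g - 2)) := by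
  have h1 := (isQHomogeneous_X y₁).sub (isQHomogeneous_X x₂)
  fin_cases g <;> fin_cases h <;>
    first | exact isQHomogeneous_zero _ | exact isQHomogeneous_one | exact h1

theorem chiOut_qdeg (x₂ y₁ : M) (g h : Fin 4) :
    IsQHomogeneous (chiOut x₂ y₁ g h) (wideQ h - arcsQ g) := by
  have h1 := (isQHomogeneous_X y₁).sub (isQHomogeneous_X x₂)
  fin_cases g <;> fin_cases h <;>
    first
    | exact isQHomogeneous_zero _ | exact isQHomogeneous_one | exact isQHomogeneous_one.neg
    | exact h1

theorem arcsD_adeg (x₁ x₂ y₁ y₂ : M) (g h : Fin 4) (hne : arcsD x₁ x₂ y₁ y₂ g h ≠ 0) :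
    koszulA h = koszulA g + 1 := by
  fin_cases g <;> fin_cases h <;> first | rfl | exact absurd rfl hne

theorem wideD_adeg (x₁ x₂ y₁ y₂ : M) (g h : Fin 4) (hne : wideD x₁ x₂ y₁ y₂ g h ≠ 0) :
    koszulA h = koszulA g + 1 := by
  fin_cases g <;> fin_cases h <;> first | rfl | exact absurd rfl hne

theorem chiIn_adeg (x₂ y₁ : M) (g h : Fin 4) (hne : chiIn x₂ y₁ g h ≠ 0) :
    koszulA h = koszulA g := by
  fin_cases g <;> fin_cases h <;> first | rfl | exact absurd rfl hne

theorem chiOut_adeg (x₂ y₁ : M) (g h : Fin 4) (hne : chiOut x₂ y₁ g h ≠ 0) :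
    koszulA h = koszulA g := by
  fin_cases g <;> fin_cases h <;> first | rfl | exact absurd rfl hne

theorem arcsD_sq (x₁ x₂ y₁ y₂ : M) : arcsD x₁ x₂ y₁ y₂ * arcsD x₁ x₂ y₁ y₂ = 0 := by
  ext1 g h
  fin_cases g <;> fin_cases h <;> simp [arcsD, Matrix.mul_apply, Fin.sum_univ_four]
  ring

theorem wideD_sq (x₁ x₂ y₁ y₂ : M) : wideD x₁ x₂ y₁ y₂ * wideD x₁ x₂ y₁ y₂ = 0 := by
  ext1 g h
  fin_cases g <;> fin_cases h <;> simp [wideD, Matrix.mul_apply, Fin.sum_univ_four]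
  ring

theorem chiIn_comm (x₁ x₂ y₁ y₂ : M) :
    wideD x₁ x₂ y₁ y₂ * chiIn x₂ y₁ = chiIn x₂ y₁ * arcsD x₁ x₂ y₁ y₂ := by
  ext1 g h
  fin_cases g <;> fin_cases h <;>
    simp [wideD, arcsD, chiIn, Matrix.mul_apply, Fin.sum_univ_four] <;> ring

theorem chiOut_comm (x₁ x₂ y₁ y₂ : M) :
    arcsD x₁ x₂ y₁ y₂ * chiOut x₂ y₁ = chiOut x₂ y₁ * wideD x₁ x₂ y₁ y₂ := by
  ext1 g h
  fin_cases g <;> fin_cases h <;>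
    simp [wideD, arcsD, chiOut, Matrix.mul_apply, Fin.sum_univ_four] <;> ring

/-- `C(arc)`. -/
noncomputable def arcC (x y : M) : FreeBicomplex M where
  G := Fin 2
  qdeg := ![0, 2]
  adeg := ![0, 1]
  tdeg _ := 0
  dg := arcD x y
  dc := 0
  dg_qdeg := arcD_qdeg x y
  dc_qdeg _ _ := isQHomogeneous_zero _
  dg_deg g h hne := by
    fin_cases g <;> fin_cases h <;> first | exact ⟨rfl, rfl⟩ | exact absurd rfl hne
  dc_deg _ _ h := absurd rfl h
  dg_sq := by
    ext1 g h
    fin_cases g <;> fin_cases h <;> simp [arcD, Matrix.mul_apply]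
  dc_sq := Matrix.mul_zero _
  comm := by rw [Matrix.mul_zero, Matrix.zero_mul]

/-- `C(wide)`. -/
noncomputable def wideC (x₁ x₂ y₁ y₂ : M) : FreeBicomplex M where
  G := Fin 4
  qdeg := wideQ
  adeg := koszulA
  tdeg _ := 0
  dg := wideD x₁ x₂ y₁ y₂
  dc := 0
  dg_qdeg := wideD_qdeg x₁ x₂ y₁ y₂
  dc_qdeg _ _ := isQHomogeneous_zero _
  dg_deg g h hne := ⟨wideD_adeg _ _ _ _ g h hne, rfl⟩
  dc_deg _ _ h := absurd rfl h
  dg_sq := wideD_sq _ _ _ _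
  dc_sq := Matrix.mul_zero _
  comm := by rw [Matrix.mul_zero, Matrix.zero_mul]

/-- The positive crossing `C(arcs) ⟶ t q⁻² C(wide)` with horizontal differential `χᵢ`; the left
summand of the basis belongs to the arcs. -/
noncomputable def posC (x₁ x₂ y₁ y₂ : M) : FreeBicomplex M where
  G := Fin 4 ⊕ Fin 4
  qdeg := Sum.elim arcsQ fun g => wideQ g - 2
  adeg := Sum.elim koszulA koszulA
  tdeg := Sum.elim (fun _ => 0) fun _ => 1
  dg := Matrix.fromBlocks (arcsD x₁ x₂ y₁ y₂) 0 0 (wideD x₁ x₂ y₁ y₂)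
  dc := Matrix.fromBlocks 0 0 (chiIn x₂ y₁) 0
  dg_qdeg := by
    rintro (g | g) (h | h)
    · exact arcsD_qdeg x₁ x₂ y₁ y₂ g h
    · exact isQHomogeneous_zero _
    · exact isQHomogeneous_zero _
    · simpa using wideD_qdeg x₁ x₂ y₁ y₂ g h
  dc_qdeg := by
    rintro (g | g) (h | h)
    · exact isQHomogeneous_zero _
    · exact isQHomogeneous_zero _
    · exact chiIn_qdeg x₂ y₁ g h
    · exact isQHomogeneous_zero _
  dg_deg := by
    rintro (g | g) (h | h) hne
    · exact ⟨arcsD_adeg x₁ x₂ y₁ y₂ g h hne, rfl⟩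
    · exact absurd rfl hne
    · exact absurd rfl hne
    · exact ⟨wideD_adeg x₁ x₂ y₁ y₂ g h hne, rfl⟩
  dc_deg := by
    rintro (g | g) (h | h) hne
    · exact absurd rfl hne
    · exact absurd rfl hne
    · exact ⟨chiIn_adeg x₂ y₁ g h hne, rfl⟩
    · exact absurd rfl hne
  dg_sq := by simp [Matrix.fromBlocks_multiply, arcsD_sq, wideD_sq]
  dc_sq := by simp [Matrix.fromBlocks_multiply]
  comm := by simp [Matrix.fromBlocks_multiply, chiIn_comm]

/-- The negative crossing `t⁻¹ C(wide) ⟶ C(arcs)` with horizontal differential `χₒ`; the left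
summand of the basis belongs to the MOY vertex. -/
noncomputable def negC (x₁ x₂ y₁ y₂ : M) : FreeBicomplex M where
  G := Fin 4 ⊕ Fin 4
  qdeg := Sum.elim wideQ arcsQ
  adeg := Sum.elim koszulA koszulA
  tdeg := Sum.elim (fun _ => -1) fun _ => 0
  dg := Matrix.fromBlocks (wideD x₁ x₂ y₁ y₂) 0 0 (arcsD x₁ x₂ y₁ y₂)
  dc := Matrix.fromBlocks 0 0 (chiOut x₂ y₁) 0
  dg_qdeg := by
    rintro (g | g) (h | h)
    · exact wideD_qdeg x₁ x₂ y₁ y₂ g h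
    · exact isQHomogeneous_zero _
    · exact isQHomogeneous_zero _
    · exact arcsD_qdeg x₁ x₂ y₁ y₂ g h
  dc_qdeg := by
    rintro (g | g) (h | h)
    · exact isQHomogeneous_zero _
    · exact isQHomogeneous_zero _
    · exact chiOut_qdeg x₂ y₁ g h
    · exact isQHomogeneous_zero _
  dg_deg := by
    rintro (g | g) (h | h) hne
    · exact ⟨wideD_adeg x₁ x₂ y₁ y₂ g h hne, rfl⟩
    · exact absurd rfl hne
    · exact absurd rfl hne
    · exact ⟨arcsD_adeg x₁ x₂ y₁ y₂ g h hne, rfl⟩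
  dc_deg := by
    rintro (g | g) (h | h) hne
    · exact absurd rfl hne
    · exact absurd rfl hne
    · exact ⟨chiOut_adeg x₂ y₁ g h hne, rfl⟩
    · exact absurd rfl hne
  dg_sq := by simp [Matrix.fromBlocks_multiply, arcsD_sq, wideD_sq]
  dc_sq := by simp [Matrix.fromBlocks_multiply]
  comm := by simp [Matrix.fromBlocks_multiply, chiOut_comm]

/-- The bicomplex of an elementary piece. -/
noncomputable def Piece.bicomplex : Piece M → FreeBicomplex M
  | .arc x y => arcC x y
  | .pos x₁ x₂ y₁ y₂ => posC x₁ x₂ y₁ y₂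
  | .neg x₁ x₂ y₁ y₂ => negC x₁ x₂ y₁ y₂
  | .wide x₁ x₂ y₁ y₂ => wideC x₁ x₂ y₁ y₂

end Local

/-- The bicomplex `C(D)`: the tensor product of the bicomplexes of the pieces, all of them over
the polynomial ring on all marks, so that glued ends carry the same variable. -/
noncomputable def Diagram.bicomplex (D : Diagram) : FreeBicomplex D.Mark :=
  D.pieces.foldr (fun p B => p.bicomplex.tensor B) (FreeBicomplex.unit D.Mark)

/-! ## Homology -/

section Homology

variable {R V : Type} [CommRing R] [Algebra ℚ R] [AddCommGroup V] [Module R V] [Module ℚ V]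
  [IsScalarTower ℚ R V]

/-- The homology `ker d / im d` of a module with an endomorphism `d` such that `d² = 0`. -/
abbrev Homology (d : V →ₗ[R] V) : Type :=
  LinearMap.ker d ⧸ (LinearMap.range d).submoduleOf (LinearMap.ker d)

/-- The classes of the cycles that lie in a given `ℚ`-subspace `W`. For a homogeneous component
`W` of a graded module this is the corresponding homogeneous component of the homology. -/
def homologyPart (d : V →ₗ[R] V) (W : Submodule ℚ V) : Submodule ℚ (Homology d) :=
  (W.comap ((LinearMap.ker d).subtype.restrictScalars ℚ)).map
    (((LinearMap.range d).submoduleOf (LinearMap.ker d)).mkQ.restrictScalars ℚ)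

/-- The map induced on the homology of `d` by an endomorphism `e` that commutes with `d`. -/
def homologyMap (d e : V →ₗ[R] V) (h : d ∘ₗ e = e ∘ₗ d) : Homology d →ₗ[R] Homology d :=
  Submodule.mapQ _ _
    (e.restrict (p := LinearMap.ker d) (q := LinearMap.ker d) fun v hv => by
      rw [LinearMap.mem_ker] at hv ⊢
      rw [← LinearMap.comp_apply, h, LinearMap.comp_apply, hv, map_zero])
    (by
      rintro ⟨v, hv⟩ ⟨w, hw⟩
      refine ⟨e w, ?_⟩
      have h1 : d (e w) = e (d w) := LinearMap.congr_fun h w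
      rw [h1, hw]
      rfl)

end Homology

namespace FreeBicomplex

variable {M : Type}

/-- The underlying free module. -/
abbrev Chains (B : FreeBicomplex M) : Type := B.G → TotalRing M

/-- The component of degree `qⁱaʲtᵏ` of the underlying free module. -/
def chainsPart (B : FreeBicomplex M) (i j k : ℤ) : Submodule ℚ B.Chains where
  carrier := {v | ∀ g, IsQHomogeneous (v g) (i - B.qdeg g) ∧
    (v g ≠ 0 → B.adeg g = j ∧ B.tdeg g = k)}
  zero_mem' _ := ⟨isQHomogeneous_zero _, fun h => absurd rfl h⟩
  add_mem' {v w} hv hw g := by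
    refine ⟨(hv g).1.add (hw g).1, fun h => ?_⟩
    by_cases hvg : v g = 0
    · refine (hw g).2 fun hwg => h ?_
      rw [Pi.add_apply, hvg, hwg, add_zero]
    · exact (hv g).2 hvg
  smul_mem' c v hv g := by
    refine ⟨Submodule.smul_mem (MvPolynomial.weightedHomogeneousSubmodule ℚ _ _) c (hv g).1,
      fun h => (hv g).2 fun hvg => h ?_⟩
    rw [Pi.smul_apply, hvg, smul_zero]

/-- The differential `d_g`. -/
noncomputable def dgMap (B : FreeBicomplex M) : B.Chains →ₗ[TotalRing M] B.Chains :=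
  B.dg.mulVecLin

/-- The differential `d_c`. -/
noncomputable def dcMap (B : FreeBicomplex M) : B.Chains →ₗ[TotalRing M] B.Chains :=
  B.dc.mulVecLin

theorem dgMap_comp_dcMap (B : FreeBicomplex M) : B.dgMap ∘ₗ B.dcMap = B.dcMap ∘ₗ B.dgMap := by
  rw [dgMap, dcMap, ← Matrix.mulVecLin_mul, ← Matrix.mulVecLin_mul, B.comm]

/-- The differential induced by `d_c` on the homology of `d_g`. -/
noncomputable def dcStar (B : FreeBicomplex M) :
    Homology B.dgMap →ₗ[TotalRing M] Homology B.dgMap :=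
  homologyMap B.dgMap B.dcMap B.dgMap_comp_dcMap

end FreeBicomplex

/-- The HOMFLY-PT homology `H(D) = H_{d_c*}(H_{d_g}(C(D)))`. -/
abbrev Diagram.HHH (D : Diagram) : Type := Homology D.bicomplex.dcStar

/-- The component of `H(D)` of degree `qⁱaʲtᵏ`. -/
noncomputable def Diagram.part (D : Diagram) (i j k : ℤ) : Submodule ℚ D.HHH :=
  homologyPart D.bicomplex.dcStar
    (homologyPart D.bicomplex.dgMap (D.bicomplex.chainsPart i j k))

/-! ## The polynomial `P^b` -/

/-- The field `ℤ(q, a)` of rational functions, as `ℚ(a)(q)`. -/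
abbrev Qqa : Type := RatFunc (RatFunc ℚ)

/-- The variable `q`. -/
noncomputable def q : Qqa := RatFunc.X

/-- The variable `a`. -/
noncomputable def a : Qqa := RatFunc.C RatFunc.X

/-- The expansion of a rational function at `q = 0`, a Laurent series in `q` over `ℚ(a)`. -/
noncomputable def laurentExpansion (F : Qqa) : LaurentSeries (RatFunc ℚ) :=
  (RatFunc.coeToLaurentSeries (F := RatFunc ℚ)).coe F

/-- The coefficient of `qⁱaʲ` in the Poincaré series `∑ dim H(D)ᵢⱼₖ qⁱaʲtᵏ` at `t = -1`. -/
noncomputable def Diagram.coeffAtNegOne (D : Diagram) (i j : ℤ) : ℤ :=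
  ∑ᶠ k : ℤ, ((Int.negOnePow k : ℤˣ) : ℤ) * (Module.finrank ℚ (D.part i j k) : ℤ)

/-- The Poincaré series of `H(D)` can be evaluated at `t = -1` and the result is (the expansion
at `q = 0` of) the rational function `F`: the components of `H(D)` have finite dimension, for
each `i` only finitely many of the `H(D)ᵢⱼₖ` are nonzero, and the coefficient of `qⁱ` in the
Laurent series of `F`, an element of `ℚ(a)`, is `∑ⱼ (∑ₖ (-1)ᵏ dim H(D)ᵢⱼₖ) aʲ`. -/
def Diagram.IsPoincareAtNegOne (D : Diagram) (F : Qqa) : Prop :=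
  (∀ i j k : ℤ, FiniteDimensional ℚ (D.part i j k)) ∧
  (∀ i : ℤ, {jk : ℤ × ℤ | D.part i jk.1 jk.2 ≠ ⊥}.Finite) ∧
  ∀ i : ℤ, (laurentExpansion F).coeff i =
    ∑ᶠ j : ℤ, (D.coeffAtNegOne i j : RatFunc ℚ) * (RatFunc.X : RatFunc ℚ) ^ j

open Classical in
/-- `P^b(D) ∈ ℤ(q, a)`, the Poincaré series of `H(D)` evaluated at `t = -1`. -/
noncomputable def Pb (D : Diagram) : Qqa :=
  if h : ∃ F, D.IsPoincareAtNegOne F then h.choose else 0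

end HomflyPT

open HomflyPT

namespace HomflyPT

/-! ## Graded chain complexes over a graded ring -/

/-! The horizontal differential does not influence $P^b$. In fixed quantum and Hochschild degree,
`d_{c*}` is a differential on the finite-dimensional graded space $H(C(D), d_g)$, and passing to its
homology does not change the Euler characteristic in the homological degree
(`FreeBicomplex.chi_toCx`). So $P^b(D)$ is the Poincaré series of $H(C(D), d_g)$ at $t=-1$. With
`d_c` forgotten, a crossing is the direct sum of two arcs and a shifted MOY vertex $b$, and a
homological shift by one becomes a sign: a positive crossing is $1 - q^{-2}b$ and a negative one is
$1 - b$. Hence $P^b$ is a sum, over all resolutions of the crossings, of series of Koszul complexes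
over the polynomial ring on the marks (`stateSum`, `bicomplex_series`). The resolution formulas are
immediate from this, and the skein relation is a linear combination of them.

The rest is a calculus of Koszul complexes. Their series `kser` depends only on the rows up to
order, sign and adding multiples of one row to another; a zero row of degree $d$ contributes the
factor $1 + aq^d$. A variable $X$ is removed in one of three ways: a row $X - p$ eliminates it
(`kser_eliminate`); if $X$ occurs only in a row $\delta X$, the constants split off (`kser_mul_X`);
if it occurs only in a monic quadratic row and a row $cX$, the complex splits into two over the
smaller ring (`kser_quadratic`). Each rule is an isomorphism or a surjection with acyclic kernel
(`Cx.IsQ`). Such maps survive taking further cones, so a relation between tangles proved with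
arbitrary additional rows holds for diagrams (`stateSum_relation`).

The MOY relations follow by removing the inner marks of the tangles. From $b^2 = (1+q^2)b$ one gets
$(1-q^{-2}b)(1-b) = 1$, the Reidemeister II moves. On three strands $b_1b_2b_1 = q^2b_1 + S$, where
$S$ is the Koszul complex that identifies the elementary symmetric functions of the lower ends with
those of the upper ends (`kser_three_vertices`). Since $S$ is unchanged by left-right reflection,
MOY III follows, and the expansion of $(1-q^{-2}b_1)(1-q^{-2}b_2)(1-q^{-2}b_1)$ becomes symmetric in
$b_1, b_2$, which is Reidemeister III.

Rationality is a Hilbert–Serre argument for cycles modulo boundaries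
(`FreeBicomplex.hilbert_sub_mem_range`). Expansion at $q=0$ is an injective field homomorphism, so
$P^b$ is determined by its Laurent series, and all relations may be checked on Laurent series. -/

/-- A nonnegative grading of a `ℚ`-algebra by finite-dimensional subspaces. -/
class GradedAlg {A : Type} [CommRing A] [Algebra ℚ A] (gr : ℤ → Submodule ℚ A) : Prop where
  one_mem : (1 : A) ∈ gr 0
  mul_mem : ∀ {i j : ℤ} {x y : A}, x ∈ gr i → y ∈ gr j → x * y ∈ gr (i + j)
  finite : ∀ i, FiniteDimensional ℚ (gr i)
  eq_bot : ∀ i, i < 0 → gr i = ⊥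

/-- A homogeneous element of a graded ring together with its degree. -/
@[ext] structure HElt {A : Type} [CommRing A] [Algebra ℚ A] (gr : ℤ → Submodule ℚ A) where
  deg : ℤ
  val : A
  mem : val ∈ gr deg

/-- A chain complex of modules over a graded ring, with quantum degree, Hochschild degree (lowered
by the differential) and homological degree. -/
structure Cx {A : Type} [CommRing A] [Algebra ℚ A] (gr : ℤ → Submodule ℚ A) where
  V : Type
  [addCommGroup : AddCommGroup V]
  [module : Module A V]
  [moduleRat : Module ℚ V]
  [tower : IsScalarTower ℚ A V]
  part : ℤ → ℤ → ℤ → Submodule ℚ V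
  d : V →ₗ[A] V
  d_sq : ∀ v, d (d v) = 0
  d_mem : ∀ {i j k v}, v ∈ part i (j + 1) k → d v ∈ part i j k
  smul_mem : ∀ {e i j k} {r : A} {v : V}, r ∈ gr e → v ∈ part i j k → r • v ∈ part (e + i) j k
  finite : ∀ i j k, FiniteDimensional ℚ (part i j k)
  bounded : ∃ N : ℤ, ∀ i j k, part i j k ≠ ⊥ → -N ≤ i ∧ |j| ≤ N ∧ |k| ≤ N

attribute [instance] Cx.addCommGroup Cx.module Cx.moduleRat Cx.tower Cx.finite

namespace Cx

variable {A : Type} [CommRing A] [Algebra ℚ A] {gr : ℤ → Submodule ℚ A}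

/-- The differential as a `ℚ`-linear map. -/
def dRat (C : Cx gr) : C.V →ₗ[ℚ] C.V := C.d.restrictScalars ℚ

/-- Cycles of a given degree. -/
def cycles (C : Cx gr) (i j k : ℤ) : Submodule ℚ C.V := LinearMap.ker C.dRat ⊓ C.part i j k

/-- Boundaries of a given degree. -/
def bounds (C : Cx gr) (i j k : ℤ) : Submodule ℚ C.V := (C.part i (j + 1) k).map C.dRat

instance (C : Cx gr) (i j k : ℤ) : FiniteDimensional ℚ (C.cycles i j k) :=
  Submodule.finiteDimensional_of_le (inf_le_right : _ ≤ C.part i j k)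

instance (C : Cx gr) (i j k : ℤ) : FiniteDimensional ℚ (C.bounds i j k) := by
  unfold bounds; infer_instance

theorem bounds_le_cycles (C : Cx gr) (i j k : ℤ) : C.bounds i j k ≤ C.cycles i j k := by
  rintro _ ⟨w, hw, rfl⟩
  exact ⟨C.d_sq w, C.d_mem hw⟩

/-- The dimension of the homology in a given degree. -/
noncomputable def hdim (C : Cx gr) (i j k : ℤ) : ℤ :=
  (Module.finrank ℚ (C.cycles i j k) : ℤ) - Module.finrank ℚ (C.bounds i j k)

theorem hdim_eq_zero (C : Cx gr) {i j k : ℤ} (h : C.part i j k = ⊥) : C.hdim i j k = 0 := by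
  have h1 : C.cycles i j k = ⊥ := by rw [cycles, h, inf_bot_eq]
  have h2 : C.bounds i j k = ⊥ := le_bot_iff.mp (h1 ▸ C.bounds_le_cycles i j k)
  rw [hdim, h1, h2, sub_self]

end Cx

/-! ### Dimension counts for subspaces of rational vector spaces. -/

section rank

variable {V W : Type} [AddCommGroup V] [Module ℚ V] [AddCommGroup W] [Module ℚ W]

/-- Rank–nullity for the restriction to `P`. The kernel is kept as a subspace of the ambient space,
so that the kernels for different `P`, such as cycles and boundaries, can be compared. -/
theorem finrank_eq_map_add_ker (φ : V →ₗ[ℚ] W) (P : Submodule ℚ V) [FiniteDimensional ℚ P] :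
    Module.finrank ℚ P = Module.finrank ℚ (P.map φ) +
      Module.finrank ℚ (LinearMap.ker φ ⊓ P : Submodule ℚ V) := by
  have h := LinearMap.finrank_range_add_finrank_ker (φ.domRestrict P)
  rw [← h, LinearMap.range_domRestrict]
  congr 1
  have : (LinearMap.ker φ ⊓ P : Submodule ℚ V) =
      (LinearMap.ker (φ.domRestrict P)).map P.subtype := by
    ext v
    simp only [Submodule.mem_inf, LinearMap.mem_ker, Submodule.mem_map, Submodule.subtype_apply,
      Subtype.exists, LinearMap.domRestrict_apply]
    exact ⟨fun h => ⟨v, h.2, h.1, rfl⟩, by rintro ⟨v, h, h', rfl⟩; exact ⟨h', h⟩⟩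
  rw [this]
  exact (Submodule.finrank_map_subtype_eq P _).symm

/-- The product of two subspaces, as a space. -/
def prodSubmoduleEquiv (P : Submodule ℚ V) (Q : Submodule ℚ W) : P.prod Q ≃ₗ[ℚ] P × Q where
  toFun x := (⟨x.1.1, x.2.1⟩, ⟨x.1.2, x.2.2⟩)
  invFun x := ⟨(x.1.1, x.2.1), x.1.2, x.2.2⟩
  map_add' _ _ := rfl
  map_smul' _ _ := rfl
  left_inv _ := rfl
  right_inv _ := rfl

theorem finrank_prod_submodule (P : Submodule ℚ V) (Q : Submodule ℚ W) [FiniteDimensional ℚ P]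
    [FiniteDimensional ℚ Q] :
    Module.finrank ℚ (P.prod Q) = Module.finrank ℚ P + Module.finrank ℚ Q := by
  rw [← Module.finrank_prod]
  exact (prodSubmoduleEquiv P Q).finrank_eq

instance finite_prod_submodule (P : Submodule ℚ V) (Q : Submodule ℚ W) [FiniteDimensional ℚ P]
    [FiniteDimensional ℚ Q] : FiniteDimensional ℚ (P.prod Q) :=
  Module.Finite.equiv (prodSubmoduleEquiv P Q).symm

end rank

namespace Cx

variable {A : Type} [CommRing A] [Algebra ℚ A] {gr : ℤ → Submodule ℚ A}

/-! ### Operations -/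

/-- The mapping cone of multiplication by a homogeneous element. -/
def cone (f : HElt gr) (C : Cx gr) : Cx gr where
  V := C.V × C.V
  part i j k := (C.part i j k).prod (C.part (i - f.deg) (j - 1) k)
  -- The minus sign in the second component makes the two terms `f • d w` of the square cancel.
  d := (C.d.comp (LinearMap.fst A _ _) + f.val • LinearMap.snd A _ _).prod
    (-(C.d.comp (LinearMap.snd A _ _)))
  d_sq v := by
    ext <;> simp [C.d_sq]
  d_mem {i j k v} h := by
    obtain ⟨h1, h2⟩ := h
    rw [add_sub_cancel_right] at h2
    refine ⟨?_, ?_⟩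
    · have := C.smul_mem f.mem h2
      rw [add_sub_cancel] at this
      exact add_mem (C.d_mem h1) this
    · refine neg_mem (C.d_mem ?_)
      rwa [sub_add_cancel]
  smul_mem {e i j k r v} hr hv := by
    refine ⟨C.smul_mem hr hv.1, ?_⟩
    rw [add_sub_assoc]
    exact C.smul_mem hr hv.2
  finite i j k := finite_prod_submodule _ _
  bounded := by
    obtain ⟨N, hN⟩ := C.bounded
    refine ⟨N + |f.deg| + 1, fun i j k h => ?_⟩
    have hd := abs_le.mp (le_refl |f.deg|)
    by_cases h1 : C.part i j k = ⊥
    · by_cases h2 : C.part (i - f.deg) (j - 1) k = ⊥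
      · exact absurd (by rw [h1, h2, Submodule.prod_bot]) h
      · have := hN _ _ _ h2
        rw [abs_le, abs_le] at *
        omega
    · have := hN _ _ _ h1
      rw [abs_le, abs_le] at *
      omega

/-- Direct sum. -/
def prod (C C' : Cx gr) : Cx gr where
  V := C.V × C'.V
  part i j k := (C.part i j k).prod (C'.part i j k)
  d := C.d.prodMap C'.d
  d_sq v := by ext <;> simp [C.d_sq, C'.d_sq]
  d_mem h := ⟨C.d_mem h.1, C'.d_mem h.2⟩
  smul_mem hr hv := ⟨C.smul_mem hr hv.1, C'.smul_mem hr hv.2⟩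
  finite i j k := finite_prod_submodule _ _
  bounded := by
    obtain ⟨N, hN⟩ := C.bounded
    obtain ⟨N', hN'⟩ := C'.bounded
    refine ⟨max N N', fun i j k h => ?_⟩
    by_cases h1 : C.part i j k = ⊥
    · by_cases h2 : C'.part i j k = ⊥
      · exact absurd (by rw [h1, h2, Submodule.prod_bot]) h
      · have := hN' _ _ _ h2
        rw [abs_le, abs_le] at *
        omega
    · have := hN _ _ _ h1
      rw [abs_le, abs_le] at *
      omega

/-- Shift of the three degrees. -/
def shift (m n s : ℤ) (C : Cx gr) : Cx gr where
  V := C.V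
  part i j k := C.part (i - m) (j - n) (k - s)
  d := C.d
  d_sq := C.d_sq
  d_mem {i j k v} h := C.d_mem (by rwa [sub_add_eq_add_sub])
  smul_mem hr hv := by
    rw [add_sub_assoc]
    exact C.smul_mem hr hv
  finite i j k := C.finite _ _ _
  bounded := by
    obtain ⟨N, hN⟩ := C.bounded
    refine ⟨N + |m| + |n| + |s|, fun i j k h => ?_⟩
    have := hN _ _ _ h
    have h1 := abs_le.mp (le_refl |m|)
    have h2 := abs_le.mp (le_refl |n|)
    have h3 := abs_le.mp (le_refl |s|)
    rw [abs_le, abs_le] at *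
    omega

/-- The complex with the opposite differential. -/
def negD (C : Cx gr) : Cx gr where
  V := C.V
  part := C.part
  d := -C.d
  d_sq v := by simp [C.d_sq]
  d_mem h := neg_mem (C.d_mem h)
  smul_mem := C.smul_mem
  finite := C.finite
  bounded := C.bounded

/-- The graded ring as a complex concentrated in degree zero. -/
def base (gr : ℤ → Submodule ℚ A) [GradedAlg gr] : Cx gr where
  V := A
  part i j k := if j = 0 ∧ k = 0 then gr i else ⊥
  d := 0
  d_sq _ := rfl
  d_mem _ := by simp
  smul_mem hr hv := by
    split_ifs at hv ⊢
    · exact GradedAlg.mul_mem (gr := gr) hr hv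
    · rw [(Submodule.mem_bot ℚ).mp hv, smul_zero]; exact zero_mem _
  finite i j k := by
    by_cases h : j = 0 ∧ k = 0
    · rw [if_pos h]
      exact GradedAlg.finite i
    · rw [if_neg h]
      infer_instance
  bounded := by
    refine ⟨0, fun i j k h => ?_⟩
    split_ifs at h with h1
    · rw [h1.1, h1.2]
      simp only [neg_zero, abs_zero, le_refl, and_self, and_true]
      by_contra h2
      exact h (GradedAlg.eq_bot i (by omega))
    · exact absurd rfl h

theorem mem_base [GradedAlg gr] {i j k : ℤ} {v : A} :
    v ∈ (base gr).part i j k ↔ v ∈ gr i ∧ (v ≠ 0 → j = 0 ∧ k = 0) := by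
  change v ∈ (if j = 0 ∧ k = 0 then gr i else ⊥ : Submodule ℚ A) ↔ _
  split_ifs with h
  · simp [h]
  · rw [Submodule.mem_bot]
    refine ⟨fun h0 => ⟨h0 ▸ zero_mem _, fun h1 => absurd h0 h1⟩, fun h1 => ?_⟩
    by_contra h0
    exact h (h1.2 h0)

/-- The iterated cone: the Koszul complex of a list of homogeneous elements with coefficients in
a complex. -/
def koszul : List (HElt gr) → Cx gr → Cx gr
  | [], C => C
  | f :: F, C => koszul F (cone f C)

/-! ### Surjections with acyclic kernel -/

/-- A morphism of complexes that is surjective with acyclic kernel in all degrees. -/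
structure IsQ {C C' : Cx gr} (φ : C.V →ₗ[A] C'.V) : Prop where
  comm : ∀ v, φ (C.d v) = C'.d (φ v)
  map_mem : ∀ {i j k v}, v ∈ C.part i j k → φ v ∈ C'.part i j k
  surj : ∀ {i j k v}, v ∈ C'.part i j k → ∃ w ∈ C.part i j k, φ w = v
  ker : ∀ {i j k v}, v ∈ C.part i j k → φ v = 0 → C.d v = 0 →
    ∃ w ∈ C.part i (j + 1) k, φ w = 0 ∧ C.d w = v

/-- For an injective map the condition on the kernel is empty. The isomorphisms of complexes below
enter through this case. -/
theorem IsQ.of_injective {C C' : Cx gr} {φ : C.V →ₗ[A] C'.V}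
    (comm : ∀ v, φ (C.d v) = C'.d (φ v))
    (map_mem : ∀ {i j k v}, v ∈ C.part i j k → φ v ∈ C'.part i j k)
    (surj : ∀ {i j k v}, v ∈ C'.part i j k → ∃ w ∈ C.part i j k, φ w = v)
    (inj : ∀ v, φ v = 0 → v = 0) : IsQ (C := C) (C' := C') φ :=
  ⟨comm, map_mem, surj, fun {_ _ _ v} _ h _ =>
    ⟨0, zero_mem _, map_zero _, by rw [inj v h, map_zero]⟩⟩

/-- Cycles map onto cycles: if `w` lifts a cycle, then `d w` is a cycle in the acyclic kernel, hence
equals `d u` with `u` in the kernel, and `w - u` is a cyclic lift. Boundaries map onto boundaries,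
and by acyclicity both restrictions have the same kernel. Rank–nullity for the two then gives equal
differences. -/
theorem IsQ.hdim_eq {C C' : Cx gr} {φ : C.V →ₗ[A] C'.V} (h : IsQ (C := C) (C' := C') φ)
    (i j k : ℤ) : C.hdim i j k = C'.hdim i j k := by
  let ψ : C.V →ₗ[ℚ] C'.V := φ.restrictScalars ℚ
  have hZ : (C.cycles i j k).map ψ = C'.cycles i j k := by
    ext v
    constructor
    · rintro ⟨w, ⟨hw1, hw2⟩, rfl⟩
      refine ⟨?_, h.map_mem hw2⟩
      have : C'.d (φ w) = 0 := by
        rw [← h.comm]; rw [show C.d w = 0 from hw1, map_zero]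
      exact this
    · rintro ⟨hv1, hv2⟩
      obtain ⟨w, hw, rfl⟩ := h.surj hv2
      have hw' : w ∈ C.part i ((j - 1) + 1) k := by rwa [sub_add_cancel]
      have h0 : φ (C.d w) = 0 := by rw [h.comm]; exact hv1
      obtain ⟨u, hu, hu0, hud⟩ := h.ker (C.d_mem hw') h0 (C.d_sq w)
      rw [sub_add_cancel] at hu
      refine ⟨w - u, ⟨?_, sub_mem hw hu⟩, ?_⟩
      · have : C.d (w - u) = 0 := by rw [map_sub, hud, sub_self]
        exact this
      · change φ (w - u) = φ w
        rw [map_sub, hu0, sub_zero]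
  have hB : (C.bounds i j k).map ψ = C'.bounds i j k := by
    ext v
    constructor
    · rintro ⟨_, ⟨w, hw, rfl⟩, rfl⟩
      exact ⟨φ w, h.map_mem hw, (h.comm w).symm⟩
    · rintro ⟨w, hw, rfl⟩
      obtain ⟨u, hu, rfl⟩ := h.surj hw
      exact ⟨C.d u, ⟨u, hu, rfl⟩, h.comm u⟩
  have hK : (LinearMap.ker ψ ⊓ C.cycles i j k : Submodule ℚ C.V) =
      LinearMap.ker ψ ⊓ C.bounds i j k := by
    refine le_antisymm ?_ (inf_le_inf le_rfl (C.bounds_le_cycles i j k))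
    rintro v ⟨hv, hv1, hv2⟩
    obtain ⟨w, hw, hw0, rfl⟩ := h.ker hv2 hv hv1
    exact ⟨hv, w, hw, rfl⟩
  rw [hdim, hdim, finrank_eq_map_add_ker ψ (C.cycles i j k),
    finrank_eq_map_add_ker ψ (C.bounds i j k), hZ, hB, hK]
  push_cast
  ring

/-- The map induced on cones. -/
def coneMap (f : HElt gr) {C C' : Cx gr} (φ : C.V →ₗ[A] C'.V) :
    (cone f C).V →ₗ[A] (cone f C').V := φ.prodMap φ

/-- The kernel of the map of cones is the cone on the kernel, and a cone on an acyclic complex is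
acyclic: write `w = d u`, then `v + f u` is a cycle of the kernel, so it equals `d t`, and `(t, -u)`
bounds `(v, w)`. This is what allows local replacements inside a larger Koszul complex. -/
theorem IsQ.cone (f : HElt gr) {C C' : Cx gr} {φ : C.V →ₗ[A] C'.V}
    (h : IsQ (C := C) (C' := C') φ) :
    IsQ (C := cone f C) (C' := cone f C') (coneMap f φ) where
  comm := by
    rintro ⟨v, w⟩
    refine Prod.ext ?_ ?_
    · change φ (C.d v + f.val • w) = C'.d (φ v) + f.val • φ w
      rw [map_add, map_smul, h.comm]
    · change φ (-C.d w) = -C'.d (φ w)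
      rw [map_neg, h.comm]
  map_mem hv := ⟨h.map_mem hv.1, h.map_mem hv.2⟩
  surj := by
    rintro i j k ⟨v, w⟩ ⟨hv, hw⟩
    obtain ⟨v', hv', rfl⟩ := h.surj hv
    obtain ⟨w', hw', rfl⟩ := h.surj hw
    exact ⟨(v', w'), ⟨hv', hw'⟩, rfl⟩
  ker := by
    rintro i j k ⟨v, w⟩ ⟨hv, hw⟩ h0 hd
    have h1 : φ v = 0 := congrArg Prod.fst h0
    have h2 : φ w = 0 := congrArg Prod.snd h0
    have h3 : C.d v + f.val • w = 0 := congrArg Prod.fst hd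
    have h4 : C.d w = 0 := neg_eq_zero.mp (congrArg Prod.snd hd)
    obtain ⟨u, hu, hu0, rfl⟩ := h.ker hw h2 h4
    change u ∈ C.part (i - f.deg) (j - 1 + 1) k at hu
    rw [sub_add_cancel] at hu
    have hfu := C.smul_mem f.mem hu
    rw [add_sub_cancel] at hfu
    obtain ⟨t, ht, ht0, htd⟩ := h.ker (add_mem hv hfu)
      (by rw [map_add, map_smul, h1, hu0, smul_zero, add_zero])
      (by rw [map_add, map_smul, h3])
    refine ⟨(t, -u), ⟨ht, ?_⟩, ?_, ?_⟩
    · change -u ∈ C.part (i - f.deg) (j + 1 - 1) k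
      rw [add_sub_cancel_right]
      exact neg_mem hu
    · refine Prod.ext ht0 ?_
      change φ (-u) = 0
      rw [map_neg, hu0, neg_zero]
    · refine Prod.ext ?_ ?_
      · change C.d t + f.val • -u = v
        rw [htd, smul_neg, add_neg_cancel_right]
      · change -C.d (-u) = C.d u
        rw [map_neg, neg_neg]

end Cx

/-! ### The Poincaré series at `t = -1` -/

namespace Cx

variable {A : Type} [CommRing A] [Algebra ℚ A] {gr : ℤ → Submodule ℚ A}

/-- The Euler characteristic with respect to the homological degree. -/
noncomputable def chi (C : Cx gr) (i j : ℤ) : ℤ :=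
  ∑ᶠ k : ℤ, ((Int.negOnePow k : ℤˣ) : ℤ) * C.hdim i j k

/-- The coefficient of `q ^ i` of the Poincaré series at `t = -1`. -/
noncomputable def seriesCoeff (C : Cx gr) (i : ℤ) : RatFunc ℚ :=
  ∑ᶠ j : ℤ, (C.chi i j : RatFunc ℚ) * (RatFunc.X : RatFunc ℚ) ^ j

/-- A `finsum` is additive only for finite supports; these come from `bounded`. -/
theorem chi_support_finite (C : Cx gr) (i j : ℤ) :
    (Function.support fun k : ℤ => ((Int.negOnePow k : ℤˣ) : ℤ) * C.hdim i j k).Finite := by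
  obtain ⟨N, hN⟩ := C.bounded
  refine (Set.finite_Icc (-N) N).subset fun k hk => ?_
  by_contra hc
  apply hk
  beta_reduce
  rw [C.hdim_eq_zero, mul_zero]
  by_contra h
  exact hc (abs_le.mp (hN _ _ _ h).2.2)

theorem exists_chi_eq_zero (C : Cx gr) :
    ∃ N : ℤ, ∀ i j, C.chi i j ≠ 0 → -N ≤ i ∧ |j| ≤ N := by
  obtain ⟨N, hN⟩ := C.bounded
  refine ⟨N, fun i j h => ?_⟩
  by_contra hc
  apply h
  rw [chi]
  refine finsum_eq_zero_of_forall_eq_zero fun k => ?_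
  rw [C.hdim_eq_zero, mul_zero]
  by_contra h1
  exact hc ⟨(hN _ _ _ h1).1, (hN _ _ _ h1).2.1⟩

theorem seriesCoeff_support_finite (C : Cx gr) (i : ℤ) :
    (Function.support fun j : ℤ => (C.chi i j : RatFunc ℚ) * (RatFunc.X : RatFunc ℚ) ^ j).Finite := by
  obtain ⟨N, hN⟩ := C.exists_chi_eq_zero
  refine (Set.finite_Icc (-N) N).subset fun j hj => ?_
  by_contra hc
  apply hj
  have : C.chi i j = 0 := by
    by_contra h
    exact hc (abs_le.mp (hN _ _ h).2)
  simp only [this, Int.cast_zero, zero_mul]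

theorem seriesCoeff_bddBelow (C : Cx gr) : BddBelow (Function.support C.seriesCoeff) := by
  obtain ⟨N, hN⟩ := C.exists_chi_eq_zero
  refine ⟨-N, fun i hi => ?_⟩
  by_contra hc
  apply hi
  refine finsum_eq_zero_of_forall_eq_zero fun j => ?_
  have : C.chi i j = 0 := by
    by_contra h
    exact hc (hN _ _ h).1
  rw [this, Int.cast_zero, zero_mul]

/-- The Poincaré series of the homology at `t = -1`. -/
noncomputable def series (C : Cx gr) : LaurentSeries (RatFunc ℚ) :=
  HahnSeries.ofSuppBddBelow C.seriesCoeff C.seriesCoeff_bddBelow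

/-- Only dimensions are compared, so the two complexes may live over different rings. -/
theorem series_congr {B : Type} [CommRing B] [Algebra ℚ B] {gr' : ℤ → Submodule ℚ B}
    {C : Cx gr} {C' : Cx gr'} (h : ∀ i j k, C.hdim i j k = C'.hdim i j k) :
    C.series = C'.series := by
  ext i
  change C.seriesCoeff i = C'.seriesCoeff i
  simp only [seriesCoeff, chi, h]

theorem IsQ.series_eq {C C' : Cx gr} {φ : C.V →ₗ[A] C'.V} (h : IsQ (C := C) (C' := C') φ) :
    C.series = C'.series := series_congr h.hdim_eq

theorem hdim_prod (C C' : Cx gr) (i j k : ℤ) :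
    (C.prod C').hdim i j k = C.hdim i j k + C'.hdim i j k := by
  have h1 : (C.prod C').cycles i j k = (C.cycles i j k).prod (C'.cycles i j k) := by
    ext ⟨v, w⟩
    constructor
    · rintro ⟨h1, h2, h3⟩
      have h1' : (C.d v, C'.d w) = 0 := h1
      exact ⟨⟨congrArg Prod.fst h1', h2⟩, ⟨congrArg Prod.snd h1', h3⟩⟩
    · rintro ⟨⟨h1, h2⟩, h3, h4⟩
      exact ⟨Prod.ext h1 h3, h2, h4⟩
  have h2 : (C.prod C').bounds i j k = (C.bounds i j k).prod (C'.bounds i j k) := by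
    ext ⟨v, w⟩
    constructor
    · rintro ⟨⟨v', w'⟩, ⟨h1, h2⟩, h3⟩
      exact ⟨⟨v', h1, congrArg Prod.fst h3⟩, ⟨w', h2, congrArg Prod.snd h3⟩⟩
    · rintro ⟨⟨v', h1, h2⟩, w', h3, h4⟩
      exact ⟨(v', w'), ⟨h1, h3⟩, Prod.ext h2 h4⟩
  have e1 := finrank_prod_submodule (C.cycles i j k) (C'.cycles i j k)
  have e2 := finrank_prod_submodule (C.bounds i j k) (C'.bounds i j k)
  rw [hdim, h1, h2]
  change ((Module.finrank ℚ ((C.cycles i j k).prod (C'.cycles i j k)) : ℕ) : ℤ) -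
    (Module.finrank ℚ ((C.bounds i j k).prod (C'.bounds i j k)) : ℕ) = _
  rw [e1, e2, hdim, hdim]
  push_cast
  ring

theorem chi_prod (C C' : Cx gr) (i j : ℤ) : (C.prod C').chi i j = C.chi i j + C'.chi i j := by
  rw [chi, chi, chi, ← finsum_add_distrib (C.chi_support_finite i j) (C'.chi_support_finite i j)]
  exact finsum_congr fun k => by rw [hdim_prod, mul_add]

theorem series_prod (C C' : Cx gr) : (C.prod C').series = C.series + C'.series := by
  ext i
  change seriesCoeff _ i = seriesCoeff _ i + seriesCoeff _ i
  rw [seriesCoeff, seriesCoeff, seriesCoeff,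
    ← finsum_add_distrib (C.seriesCoeff_support_finite i) (C'.seriesCoeff_support_finite i)]
  exact finsum_congr fun k => by rw [chi_prod]; push_cast; ring

theorem hdim_shift (C : Cx gr) (m n s i j k : ℤ) :
    (C.shift m n s).hdim i j k = C.hdim (i - m) (j - n) (k - s) := by
  have h2 : (C.shift m n s).bounds i j k = C.bounds (i - m) (j - n) (k - s) := by
    change (C.part (i - m) (j + 1 - n) (k - s)).map C.dRat = _
    rw [bounds, sub_add_eq_add_sub]
  rw [hdim, h2]
  rfl

/-- The monomial `(-1)^s q^m a^n`. -/
noncomputable def mono (m n s : ℤ) : LaurentSeries (RatFunc ℚ) :=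
  HahnSeries.single m (((Int.negOnePow s : ℤˣ) : ℤ) * (RatFunc.X : RatFunc ℚ) ^ n)

theorem chi_shift (C : Cx gr) (m n s i j : ℤ) :
    (C.shift m n s).chi i j = ((Int.negOnePow s : ℤˣ) : ℤ) * C.chi (i - m) (j - n) := by
  rw [chi, chi, mul_finsum]
  refine Eq.trans ?_ (finsum_comp_equiv (Equiv.subRight s))
  refine finsum_congr fun k => ?_
  rw [hdim_shift, Equiv.subRight_apply, ← mul_assoc, ← Units.val_mul, ← Int.negOnePow_add,
    add_sub_cancel]

theorem series_shift (C : Cx gr) (m n s : ℤ) :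
    (C.shift m n s).series = mono m n s * C.series := by
  ext i
  rw [mono, HahnSeries.coeff_single_mul]
  change seriesCoeff _ i = _ * seriesCoeff _ (i - m)
  rw [seriesCoeff, seriesCoeff, mul_finsum]
  refine Eq.trans ?_ (finsum_comp_equiv (Equiv.subRight n))
  refine finsum_congr fun j => ?_
  rw [chi_shift, Equiv.subRight_apply]
  have hX : (RatFunc.X : RatFunc ℚ) ≠ 0 := RatFunc.X_ne_zero
  rw [show j = n + (j - n) by ring, zpow_add₀ hX, show n + (j - n) - n = j - n by ring]
  push_cast
  ring

theorem series_negD (C : Cx gr) : C.negD.series = C.series := by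
  refine series_congr fun i j k => ?_
  have h1 : C.negD.cycles i j k = C.cycles i j k := by
    ext v
    change (-C.d v = 0 ∧ _) ↔ (C.d v = 0 ∧ _)
    rw [neg_eq_zero]
    rfl
  have h2 : C.negD.bounds i j k = C.bounds i j k := by
    ext v
    constructor
    · rintro ⟨w, hw, rfl⟩
      exact ⟨-w, neg_mem hw, map_neg _ _⟩
    · rintro ⟨w, hw, rfl⟩
      refine ⟨-w, neg_mem hw, ?_⟩
      change -C.d (-w) = C.d w
      rw [map_neg, neg_neg]
  rw [hdim, h1, h2]
  rfl

/-! ### Koszul complexes -/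

/-- The coefficient complex varies in the induction, because each row of the list replaces it by a
cone. -/
theorem IsQ.exists_koszul (F : List (HElt gr)) {C C' : Cx gr} {φ : C.V →ₗ[A] C'.V}
    (h : IsQ (C := C) (C' := C') φ) :
    ∃ ψ : (koszul F C).V →ₗ[A] (koszul F C').V, IsQ (C := koszul F C) (C' := koszul F C') ψ := by
  induction F generalizing C C' with
  | nil => exact ⟨φ, h⟩
  | cons f F ih => exact ih (h.cone f)

theorem IsQ.koszul_series (F : List (HElt gr)) {C C' : Cx gr} {φ : C.V →ₗ[A] C'.V}
    (h : IsQ (C := C) (C' := C') φ) : (koszul F C).series = (koszul F C').series := by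
  obtain ⟨ψ, hψ⟩ := h.exists_koszul F
  exact hψ.series_eq

/-- A cone on a direct sum is the direct sum of the cones, by exchanging the two middle summands. -/
theorem koszul_prod_series (F : List (HElt gr)) (C C' : Cx gr) :
    (koszul F (C.prod C')).series = (koszul F C).series + (koszul F C').series := by
  induction F generalizing C C' with
  | nil => exact series_prod C C'
  | cons f F ih =>
    refine Eq.trans ?_ (ih (cone f C) (cone f C'))
    refine IsQ.koszul_series F (C := cone f (C.prod C')) (C' := (cone f C).prod (cone f C'))
      (φ := ((LinearMap.fst A C.V C'.V).prodMap (LinearMap.fst A C.V C'.V)).prod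
        ((LinearMap.snd A C.V C'.V).prodMap (LinearMap.snd A C.V C'.V))) ?_
    refine IsQ.of_injective (fun _ => rfl) ?_ ?_ ?_
    · rintro i j k ⟨⟨a, b⟩, c, d⟩ ⟨⟨h1, h2⟩, h3, h4⟩
      exact ⟨⟨h1, h3⟩, h2, h4⟩
    · rintro i j k ⟨⟨a, b⟩, c, d⟩ ⟨⟨h1, h2⟩, h3, h4⟩
      exact ⟨((a, c), (b, d)), ⟨⟨h1, h3⟩, h2, h4⟩, rfl⟩
    · rintro ⟨⟨a, b⟩, c, d⟩ h
      have h1 : a = 0 := congrArg (fun z => z.1.1) h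
      have h2 : c = 0 := congrArg (fun z => z.1.2) h
      have h3 : b = 0 := congrArg (fun z => z.2.1) h
      have h4 : d = 0 := congrArg (fun z => z.2.2) h
      subst h1 h2 h3 h4
      rfl

theorem koszul_shift_series (F : List (HElt gr)) (C : Cx gr) (m n s : ℤ) :
    (koszul F (C.shift m n s)).series = mono m n s * (koszul F C).series := by
  induction F generalizing C with
  | nil => exact series_shift C m n s
  | cons f F ih =>
    refine Eq.trans ?_ (ih (cone f C))
    refine IsQ.koszul_series F (C := cone f (C.shift m n s)) (C' := (cone f C).shift m n s)
      (φ := LinearMap.id) ?_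
    have key : ∀ i j k, (cone f (C.shift m n s)).part i j k =
        ((cone f C).shift m n s).part i j k := fun i j k => by
      change (C.part _ _ _).prod (C.part _ _ _) = (C.part _ _ _).prod (C.part _ _ _)
      rw [sub_right_comm i m, sub_right_comm j n]
    exact IsQ.of_injective (fun _ => rfl) (fun {i j k v} h => (key i j k).le h)
      (fun {i j k v} h => ⟨v, (key i j k).ge h, rfl⟩) fun _ h => h

/-- The sign passes through a cone by changing the sign of the second component. It has to be
removed because a cone carries the opposite differential on its shifted copy. -/
theorem koszul_negD_series (F : List (HElt gr)) (C : Cx gr) :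
    (koszul F C.negD).series = (koszul F C).series := by
  induction F generalizing C with
  | nil => exact series_negD C
  | cons f F ih =>
    refine Eq.trans ?_ (ih (cone f C))
    refine IsQ.koszul_series F (C := cone f C.negD) (C' := (cone f C).negD)
      (φ := (LinearMap.fst A C.V C.V).prod (-LinearMap.snd A C.V C.V)) ?_
    refine IsQ.of_injective ?_ ?_ ?_ ?_
    · rintro ⟨(v : C.V), (w : C.V)⟩
      refine Prod.ext ?_ ?_
      · change -C.d v + f.val • w = -(C.d v + f.val • -w)
        rw [smul_neg]; abel
      · change - -(-C.d w) = - -C.d (-w)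
        rw [map_neg]
    · rintro i j k ⟨v, w⟩ ⟨h1, h2⟩
      exact ⟨h1, neg_mem h2⟩
    · rintro i j k ⟨v, w⟩ ⟨h1, h2⟩
      exact ⟨(v, -w), ⟨h1, neg_mem h2⟩, Prod.ext rfl (neg_neg w)⟩
    · rintro ⟨v, w⟩ h
      have h1 : v = 0 := congrArg Prod.fst h
      have h2 : -w = 0 := congrArg Prod.snd h
      exact Prod.ext h1 (neg_eq_zero.mp h2)

/-- For a transposition of two rows, exchange the two middle summands of the double cone and change
the sign of the last one, as for the product of two exterior generators. -/
theorem koszul_perm_series {F G : List (HElt gr)} (h : F.Perm G) (C : Cx gr) :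
    (koszul F C).series = (koszul G C).series := by
  induction h generalizing C with
  | nil => rfl
  | cons f _ ih => exact ih _
  | trans _ _ ih1 ih2 => exact (ih1 C).trans (ih2 C)
  | swap f g F =>
    refine IsQ.koszul_series F (C := cone f (cone g C)) (C' := cone g (cone f C))
      (φ := ((LinearMap.fst A C.V C.V).prodMap (LinearMap.fst A C.V C.V)).prod
        ((LinearMap.snd A C.V C.V).prodMap (-LinearMap.snd A C.V C.V))) ?_
    refine IsQ.of_injective ?_ ?_ ?_ ?_
    · rintro ⟨⟨a, b⟩, c, d⟩
      refine Prod.ext (Prod.ext ?_ ?_) (Prod.ext ?_ ?_)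
      · change C.d a + g.val • b + f.val • c = C.d a + f.val • c + g.val • b
        abel
      · change -(C.d c + g.val • d) = -C.d c + g.val • -d
        rw [smul_neg]; abel
      · change -C.d b + f.val • d = -(C.d b + f.val • -d)
        rw [smul_neg]; abel
      · change - - -C.d d = - -C.d (-d)
        rw [map_neg]
    · rintro i j k ⟨⟨a, b⟩, c, d⟩ ⟨⟨h1, h2⟩, h3, h4⟩
      refine ⟨⟨h1, h3⟩, h2, neg_mem ?_⟩
      rw [sub_right_comm]
      exact h4
    · rintro i j k ⟨⟨a, b⟩, c, d⟩ ⟨⟨h1, h2⟩, h3, h4⟩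
      refine ⟨((a, c), (b, -d)), ⟨⟨h1, h3⟩, h2, neg_mem ?_⟩, ?_⟩
      · rw [sub_right_comm]
        exact h4
      · exact Prod.ext rfl (Prod.ext rfl (neg_neg d))
    · rintro ⟨⟨a, b⟩, c, d⟩ h
      have h1 : a = 0 := congrArg (fun z => z.1.1) h
      have h2 : c = 0 := congrArg (fun z => z.1.2) h
      have h3 : b = 0 := congrArg (fun z => z.2.1) h
      have h4 : -d = 0 := congrArg (fun z => z.2.2) h
      rw [neg_eq_zero] at h4
      subst h1 h2 h3 h4
      rfl

/-- A multiple of another element of the list can be added to an element of the list. -/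
theorem koszul_rowop_series (f f' g : HElt gr) (c : A) (hdeg : f'.deg = f.deg)
    (hc : c ∈ gr (f.deg - g.deg)) (hval : f.val = f'.val + c * g.val) (F : List (HElt gr))
    (C : Cx gr) : (koszul (g :: f :: F) C).series = (koszul (g :: f' :: F) C).series := by
  refine IsQ.koszul_series F (C := cone f (cone g C)) (C' := cone f' (cone g C))
    -- A change of basis of the exterior algebra: since `f x + g w = f' x + g (w + c x)`, the
    -- coefficient `w` of the row `g` becomes `w + c x`, and on the top exterior degree nothing
    -- changes.
    (φ := ((LinearMap.id : (C.V × C.V) →ₗ[A] (C.V × C.V)).coprod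
        ((LinearMap.inr A C.V C.V).comp (c • LinearMap.fst A C.V C.V))).prod
      (LinearMap.snd A (C.V × C.V) (C.V × C.V))) ?_
  refine IsQ.of_injective ?_ ?_ ?_ ?_
  · rintro ⟨⟨v, w⟩, x, y⟩
    refine Prod.ext (Prod.ext ?_ ?_) (Prod.ext rfl rfl)
    · change C.d v + g.val • w + f.val • x + 0 = C.d (v + 0) + g.val • (w + c • x) + f'.val • x
      rw [hval, add_smul, mul_comm c, mul_smul, smul_add, add_zero, add_zero]
      abel
    · change -C.d w + f.val • y + c • -(C.d x + g.val • y) = -C.d (w + c • x) + f'.val • y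
      rw [hval, add_smul, mul_smul, map_add, map_smul, smul_neg, smul_add]
      abel
  · rintro i j k ⟨⟨v, w⟩, x, y⟩ ⟨⟨h1, h2⟩, h3, h4⟩
    refine ⟨⟨add_mem h1 (zero_mem _), add_mem h2 ?_⟩, ?_, ?_⟩
    · have := C.smul_mem hc h3
      rwa [show f.deg - g.deg + (i - f.deg) = i - g.deg by ring] at this
    · change x ∈ C.part (i - f'.deg) _ _
      rw [hdeg]; exact h3
    · change y ∈ C.part (i - f'.deg - _) _ _
      rw [hdeg]; exact h4
  · rintro i j k ⟨⟨v, w⟩, x, y⟩ ⟨⟨h1, h2⟩, h3, h4⟩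
    change x ∈ C.part (i - f'.deg) _ _ at h3
    change y ∈ C.part (i - f'.deg - _) _ _ at h4
    rw [hdeg] at h3 h4
    refine ⟨((v, w - c • x), (x, y)), ⟨⟨h1, sub_mem h2 ?_⟩, h3, h4⟩, ?_⟩
    · have := C.smul_mem hc h3
      rwa [show f.deg - g.deg + (i - f.deg) = i - g.deg by ring] at this
    · refine Prod.ext (Prod.ext (add_zero v) ?_) rfl
      exact sub_add_cancel w (c • x)
  · rintro ⟨⟨v, w⟩, x, y⟩ h
    have h1 : v + 0 = 0 := congrArg (fun z => z.1.1) h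
    have h2 : w + c • x = 0 := congrArg (fun z => z.1.2) h
    have h3 : x = 0 := congrArg (fun z => z.2.1) h
    have h4 : y = 0 := congrArg (fun z => z.2.2) h
    subst h3 h4
    rw [smul_zero, add_zero] at h2
    rw [add_zero] at h1
    subst h1 h2
    rfl

theorem koszul_neg_series (f f' : HElt gr) (hdeg : f'.deg = f.deg) (hval : f'.val = -f.val)
    (F : List (HElt gr)) (C : Cx gr) :
    (koszul (f :: F) C).series = (koszul (f' :: F) C).series := by
  refine IsQ.koszul_series F (C := cone f C) (C' := cone f' C)
    (φ := (LinearMap.fst A C.V C.V).prod (-LinearMap.snd A C.V C.V)) ?_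
  refine IsQ.of_injective ?_ ?_ ?_ ?_
  · rintro ⟨v, w⟩
    refine Prod.ext ?_ ?_
    · change C.d v + f.val • w = C.d v + f'.val • -w
      rw [smul_neg, hval, neg_smul, neg_neg]
    · change - -C.d w = -C.d (-w)
      rw [map_neg]
  · rintro i j k ⟨v, w⟩ ⟨h1, h2⟩
    refine ⟨h1, neg_mem ?_⟩
    rw [hdeg]; exact h2
  · rintro i j k ⟨v, w⟩ ⟨h1, h2⟩
    rw [hdeg] at h2
    exact ⟨(v, -w), ⟨h1, neg_mem h2⟩, Prod.ext rfl (neg_neg w)⟩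
  · rintro ⟨v, w⟩ h
    have h1 : v = 0 := congrArg Prod.fst h
    have h2 : -w = 0 := congrArg Prod.snd h
    exact Prod.ext h1 (neg_eq_zero.mp h2)

/-- The cone of zero is a direct sum of `C` and a copy of it, with opposite differential, shifted by
the degree of the row and by one Hochschild degree. -/
theorem koszul_zero_series (f : HElt gr) (hf : f.val = 0) (F : List (HElt gr)) (C : Cx gr) :
    (koszul (f :: F) C).series = (1 + mono f.deg 1 0) * (koszul F C).series := by
  have h : (koszul F (cone f C)).series =
      (koszul F (C.prod (C.negD.shift f.deg 1 0))).series := by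
    have key : ∀ i j k, (cone f C).part i j k =
        (C.prod (C.negD.shift f.deg 1 0)).part i j k := fun i j k => by
      change (C.part _ _ _).prod (C.part _ _ _) = (C.part _ _ _).prod (C.part _ _ _)
      rw [sub_zero]
    refine IsQ.koszul_series F (C := cone f C) (C' := C.prod (C.negD.shift f.deg 1 0))
      (φ := LinearMap.id) ?_
    refine IsQ.of_injective ?_ (fun {i j k v} h => (key i j k).le h)
      (fun {i j k v} h => ⟨v, (key i j k).ge h, rfl⟩) fun _ h => h
    rintro ⟨v, w⟩
    refine Prod.ext ?_ rfl
    change C.d v + f.val • w = C.d v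
    rw [hf, zero_smul, add_zero]
  change (koszul F (cone f C)).series = _
  rw [h, koszul_prod_series, koszul_shift_series, koszul_negD_series]
  ring

end Cx

/-! ## Change of rings -/

section

variable {A B D : Type} [CommRing A] [Algebra ℚ A] [CommRing B] [Algebra ℚ B] [CommRing D]
  [Algebra ℚ D] {gr : ℤ → Submodule ℚ A} {gr' : ℤ → Submodule ℚ B} {gr'' : ℤ → Submodule ℚ D}

/-- A homomorphism of graded rings. -/
structure GrHom (gr : ℤ → Submodule ℚ A) (gr' : ℤ → Submodule ℚ B) where
  hom : A →ₐ[ℚ] B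
  map_mem : ∀ {i x}, x ∈ gr i → hom x ∈ gr' i

/-- The image of a homogeneous element. -/
def HElt.map (ρ : GrHom gr gr') (f : HElt gr) : HElt gr' := ⟨f.deg, ρ.hom f.val, ρ.map_mem f.mem⟩

@[simp] theorem HElt.map_deg (ρ : GrHom gr gr') (f : HElt gr) : (f.map ρ).deg = f.deg := rfl

@[simp] theorem HElt.map_val (ρ : GrHom gr gr') (f : HElt gr) :
    (f.map ρ).val = ρ.hom f.val := rfl

namespace Cx

/-- Restriction of scalars. -/
def restrict (ρ : GrHom gr gr') (C : Cx gr') : Cx gr :=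
  letI : Module A C.V := Module.compHom C.V ρ.hom.toRingHom
  { V := C.V
    tower := ⟨fun r x v => by
      change ρ.hom (r • x) • v = r • ρ.hom x • v
      rw [map_smul, smul_assoc]⟩
    part := C.part
    d :=
      { toFun := C.d
        map_add' := C.d.map_add
        map_smul' := fun r v => C.d.map_smul (ρ.hom r) v }
    d_sq := C.d_sq
    d_mem := C.d_mem
    smul_mem := fun hr hv => C.smul_mem (ρ.map_mem hr) hv
    finite := C.finite
    bounded := C.bounded }

theorem restrict_series (ρ : GrHom gr gr') (C : Cx gr') : (C.restrict ρ).series = C.series := rfl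

theorem koszul_restrict (ρ : GrHom gr gr') (F : List (HElt gr)) (C : Cx gr') :
    koszul F (C.restrict ρ) = (koszul (F.map (HElt.map ρ)) C).restrict ρ := by
  induction F generalizing C with
  | nil => rfl
  | cons f F ih => exact ih (cone (f.map ρ) C)

/-- If all remaining rows come from the smaller ring, the coefficient complex need only be
simplified linearly over that ring. The splittings below are not linear over the larger one. -/
theorem koszul_map_series (ρ : GrHom gr gr') (F : List (HElt gr)) (C : Cx gr') :
    (koszul (F.map (HElt.map ρ)) C).series = (koszul F (C.restrict ρ)).series := by
  rw [koszul_restrict, restrict_series]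

/-- The inverse has to be graded as well: it provides the homogeneous preimages. -/
theorem koszul_equiv_series [GradedAlg gr] [GradedAlg gr'] (ρ : GrHom gr gr') (τ : GrHom gr' gr)
    (h : ∀ x, τ.hom (ρ.hom x) = x) (h' : ∀ y, ρ.hom (τ.hom y) = y) (F : List (HElt gr)) :
    (koszul F (base gr)).series = (koszul (F.map (HElt.map ρ)) (base gr')).series := by
  rw [koszul_map_series]
  refine IsQ.koszul_series F (C := base gr) (C' := (base gr').restrict ρ)
    (φ := { toFun := ρ.hom, map_add' := map_add ρ.hom, map_smul' := map_mul ρ.hom }) ?_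
  refine IsQ.of_injective (fun _ => map_zero ρ.hom) ?_ ?_ ?_
  · intro i j k (v : A) hv
    obtain ⟨h1, h2⟩ := (mem_base (gr := gr)).mp hv
    exact (mem_base (gr := gr')).mpr ⟨ρ.map_mem h1, fun h0 => h2 fun h3 => h0 (by
      change ρ.hom v = 0
      rw [h3, map_zero])⟩
  · intro i j k (v : B) hv
    obtain ⟨h1, h2⟩ := (mem_base (gr := gr')).mp hv
    exact ⟨τ.hom v, (mem_base (gr := gr)).mpr ⟨τ.map_mem h1, fun h0 => h2 fun h3 => h0 (by
      rw [h3, map_zero])⟩, h' v⟩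
  · intro (v : A) hv
    rw [← h v]
    exact (congrArg τ.hom hv).trans (map_zero τ.hom)

end Cx

end

/-! ## Polynomial rings in one variable -/

section Poly

open Polynomial

variable {A : Type} [CommRing A] [Algebra ℚ A]

omit [Algebra ℚ A] in
theorem divX_X_mul_add_C (p : A[X]) (x : A) : divX (X * p + C x) = p := by
  ext n
  rw [coeff_divX, coeff_add, coeff_X_mul, coeff_C_succ, add_zero]

/-- The grading of `A[X]` with `X` in degree 2. -/
def polyGr (gr : ℤ → Submodule ℚ A) (i : ℤ) : Submodule ℚ A[X] where
  carrier := {p | ∀ n : ℕ, p.coeff n ∈ gr (i - 2 * n)}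
  zero_mem' n := by rw [coeff_zero]; exact zero_mem _
  add_mem' hp hr n := by rw [coeff_add]; exact add_mem (hp n) (hr n)
  smul_mem' c p hp n := by rw [coeff_smul]; exact Submodule.smul_mem _ c (hp n)

variable {gr : ℤ → Submodule ℚ A}

theorem C_mem_polyGr {i : ℤ} {x : A} (h : x ∈ gr i) : C x ∈ polyGr gr i := fun n => by
  rw [coeff_C]
  split_ifs with h0
  · rw [h0]; simpa using h
  · exact zero_mem _

variable [GradedAlg gr]

theorem X_mem_polyGr : (X : A[X]) ∈ polyGr gr 2 := fun n => by
  rw [coeff_X]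
  split_ifs with h0
  · rw [← h0]; exact GradedAlg.one_mem
  · exact zero_mem _

instance : GradedAlg (polyGr gr) where
  one_mem := C_mem_polyGr GradedAlg.one_mem
  mul_mem {i j p r} hp hr n := by
    rw [coeff_mul]
    refine sum_mem fun x hx => ?_
    have := GradedAlg.mul_mem (gr := gr) (hp x.1) (hr x.2)
    replace hx := Finset.HasAntidiagonal.mem_antidiagonal.mp hx
    rwa [← hx, show i + j - 2 * ((x.1 + x.2 : ℕ) : ℤ) = i - 2 * x.1 + (j - 2 * x.2) by
      push_cast; ring]
  finite i := by
    have : ∀ i, FiniteDimensional ℚ (gr i) := GradedAlg.finite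
    -- Coefficients beyond `i.toNat` have negative degree and vanish, so finitely many coefficients
    -- determine `p`.
    let ψ : polyGr gr i →ₗ[ℚ] ∀ n : Fin (i.toNat + 1), gr (i - 2 * ((n : ℕ) : ℤ)) :=
      { toFun := fun p n => ⟨p.1.coeff n, p.2 n⟩
        map_add' := fun p r => funext fun n => Subtype.ext (coeff_add p.1 r.1 n)
        map_smul' := fun c p => funext fun n => Subtype.ext (coeff_smul c p.1 n) }
    refine Module.Finite.of_injective ψ ?_
    intro p r h
    ext n
    by_cases hn : n < i.toNat + 1
    · exact congrArg Subtype.val (congrFun h ⟨n, hn⟩)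
    · have h0 : gr (i - 2 * n) = ⊥ := GradedAlg.eq_bot _ (by omega)
      have h1 := p.2 n
      have h2 := r.2 n
      rw [h0, Submodule.mem_bot] at h1 h2
      rw [h1, h2]
  eq_bot i hi := by
    rw [eq_bot_iff]
    intro p hp
    rw [Submodule.mem_bot]
    ext n
    have := hp n
    rwa [GradedAlg.eq_bot (gr := gr) (i - 2 * n) (by omega), Submodule.mem_bot] at this

/-- The inclusion of the constants. -/
noncomputable def polyC (gr : ℤ → Submodule ℚ A) : GrHom gr (polyGr gr) where
  hom := CAlgHom
  map_mem h := C_mem_polyGr h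

theorem eval_mem_of_mem_polyGr {i : ℤ} {p : A[X]} (hp : p ∈ polyGr gr i) {x : A} (hx : x ∈ gr 2) :
    p.eval x ∈ gr i := by
  have hpow : ∀ n : ℕ, x ^ n ∈ gr (2 * n) := by
    intro n
    induction n with
    | zero => simpa using GradedAlg.one_mem (gr := gr)
    | succ n ih =>
      rw [pow_succ, show (2 * ((n + 1 : ℕ) : ℤ)) = 2 * n + 2 by push_cast; ring]
      exact GradedAlg.mul_mem ih hx
  rw [eval_eq_sum_range]
  refine sum_mem fun n _ => ?_
  have := GradedAlg.mul_mem (hp n) (hpow n)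
  rwa [sub_add_cancel] at this

/-- Evaluation at an element of degree 2. -/
noncomputable def polyEval (x : A) (hx : x ∈ gr 2) : GrHom (polyGr gr) gr where
  hom := (aeval x : A[X] →ₐ[A] A).restrictScalars ℚ
  map_mem h := by
    change aeval x _ ∈ _
    rw [coe_aeval_eq_eval]
    exact eval_mem_of_mem_polyGr h hx

@[simp] theorem polyEval_hom (x : A) (hx : x ∈ gr 2) (p : A[X]) :
    (polyEval x hx).hom p = p.eval x := by
  change aeval x p = _
  rw [coe_aeval_eq_eval]

namespace Cx

/-- Elimination of a variable. -/
theorem koszul_eliminate_series (x : A) (hx : x ∈ gr 2) (f : HElt (polyGr gr)) (hdeg : f.deg = 2)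
    (hval : f.val = X - C x) (F : List (HElt (polyGr gr))) :
    (koszul (f :: F) (base (polyGr gr))).series =
      (koszul (F.map (HElt.map (polyEval x hx))) (base gr)).series := by
  rw [koszul_map_series]
  refine IsQ.koszul_series F (C := cone f (base (polyGr gr)))
    (C' := (base gr).restrict (polyEval x hx))
    (φ := { toFun := fun v => (eval x (v.1 : A[X]) : A)
            map_add' := fun v w => eval_add (p := (v.1 : A[X])) (q := (w.1 : A[X]))
            map_smul' := fun r v => (eval_mul (p := r) (q := (v.1 : A[X]))).trans
              (congrArg (· * eval x (v.1 : A[X])) (polyEval_hom x hx r).symm) }) ?_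
  constructor
  · rintro ⟨(v : A[X]), (w : A[X])⟩
    change eval x (0 + f.val * w) = 0
    rw [hval, zero_add, eval_mul, eval_sub, eval_X, eval_C, sub_self, zero_mul]
  · rintro i j k ⟨(v : A[X]), (w : A[X])⟩ ⟨hv, hw⟩
    obtain ⟨h1, h2⟩ := (mem_base (gr := polyGr gr)).mp hv
    refine (mem_base (gr := gr)).mpr ⟨eval_mem_of_mem_polyGr h1 hx, fun h0 => h2 ?_⟩
    rintro (h3 : v = 0)
    exact h0 ((congrArg (eval x) h3).trans eval_zero)
  · rintro i j k (v : A) hv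
    obtain ⟨h1, h2⟩ := (mem_base (gr := gr)).mp hv
    refine ⟨(C v, (0 : A[X])), ⟨(mem_base (gr := polyGr gr)).mpr ⟨C_mem_polyGr h1, fun h0 => h2 fun h3 => h0 ?_⟩,
      zero_mem _⟩, eval_C (a := v)⟩
    change C v = 0
    rw [h3, C_0]
  -- Acyclicity of the kernel: `X - x` is monic, so the cycle condition forces `w = 0`; as `v`
  -- vanishes at `x`, it is `(X - x) r`, and `(0, r)` bounds it. It remains to see that `r` is
  -- homogeneous.
  · rintro i j k ⟨(v : A[X]), (w : A[X])⟩ ⟨hv, -⟩ h0 hd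
    change eval x v = 0 at h0
    have hd : (0 : A[X]) + f.val * w = 0 := congrArg Prod.fst hd
    rw [hval, zero_add, (monic_X_sub_C x).mul_right_eq_zero_iff] at hd
    obtain ⟨r, hr⟩ := dvd_iff_isRoot.mpr h0
    obtain ⟨h1, h2⟩ := (mem_base (gr := polyGr gr)).mp hv
    have hrec : ∀ n, r.coeff n = v.coeff (n + 1) + x * r.coeff (n + 1) := fun n => by
      rw [hr, sub_mul, coeff_sub, coeff_X_mul, coeff_C_mul, sub_add_cancel]
    -- Descending induction on the coefficient index through `hrec`; `m` bounds the distance of `n`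
    -- from the point beyond which the coefficients vanish.
    have hmem : ∀ m n : ℕ, r.natDegree < n + m → r.coeff n ∈ gr (i - 2 - 2 * n) := by
      intro m
      induction m with
      | zero =>
        intro n hn
        rw [coeff_eq_zero_of_natDegree_lt (by omega)]
        exact zero_mem _
      | succ m ih =>
        intro n hn
        rw [hrec]
        have e1 := h1 (n + 1)
        have e2 := GradedAlg.mul_mem hx (ih (n + 1) (by omega))
        rw [show i - 2 * ((n + 1 : ℕ) : ℤ) = i - 2 - 2 * n by push_cast; ring] at e1
        rw [show 2 + (i - 2 - 2 * ((n + 1 : ℕ) : ℤ)) = i - 2 - 2 * n by push_cast; ring] at e2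
        exact add_mem e1 e2
    refine ⟨((0 : A[X]), r), ⟨zero_mem _, (mem_base (gr := polyGr gr)).mpr ⟨fun n => ?_, fun hr0 => ?_⟩⟩,
      (eval_zero : eval x (0 : A[X]) = 0), ?_⟩
    · rw [hdeg]
      exact hmem (r.natDegree + 1) n (by omega)
    · have := h2 (fun h3 : v = 0 => hr0 (by
        rw [h3] at hr
        exact ((monic_X_sub_C x).mul_right_eq_zero_iff).mp hr.symm))
      omega
    · refine Prod.ext ?_ ?_
      · change (0 : A[X]) + f.val * r = v
        rw [hval, hr, zero_add]
      · change -(0 : A[X]) = w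
        rw [hd, neg_zero]

/-- Multiplication by a multiple of the variable splits off the constants. -/
theorem koszul_mul_X_series (δ : HElt gr) (g : HElt (polyGr gr)) (hdeg : g.deg = δ.deg + 2)
    (hval : g.val = C δ.val * X) (F : List (HElt gr)) :
    (koszul (g :: F.map (HElt.map (polyC gr))) (base (polyGr gr))).series =
      (koszul F (base gr)).series + mono 2 0 0 *
        (koszul (δ.map (polyC gr) :: F.map (HElt.map (polyC gr))) (base (polyGr gr))).series := by
  rw [koszul, koszul, koszul_map_series, koszul_map_series, ← koszul_shift_series,
    ← koszul_prod_series]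
  refine IsQ.koszul_series F (C := (cone g (base (polyGr gr))).restrict (polyC gr))
    (C' := (base gr).prod
      (((cone (δ.map (polyC gr)) (base (polyGr gr))).restrict (polyC gr)).shift 2 0 0))
    (φ :=
      -- As a module over `A`, the ring `A[X]` is `A ⊕ X·A[X]`. The image of `δ X` lies in the
      -- second summand, so the constants split off; on `X·A[X]`, a copy of `A[X]` shifted by 2, the
      -- map becomes multiplication by `δ`.
      { toFun := fun v => ((coeff (v.1 : A[X]) 0 : A), (divX (v.1 : A[X]), (v.2 : A[X])))
        map_add' := fun v w => Prod.ext (coeff_add (v.1 : A[X]) w.1 0)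
          (Prod.ext (divX_add (p := (v.1 : A[X])) (q := w.1)) rfl)
        map_smul' := fun r v => Prod.ext (coeff_C_mul (v.1 : A[X]))
          (Prod.ext (divX_C_mul (p := (v.1 : A[X]))) rfl) }) ?_
  have hdivX : ∀ {i : ℤ} {v : A[X]}, v ∈ polyGr gr i → divX v ∈ polyGr gr (i - 2) := by
    intro i v hv n
    rw [coeff_divX]
    have := hv (n + 1)
    rwa [show i - 2 * ((n + 1 : ℕ) : ℤ) = i - 2 - 2 * n by push_cast; ring] at this
  refine IsQ.of_injective ?_ ?_ ?_ ?_
  · rintro ⟨(v : A[X]), (w : A[X])⟩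
    refine Prod.ext ?_ (Prod.ext ?_ rfl)
    · change coeff (0 + g.val * w) 0 = 0
      rw [hval, zero_add, mul_assoc, coeff_C_mul, coeff_X_mul_zero, mul_zero]
    · have : divX (g.val * w) = C δ.val * w := by
        rw [hval, mul_right_comm, mul_comm, ← add_zero (X * _), ← C_0]
        exact divX_X_mul_add_C _ _
      exact (congrArg divX (zero_add (g.val * w))).trans (this.trans (zero_add _).symm)
  · rintro i j k ⟨(v : A[X]), (w : A[X])⟩ ⟨hv, hw⟩
    obtain ⟨h1, h2⟩ := (mem_base (gr := polyGr gr)).mp hv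
    obtain ⟨h3, h4⟩ := (mem_base (gr := polyGr gr)).mp hw
    refine ⟨(mem_base (gr := gr)).mpr ⟨?_, fun h0 => h2 ?_⟩, (mem_base (gr := polyGr gr)).mpr ⟨hdivX h1, fun h0 => ?_⟩,
      (mem_base (gr := polyGr gr)).mpr ⟨?_, fun h0 => ?_⟩⟩
    · change coeff v 0 ∈ gr i
      simpa using h1 0
    · rintro (rfl : v = 0)
      exact h0 (coeff_zero 0)
    · rw [sub_zero, sub_zero]
      refine h2 ?_
      rintro (rfl : v = 0)
      exact h0 divX_zero
    · rw [HElt.map_deg, show i - 2 - δ.deg = i - g.deg by rw [hdeg]; ring]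
      exact h3
    · rw [sub_zero, sub_zero]
      exact h4 h0
  · rintro i j k ⟨(u : A), (v : A[X]), (w : A[X])⟩ ⟨hu, hv, hw⟩
    obtain ⟨h1, h2⟩ := (mem_base (gr := gr)).mp hu
    obtain ⟨h3, h4⟩ := (mem_base (gr := polyGr gr)).mp hv
    obtain ⟨h5, h6⟩ := (mem_base (gr := polyGr gr)).mp hw
    rw [sub_zero, sub_zero] at h4 h6
    refine ⟨(X * v + C u, w), ⟨(mem_base (gr := polyGr gr)).mpr ⟨?_, fun h0 => ?_⟩, (mem_base (gr := polyGr gr)).mpr ⟨?_, h6⟩⟩, ?_⟩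
    · have := GradedAlg.mul_mem (X_mem_polyGr (gr := gr)) h3
      rw [add_sub_cancel] at this
      exact add_mem this (C_mem_polyGr h1)
    · by_cases hu0 : u = 0
      · refine h4 ?_
        rintro (rfl : v = 0)
        exact h0 (by
          change X * (0 : A[X]) + C u = 0
          rw [hu0, mul_zero, C_0, add_zero])
      · exact h2 hu0
    · rw [HElt.map_deg, show i - 2 - δ.deg = i - g.deg by rw [hdeg]; ring] at h5
      exact h5
    · refine Prod.ext ?_ (Prod.ext (divX_X_mul_add_C v u) rfl)
      change coeff (X * v + C u) 0 = u
      simp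
  · rintro ⟨(v : A[X]), (w : A[X])⟩ h
    have h1 : coeff v 0 = 0 := congrArg (fun z => z.1) h
    have h2 : divX v = 0 := congrArg (fun z => z.2.1) h
    have h3 : w = 0 := congrArg (fun z => z.2.2) h
    refine Prod.ext ?_ h3
    change v = 0
    rw [← X_mul_divX_add v, h1, h2, mul_zero, C_0, add_zero]

end Cx

end Poly

/-! ### Division by a monic quadratic polynomial, and the splitting it gives. -/

section Quadratic

open Polynomial

variable {A : Type} [CommRing A] [Algebra ℚ A]

/-- The monic quadratic polynomial `X² + bX + e`. -/
noncomputable def quadratic (b e : A) : A[X] := X ^ 2 + (C b * X + C e)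

omit [Algebra ℚ A] in
theorem quadratic_monic [Nontrivial A] (b e : A) : (quadratic b e).Monic :=
  monic_X_pow_add (n := 2) (lt_of_le_of_lt degree_linear_le (by decide))

omit [Algebra ℚ A] in
theorem quadratic_degree [Nontrivial A] (b e : A) : (quadratic b e).degree = 2 :=
  (degree_add_eq_left_of_degree_lt (by
    rw [degree_X_pow]
    exact lt_of_le_of_lt degree_linear_le (by decide))).trans (degree_X_pow 2)

omit [Algebra ℚ A] in
theorem quadratic_modByMonic [Nontrivial A] (b e : A) (r : A[X]) (u w : A) :
    (quadratic b e * r + (C w * X + C u)) %ₘ quadratic b e = C w * X + C u := by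
  refine (div_modByMonic_unique r _ (quadratic_monic b e) ⟨add_comm _ _, ?_⟩).2
  rw [quadratic_degree]
  exact lt_of_le_of_lt degree_linear_le (by decide)

omit [Algebra ℚ A] in
theorem modByMonic_quadratic_eq [Nontrivial A] (b e : A) (v : A[X]) :
    v %ₘ quadratic b e =
      C ((v %ₘ quadratic b e).coeff 1) * X + C ((v %ₘ quadratic b e).coeff 0) := by
  have h := degree_modByMonic_lt v (quadratic_monic b e)
  rw [quadratic_degree] at h
  refine eq_X_add_C_of_degree_le_one ?_
  exact Order.le_of_lt_succ h

omit [Algebra ℚ A] in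
theorem eq_quadratic_mul_add [Nontrivial A] (b e : A) (v : A[X]) :
    v = quadratic b e * (v /ₘ quadratic b e) +
      (C ((v %ₘ quadratic b e).coeff 1) * X + C ((v %ₘ quadratic b e).coeff 0)) := by
  rw [← modByMonic_quadratic_eq, add_comm, modByMonic_add_div]

variable {gr : ℤ → Submodule ℚ A} [GradedAlg gr]

theorem quadratic_mem {b e : A} (hb : b ∈ gr 2) (he : e ∈ gr 4) :
    quadratic b e ∈ polyGr gr 4 := by
  refine add_mem ?_ (add_mem ?_ (C_mem_polyGr he))
  · rw [pow_two]
    exact GradedAlg.mul_mem (gr := polyGr gr) X_mem_polyGr X_mem_polyGr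
  · exact GradedAlg.mul_mem (gr := polyGr gr) (C_mem_polyGr hb) X_mem_polyGr

/-- Comparing coefficients in the division identity expresses each coefficient of the quotient
through the next two; descending induction from the top degree gives homogeneity. -/
theorem divByMonic_quadratic_mem [Nontrivial A] {b e : A} (hb : b ∈ gr 2) (he : e ∈ gr 4) {i : ℤ}
    {v : A[X]} (hv : v ∈ polyGr gr i) : v /ₘ quadratic b e ∈ polyGr gr (i - 4) := by
  set r := v /ₘ quadratic b e with hr
  have hrec : ∀ n, r.coeff n = v.coeff (n + 2) - b * r.coeff (n + 1) - e * r.coeff (n + 2) := by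
    intro n
    have h := congrArg (fun p => coeff p (n + 2)) (eq_quadratic_mul_add b e v)
    simp only [← hr] at h
    rw [quadratic, add_mul, add_mul, mul_assoc (C b), coeff_add, coeff_add, coeff_add, coeff_add,
      coeff_X_pow_mul, coeff_C_mul, coeff_X_mul, coeff_C_mul, coeff_C_mul, coeff_X,
      if_neg (by omega), coeff_C, if_neg (by omega)] at h
    rw [h]
    ring
  have hmem : ∀ m n : ℕ, r.natDegree < n + m → r.coeff n ∈ gr (i - 4 - 2 * n) := by
    intro m
    induction m with
    | zero =>
      intro n hn
      rw [coeff_eq_zero_of_natDegree_lt (by omega)]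
      exact zero_mem _
    | succ m ih =>
      intro n hn
      rw [hrec]
      have e1 := hv (n + 2)
      have e2 := GradedAlg.mul_mem hb (ih (n + 1) (by omega))
      have e3 := GradedAlg.mul_mem he (ih (n + 2) (by omega))
      rw [show i - 2 * ((n + 2 : ℕ) : ℤ) = i - 4 - 2 * n by push_cast; ring] at e1
      rw [show 2 + (i - 4 - 2 * ((n + 1 : ℕ) : ℤ)) = i - 4 - 2 * n by push_cast; ring] at e2
      rw [show 4 + (i - 4 - 2 * ((n + 2 : ℕ) : ℤ)) = i - 4 - 2 * n by push_cast; ring] at e3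
      exact sub_mem (sub_mem e1 e2) e3
  exact fun n => hmem (r.natDegree + 1) n (by omega)

theorem modByMonic_quadratic_mem [Nontrivial A] {b e : A} (hb : b ∈ gr 2) (he : e ∈ gr 4) {i : ℤ}
    {v : A[X]} (hv : v ∈ polyGr gr i) : v %ₘ quadratic b e ∈ polyGr gr i := by
  have h1 := GradedAlg.mul_mem (quadratic_mem hb he) (divByMonic_quadratic_mem hb he hv)
  rw [add_sub_cancel] at h1
  rw [← add_sub_cancel_right (v %ₘ quadratic b e) (quadratic b e * (v /ₘ quadratic b e)),
    modByMonic_add_div]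
  exact sub_mem hv h1

namespace Cx

/-- Over `A[X]`, a monic quadratic polynomial together with a multiple of `X` splits into two
Koszul complexes over `A`. -/
theorem koszul_quadratic_series [Nontrivial A] (b e : A) (hb : b ∈ gr 2) (he : e ∈ gr 4)
    (c ce : HElt gr) (p l : HElt (polyGr gr)) (hp : p.deg = 4) (hpv : p.val = quadratic b e)
    (hl : l.deg = c.deg + 2) (hlv : l.val = C c.val * X) (hce : ce.deg = c.deg + 4)
    (hcev : ce.val = c.val * e) (F : List (HElt gr)) :
    (koszul (p :: l :: F.map (HElt.map (polyC gr))) (base (polyGr gr))).series =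
      (koszul (ce :: F) (base gr)).series + mono 2 0 0 * (koszul (c :: F) (base gr)).series := by
  rw [koszul, koszul, koszul, koszul, koszul_map_series, ← koszul_shift_series,
    ← koszul_prod_series]
  let u : A[X] →ₗ[A] A := (lcoeff A 0).comp (modByMonicHom (quadratic b e))
  let w : A[X] →ₗ[A] A := (lcoeff A 1).comp (modByMonicHom (quadratic b e))
  have hdiv : ∀ v : A[X], v = quadratic b e * (v /ₘ quadratic b e) + (C (w v) * X + C (u v)) :=
    eq_quadratic_mul_add b e
  have hu : ∀ r x y, u (quadratic b e * r + (C x * X + C y)) = y := fun r x y => by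
    change ((quadratic b e * r + (C x * X + C y)) %ₘ quadratic b e).coeff 0 = y
    rw [quadratic_modByMonic]; simp
  have hw : ∀ r x y, w (quadratic b e * r + (C x * X + C y)) = x := fun r x y => by
    change ((quadratic b e * r + (C x * X + C y)) %ₘ quadratic b e).coeff 1 = x
    rw [quadratic_modByMonic]; simp [coeff_C]
  -- Modulo `X² + bX + e` one has `X (u + wX) = -e w + (u - b w) X`. Multiplication by `c X` is
  -- therefore diagonal, with entries `c e` and `c`, from the coordinates `(-w, u - b w)` to the
  -- coordinates of the basis `1, X`.
  have hred : ∀ v1 v2 : A[X], p.val * v1 + l.val * v2 = quadratic b e *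
      (v1 + C c.val * X * (v2 /ₘ quadratic b e) + C (c.val * w v2)) +
        (C (c.val * (u v2 - b * w v2)) * X + C (c.val * e * (-w v2))) := fun v1 v2 => by
    conv_lhs => rw [hdiv v2, hpv, hlv]
    simp only [quadratic, C_mul, C_sub, C_neg]
    ring
  have hu_mem : ∀ {i : ℤ} {v : A[X]}, v ∈ polyGr gr i → u v ∈ gr i := fun {i v} hv => by
    have := modByMonic_quadratic_mem hb he hv 0
    rw [Nat.cast_zero, mul_zero, sub_zero] at this
    exact this
  have hw_mem : ∀ {i : ℤ} {v : A[X]}, v ∈ polyGr gr i → w v ∈ gr (i - 2) := fun {i v} hv => by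
    have := modByMonic_quadratic_mem hb he hv 1
    rw [Nat.cast_one, mul_one] at this
    exact this
  -- The components `v.1.2` and `v.2.2`, the coefficients of the exterior generator of the quadratic
  -- row, are dropped. The other two are reduced modulo the quadratic polynomial, the target `v.1.1`
  -- in the basis `1, X` and the source `v.2.1` in the coordinates that diagonalise `c X`.
  let φ : (A[X] × A[X]) × (A[X] × A[X]) →ₗ[A] (A × A) × (A × A) :=
    { toFun := fun v => ((u v.1.1, -w v.2.1), (w v.1.1, u v.2.1 - b * w v.2.1))
      map_add' := fun v v' => by
        simp only [Prod.fst_add, Prod.snd_add, map_add, Prod.mk_add_mk]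
        refine Prod.ext (Prod.ext rfl ?_) (Prod.ext rfl ?_) <;> ring
      map_smul' := fun r v => by
        simp only [Prod.smul_fst, Prod.smul_snd, map_smul, Prod.smul_mk, RingHom.id_apply,
          smul_eq_mul]
        refine Prod.ext (Prod.ext rfl ?_) (Prod.ext rfl ?_) <;> ring }
  refine IsQ.koszul_series F
    (C := (cone l (cone p (base (polyGr gr)))).restrict (polyC gr))
    (C' := (cone ce (base gr)).prod ((cone c (base gr)).shift 2 0 0))
    (φ :=
      { toFun := φ
        map_add' := φ.map_add
        map_smul' := fun r v => by
          refine (congrArg φ ?_).trans (φ.map_smul r v)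
          exact Prod.ext (Prod.ext (smul_eq_C_mul r).symm (smul_eq_C_mul r).symm)
            (Prod.ext (smul_eq_C_mul r).symm (smul_eq_C_mul r).symm) }) ?_
  have hmem : ∀ {i j k : ℤ} {v : A[X]} (f : A[X] →ₗ[A] A) (m : ℤ),
      (∀ {v : A[X]}, v ∈ polyGr gr i → f v ∈ gr m) →
      v ∈ (base (polyGr gr)).part i j k → f v ∈ (base gr).part m j k := by
    intro i j k v f m hf hv
    obtain ⟨h1, h2⟩ := (mem_base (gr := polyGr gr)).mp hv
    refine (mem_base (gr := gr)).mpr ⟨hf h1, fun h0 => h2 fun h3 => h0 ?_⟩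
    rw [h3, map_zero]
  constructor
  · rintro ⟨⟨(v0 : A[X]), (v1 : A[X])⟩, (v2 : A[X]), (v3 : A[X])⟩
    have e1 := hred v1 v2
    have e2 : u (p.val * v1 + l.val * v2) = ce.val * (-w v2) := by rw [e1, hu, hcev]
    have e3 : w (p.val * v1 + l.val * v2) = c.val * (u v2 - b * w v2) := by rw [e1, hw]
    have e4 : w (-(p.val * v3)) = 0 := by
      have := hw (-v3) 0 0
      rw [C_0, zero_mul, zero_add, add_zero] at this
      rw [hpv, ← mul_neg, this]
    have e5 : u (-(p.val * v3)) = 0 := by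
      have := hu (-v3) 0 0
      rw [C_0, zero_mul, zero_add, add_zero] at this
      rw [hpv, ← mul_neg, this]
    have e6 : φ ((p.val * v1 + l.val * v2, l.val * v3), (-(p.val * v3), 0)) =
        ((ce.val * (-w v2), 0), (c.val * (u v2 - b * w v2), 0)) := by
      refine Prod.ext (Prod.ext e2 ?_) (Prod.ext e3 ?_)
      · change -w (-(p.val * v3)) = 0
        rw [e4, neg_zero]
      · change u (-(p.val * v3)) - b * w (-(p.val * v3)) = 0
        rw [e4, e5, mul_zero, sub_zero]
    refine Eq.trans (congrArg φ ?_) (e6.trans ?_)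
    · refine Prod.ext (Prod.ext ?_ ?_) (Prod.ext ?_ ?_)
      · change 0 + p.val * v1 + l.val * v2 = p.val * v1 + l.val * v2
        rw [zero_add]
      · change -0 + l.val * v3 = l.val * v3
        rw [neg_zero, zero_add]
      · change -(0 + p.val * v3) = -(p.val * v3)
        rw [zero_add]
      · change - -(0 : A[X]) = 0
        rw [neg_zero, neg_zero]
    · refine Prod.ext (Prod.ext ?_ ?_) (Prod.ext ?_ ?_)
      · exact (zero_add _).symm
      · exact neg_zero.symm
      · exact (zero_add _).symm
      · exact neg_zero.symm
  · rintro i j k ⟨⟨(v0 : A[X]), (v1 : A[X])⟩, (v2 : A[X]), (v3 : A[X])⟩ ⟨⟨h0, h1⟩, h2, h3⟩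
    have hi : i - l.deg - 2 = i - ce.deg := by rw [hl, hce]; ring
    refine ⟨⟨hmem u i hu_mem h0, hmem (-w) (i - ce.deg) ?_ h2⟩, hmem w (i - 2) hw_mem ?_, ?_⟩
    · intro v hv
      rw [← hi]
      exact neg_mem (hw_mem hv)
    · rw [sub_zero, sub_zero]; exact h0
    · rw [sub_zero, sub_zero]
      refine hmem (u - b • w) (i - 2 - c.deg) ?_ h2
      intro v hv
      rw [hl, show i - (c.deg + 2) = i - 2 - c.deg by ring] at hv
      have := GradedAlg.mul_mem hb (hw_mem hv)
      rw [add_sub_cancel] at this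
      exact sub_mem (hu_mem hv) this
  · rintro i j k ⟨⟨(x0 : A), (x1 : A)⟩, (x2 : A), (x3 : A)⟩ ⟨⟨h0, h1⟩, h2, h3⟩
    obtain ⟨m0, t0⟩ := (mem_base (gr := gr)).mp h0
    obtain ⟨m1, t1⟩ := (mem_base (gr := gr)).mp h1
    obtain ⟨m2, t2⟩ := (mem_base (gr := gr)).mp h2
    obtain ⟨m3, t3⟩ := (mem_base (gr := gr)).mp h3
    rw [sub_zero, sub_zero] at t2 t3
    have hlin : ∀ {i : ℤ} {x y : A}, x ∈ gr (i - 2) → y ∈ gr i → C x * X + C y ∈ polyGr gr i := by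
      intro i x y hx hy
      have := GradedAlg.mul_mem (gr := polyGr gr) (C_mem_polyGr hx) X_mem_polyGr
      rw [sub_add_cancel] at this
      exact add_mem this (C_mem_polyGr hy)
    have hu' : ∀ x y, u (C x * X + C y) = y := fun x y => by
      have := hu 0 x y; rwa [mul_zero, zero_add] at this
    have hw' : ∀ x y, w (C x * X + C y) = x := fun x y => by
      have := hw 0 x y; rwa [mul_zero, zero_add] at this
    refine ⟨((C x2 * X + C x0, 0), (C (-x1) * X + C (x3 - b * x1), 0)),
      ⟨⟨(mem_base (gr := polyGr gr)).mpr ⟨hlin m2 m0, fun hne => ?_⟩, zero_mem _⟩,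
        (mem_base (gr := polyGr gr)).mpr ⟨hlin ?_ ?_, fun hne => ?_⟩, zero_mem _⟩, ?_⟩
    · by_contra hc
      refine hne ?_
      have z0 : x0 = 0 := by by_contra h; exact hc (t0 h)
      have z2 : x2 = 0 := by by_contra h; exact hc (t2 h)
      change C x2 * X + C x0 = 0
      rw [z0, z2, C_0, zero_mul, add_zero]
    · have := neg_mem m1
      rwa [show i - ce.deg = i - l.deg - 2 by rw [hl, hce]; ring] at this
    · have h4 := GradedAlg.mul_mem hb m1
      rw [show 2 + (i - ce.deg) = i - l.deg by rw [hl, hce]; ring] at h4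
      rw [show i - 2 - c.deg = i - l.deg by rw [hl]; ring] at m3
      exact sub_mem m3 h4
    · by_contra hc
      refine hne ?_
      have z1 : x1 = 0 := by by_contra h; exact hc (t1 h)
      have z3 : x3 = 0 := by by_contra h; exact hc (t3 h)
      change C (-x1) * X + C (x3 - b * x1) = 0
      rw [z1, z3, mul_zero, sub_zero, neg_zero, C_0, zero_mul, add_zero]
    · refine Prod.ext (Prod.ext ?_ ?_) (Prod.ext ?_ ?_)
      · exact hu' _ _
      · change -w (C (-x1) * X + C (x3 - b * x1)) = x1
        rw [hw', neg_neg]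
      · exact hw' _ _
      · change u (C (-x1) * X + C (x3 - b * x1)) - b * w (C (-x1) * X + C (x3 - b * x1)) = x3
        rw [hw', hu']
        ring
  · rintro i j k ⟨⟨(v0 : A[X]), (v1 : A[X])⟩, (v2 : A[X]), (v3 : A[X])⟩ ⟨⟨h0, h1⟩, h2, h3⟩ hφ hd
    have f1 : u v0 = 0 := congrArg (fun z => z.1.1) hφ
    have f2 : -w v2 = 0 := congrArg (fun z => z.1.2) hφ
    have f3 : w v0 = 0 := congrArg (fun z => z.2.1) hφ
    have f4 : u v2 - b * w v2 = 0 := congrArg (fun z => z.2.2) hφ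
    rw [neg_eq_zero] at f2
    rw [f2, mul_zero, sub_zero] at f4
    have g1 : 0 + p.val * v1 + l.val * v2 = 0 := congrArg (fun z => z.1.1) hd
    have g2 : -(0 + p.val * v3) = 0 := congrArg (fun z => z.2.1) hd
    rw [neg_eq_zero, zero_add, hpv, (quadratic_monic b e).mul_right_eq_zero_iff] at g2
    have d0 := hdiv v0
    have d2 := hdiv v2
    rw [f1, f3, C_0, zero_mul, add_zero, add_zero] at d0
    rw [f2, f4, C_0, zero_mul, add_zero, add_zero] at d2
    set r0 := v0 /ₘ quadratic b e with hr0
    set r2 := v2 /ₘ quadratic b e with hr2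
    have g3 : v1 = -(l.val * r2) := by
      have : quadratic b e * (v1 + l.val * r2) = 0 := by
        rw [← g1, d2, hpv]
        ring
      exact eq_neg_of_add_eq_zero_left
        (((quadratic_monic b e).mul_right_eq_zero_iff).mp this)
    obtain ⟨n0, t0⟩ := (mem_base (gr := polyGr gr)).mp h0
    obtain ⟨n2, t2⟩ := (mem_base (gr := polyGr gr)).mp h2
    have z0 : v0 = 0 → r0 = 0 := fun h => by
      rw [h] at d0
      exact ((quadratic_monic b e).mul_right_eq_zero_iff).mp d0.symm
    have z2 : v2 = 0 → r2 = 0 := fun h => by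
      rw [h] at d2
      exact ((quadratic_monic b e).mul_right_eq_zero_iff).mp d2.symm
    -- In the kernel, `v0` and `v2` are the multiples `p r0` and `p r2` of the quadratic polynomial.
    -- Being a cycle forces `v3 = 0` and `v1 = -l r2`, which is the boundary of this element.
    refine ⟨((0, r0), (0, -r2)), ⟨⟨zero_mem _, ?_⟩, zero_mem _, neg_mem ?_⟩, ?_, ?_⟩
    · refine (mem_base (gr := polyGr gr)).mpr ⟨?_, fun hne => ?_⟩
      · rw [hp]; exact divByMonic_quadratic_mem hb he n0
      · have := t0 fun h => hne (z0 h)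
        omega
    · refine (mem_base (gr := polyGr gr)).mpr ⟨?_, fun hne => ?_⟩
      · rw [hp]; exact divByMonic_quadratic_mem hb he n2
      · have := t2 fun h => hne (z2 h)
        omega
    · refine Prod.ext (Prod.ext ?_ ?_) (Prod.ext ?_ ?_)
      · exact map_zero u
      · exact (congrArg Neg.neg (map_zero w)).trans neg_zero
      · exact map_zero w
      · change u 0 - b * w 0 = 0
        rw [map_zero, map_zero, mul_zero, sub_zero]
    · refine Prod.ext (Prod.ext ?_ ?_) (Prod.ext ?_ ?_)
      · change 0 + p.val * r0 + l.val * 0 = v0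
        rw [d0, hpv]; ring
      · change -0 + l.val * -r2 = v1
        rw [g3]; ring
      · change -(0 + p.val * -r2) = v2
        rw [d2, hpv]; ring
      · change - -(0 : A[X]) = v3
        rw [g2, neg_zero, neg_zero]

end Cx

end Quadratic

/-! ## Polynomial rings on marks -/

section Marks

variable {A : Type} [CommRing A] [Algebra ℚ A] {gr : ℤ → Submodule ℚ A}

theorem GradedAlg.pow_mem [GradedAlg gr] {i : ℤ} {x : A} (h : x ∈ gr i) (n : ℕ) :
    x ^ n ∈ gr (n * i) := by
  induction n with
  | zero => simpa using GradedAlg.one_mem (gr := gr)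
  | succ n ih =>
    rw [pow_succ, show ((n + 1 : ℕ) : ℤ) * i = n * i + i by push_cast; ring]
    exact GradedAlg.mul_mem ih h

theorem GradedAlg.prod_mem [GradedAlg gr] {ι : Type} (s : Finset ι) (f : ι → A) (e : ι → ℤ)
    (h : ∀ m ∈ s, f m ∈ gr (e m)) : ∏ m ∈ s, f m ∈ gr (∑ m ∈ s, e m) := by
  classical
  induction s using Finset.induction_on with
  | empty => simpa using GradedAlg.one_mem (gr := gr)
  | insert m s hm ih =>
    rw [Finset.prod_insert hm, Finset.sum_insert hm]
    exact GradedAlg.mul_mem (h m (Finset.mem_insert_self m s))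
      (ih fun n hn => h n (Finset.mem_insert_of_mem hn))

/-- The quantum grading of `ℚ[M]`. -/
noncomputable def mvGr (M : Type) (i : ℤ) : Submodule ℚ (TotalRing M) :=
  MvPolynomial.weightedHomogeneousSubmodule ℚ (fun _ : M => (2 : ℤ)) i

variable {M N : Type}

theorem X_mem_mvGr (m : M) : MvPolynomial.X m ∈ mvGr M 2 := isQHomogeneous_X m

theorem weight_two (d : M →₀ ℕ) :
    Finsupp.weight (fun _ : M => (2 : ℤ)) d = ∑ m ∈ d.support, (d m : ℤ) * 2 := by
  rw [Finsupp.weight_apply, Finsupp.sum]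
  simp

instance [Finite M] : GradedAlg (mvGr M) where
  one_mem := isQHomogeneous_one
  mul_mem hx hy := MvPolynomial.IsWeightedHomogeneous.mul hx hy
  finite i := by
    have := Fintype.ofFinite M
    have hfin : {d : M →₀ ℕ | Finsupp.weight (fun _ : M => (2 : ℤ)) d = i}.Finite := by
      refine (Finsupp.finite_of_degree_le i.toNat).subset fun d hd => ?_
      have hd : Finsupp.weight (fun _ : M => (2 : ℤ)) d = i := hd
      rw [weight_two, ← Finset.sum_mul] at hd
      have : (d.degree : ℤ) = ∑ m ∈ d.support, (d m : ℤ) := by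
        rw [Finsupp.degree_apply]; push_cast; rfl
      change d.degree ≤ i.toNat
      omega
    rw [mvGr, MvPolynomial.weightedHomogeneousSubmodule_eq_finsupp_supported,
      AddMonoidAlgebra.supported_eq_span_single]
    exact FiniteDimensional.span_of_finite ℚ (hfin.image _)
  eq_bot i hi := by
    rw [eq_bot_iff]
    intro p hp
    rw [Submodule.mem_bot]
    ext d
    rw [MvPolynomial.coeff_zero]
    by_contra h
    have := hp h
    rw [weight_two] at this
    have h0 : (0 : ℤ) ≤ ∑ m ∈ d.support, (d m : ℤ) * 2 :=
      Finset.sum_nonneg fun m _ => by positivity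
    omega

/-- A homomorphism from `ℚ[M]` is graded if it maps the marks to elements of degree 2. -/
def mvHom [GradedAlg gr] (φ : TotalRing M →ₐ[ℚ] A) (h : ∀ m, φ (MvPolynomial.X m) ∈ gr 2) :
    GrHom (mvGr M) gr where
  hom := φ
  map_mem {i p} hp := by
    rw [MvPolynomial.as_sum p, map_sum]
    refine sum_mem fun d hd => ?_
    rw [MvPolynomial.monomial_eq, map_mul, MvPolynomial.algHom_C, Finsupp.prod, map_prod,
      ← Algebra.smul_def]
    refine Submodule.smul_mem _ _ ?_
    have hd' := hp (MvPolynomial.mem_support_iff.mp hd)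
    rw [weight_two] at hd'
    rw [← hd']
    refine GradedAlg.prod_mem _ _ _ fun m _ => ?_
    rw [map_pow]
    exact GradedAlg.pow_mem (h m) _

/-- Renaming of marks. -/
noncomputable def ren [Finite N] (ρ : M → N) : GrHom (mvGr M) (mvGr N) :=
  mvHom (MvPolynomial.rename ρ) fun m => by
    rw [MvPolynomial.rename_X]
    exact X_mem_mvGr _

@[simp] theorem ren_hom [Finite N] (ρ : M → N) (p : TotalRing M) :
    (ren ρ).hom p = MvPolynomial.rename ρ p := rfl

/-- Substitution of an element of degree 2 for the additional mark. -/
noncomputable def elim [Finite M] (p : TotalRing M) (hp : p ∈ mvGr M 2) :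
    GrHom (mvGr (Option M)) (mvGr M) :=
  mvHom (MvPolynomial.aeval fun o => o.elim p MvPolynomial.X) fun o => by
    rw [MvPolynomial.aeval_X]
    cases o
    · exact hp
    · exact X_mem_mvGr _

@[simp] theorem elim_hom [Finite M] (p : TotalRing M) (hp : p ∈ mvGr M 2)
    (f : TotalRing (Option M)) :
    (elim p hp).hom f = MvPolynomial.aeval (fun o => o.elim p MvPolynomial.X) f := rfl

/-- `ℚ[Option M] → ℚ[M][X]`. -/
noncomputable def toPoly (M : Type) [Finite M] : GrHom (mvGr (Option M)) (polyGr (mvGr M)) :=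
  mvHom (MvPolynomial.optionEquivLeft ℚ M).toAlgHom fun o => by
    cases o
    · change MvPolynomial.optionEquivLeft ℚ M _ ∈ _
      rw [MvPolynomial.optionEquivLeft_X_none]
      exact X_mem_polyGr
    · change MvPolynomial.optionEquivLeft ℚ M _ ∈ _
      rw [MvPolynomial.optionEquivLeft_X_some]
      exact C_mem_polyGr (X_mem_mvGr _)

theorem toPoly_rename [Finite M] (p : TotalRing M) :
    (toPoly M).hom (MvPolynomial.rename some p) = Polynomial.C p := by
  have : (toPoly M).hom.comp (MvPolynomial.rename some) =
      (Polynomial.CAlgHom : TotalRing M →ₐ[ℚ] Polynomial (TotalRing M)) := by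
    ext m
    simp [toPoly, mvHom]
  exact DFunLike.congr_fun this p

theorem toPoly_X [Finite M] : (toPoly M).hom (MvPolynomial.X none) = Polynomial.X :=
  MvPolynomial.optionEquivLeft_X_none ℚ M

/-- `ℚ[M][X] → ℚ[Option M]`. -/
noncomputable def ofPoly (M : Type) [Finite M] : GrHom (polyGr (mvGr M)) (mvGr (Option M)) where
  hom := (MvPolynomial.optionEquivLeft ℚ M).symm.toAlgHom
  map_mem {i p} hp := by
    change (MvPolynomial.optionEquivLeft ℚ M).symm p ∈ _
    rw [Polynomial.as_sum_range_C_mul_X_pow p, map_sum]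
    refine sum_mem fun n _ => ?_
    have h1 : (MvPolynomial.optionEquivLeft ℚ M).symm (Polynomial.C (p.coeff n)) =
        MvPolynomial.rename some (p.coeff n) := by
      rw [AlgEquiv.symm_apply_eq]
      exact (toPoly_rename _).symm
    rw [map_mul, map_pow, h1, MvPolynomial.optionEquivLeft_symm_X]
    have h2 := GradedAlg.mul_mem ((ren some).map_mem (hp n))
      (GradedAlg.pow_mem (X_mem_mvGr (none : Option M)) n)
    rwa [show i - 2 * (n : ℤ) + n * 2 = i by ring] at h2

/-- The Poincaré series at `t = -1` of a Koszul complex over `ℚ[M]`. -/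
noncomputable def kser [Finite M] (F : List (HElt (mvGr M))) : LaurentSeries (RatFunc ℚ) :=
  (Cx.koszul F (Cx.base (mvGr M))).series

theorem kser_perm [Finite M] {F G : List (HElt (mvGr M))} (h : F.Perm G) : kser F = kser G :=
  Cx.koszul_perm_series h _

theorem kser_equiv [Finite M] [Finite N] (e : M ≃ N) (F : List (HElt (mvGr M))) :
    kser (F.map (HElt.map (ren e))) = kser F := by
  refine (Cx.koszul_equiv_series (ren e) (ren e.symm) (fun x => ?_) (fun x => ?_) F).symm <;>
    simp [MvPolynomial.rename_rename]

/-- With `none` read as the polynomial variable over `ℚ[M]`, the rules for one variable become rules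
for removing one mark. -/
theorem toPoly_series [Finite M] (F : List (HElt (mvGr (Option M)))) :
    kser F = (Cx.koszul (F.map (HElt.map (toPoly M))) (Cx.base (polyGr (mvGr M)))).series :=
  Cx.koszul_equiv_series (toPoly M) (ofPoly M)
    (MvPolynomial.optionEquivLeft ℚ M).symm_apply_apply
    (MvPolynomial.optionEquivLeft ℚ M).apply_symm_apply F

theorem map_toPoly_ren [Finite M] (F : List (HElt (mvGr M))) :
    (F.map (HElt.map (ren some))).map (HElt.map (toPoly M)) =
      F.map (HElt.map (polyC (mvGr M))) := by
  rw [List.map_map]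
  refine List.map_congr_left fun f _ => HElt.ext rfl ?_
  exact toPoly_rename f.val

theorem kser_eliminate [Finite M] (p : TotalRing M) (hp : p ∈ mvGr M 2)
    (f : HElt (mvGr (Option M))) (hdeg : f.deg = 2)
    (hval : f.val = MvPolynomial.X none - MvPolynomial.rename some p)
    (F : List (HElt (mvGr (Option M)))) :
    kser (f :: F) = kser (F.map (HElt.map (elim p hp))) := by
  rw [toPoly_series, List.map_cons, Cx.koszul_eliminate_series p hp _ hdeg
    (by rw [HElt.map_val, hval, map_sub, toPoly_X, toPoly_rename]), kser, List.map_map]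
  congr 2
  refine List.map_congr_left fun g _ => HElt.ext rfl ?_
  rw [Function.comp_apply, HElt.map_val, HElt.map_val, HElt.map_val, polyEval_hom]
  have : ((polyEval p hp).hom.comp (toPoly M).hom) = (elim p hp).hom := by
    refine MvPolynomial.algHom_ext fun o => ?_
    cases o <;> simp [toPoly, mvHom, elim]
  rw [← this, AlgHom.comp_apply, polyEval_hom]

theorem kser_mul_X [Finite M] (δ : HElt (mvGr M)) (g : HElt (mvGr (Option M)))
    (hdeg : g.deg = δ.deg + 2)
    (hval : g.val = MvPolynomial.rename some δ.val * MvPolynomial.X none)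
    (F : List (HElt (mvGr M))) :
    kser (g :: F.map (HElt.map (ren some))) = kser F +
      Cx.mono 2 0 0 * kser ((δ :: F).map (HElt.map (ren some))) := by
  rw [toPoly_series, toPoly_series, map_toPoly_ren, List.map_cons, map_toPoly_ren, List.map_cons]
  exact Cx.koszul_mul_X_series δ _ hdeg
    (by rw [HElt.map_val, hval, map_mul, toPoly_X, toPoly_rename]) F

theorem kser_quadratic [Finite M] (b e : TotalRing M) (hb : b ∈ mvGr M 2) (he : e ∈ mvGr M 4)
    (c ce : HElt (mvGr M)) (p l : HElt (mvGr (Option M))) (hp : p.deg = 4)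
    (hpv : p.val = MvPolynomial.X none ^ 2 +
      (MvPolynomial.rename some b * MvPolynomial.X none + MvPolynomial.rename some e))
    (hl : l.deg = c.deg + 2)
    (hlv : l.val = MvPolynomial.rename some c.val * MvPolynomial.X none)
    (hce : ce.deg = c.deg + 4) (hcev : ce.val = c.val * e) (F : List (HElt (mvGr M))) :
    kser (p :: l :: F.map (HElt.map (ren some))) =
      kser (ce :: F) + Cx.mono 2 0 0 * kser (c :: F) := by
  rw [toPoly_series, List.map_cons, List.map_cons, map_toPoly_ren]
  refine Cx.koszul_quadratic_series b e hb he c ce _ _ hp ?_ hl ?_ hce hcev F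
  · rw [HElt.map_val, hpv]
    simp only [map_add, map_mul, map_pow, toPoly_X, toPoly_rename]
    rfl
  · rw [HElt.map_val, hlv, map_mul, toPoly_X, toPoly_rename]

/-- The zero element in a given degree. -/
def HElt.zero {A : Type} [CommRing A] [Algebra ℚ A] (gr : ℤ → Submodule ℚ A) (d : ℤ) : HElt gr :=
  ⟨d, 0, zero_mem _⟩

theorem mono_mul_mono (m n m' n' : ℤ) :
    Cx.mono m n 0 * Cx.mono m' n' 0 = Cx.mono (m + m') (n + n') 0 := by
  rw [Cx.mono, Cx.mono, Cx.mono, HahnSeries.single_mul_single]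
  congr 1
  simp [zpow_add₀ (RatFunc.X_ne_zero (K := ℚ))]

/-- The coefficient of `q ^ 0` is 1. These are the factors that are cancelled or divided by later
on. -/
theorem one_add_mono_ne_zero {m : ℤ} (hm : m ≠ 0) (n s : ℤ) : 1 + Cx.mono m n s ≠ 0 := by
  intro h
  have := congrArg (fun f => HahnSeries.coeff f 0) h
  rw [HahnSeries.coeff_add, Cx.mono, HahnSeries.coeff_single_of_ne hm.symm] at this
  simp at this

theorem kser_zero [Finite M] (f : HElt (mvGr M)) (hf : f.val = 0) (F : List (HElt (mvGr M))) :
    kser (f :: F) = (1 + Cx.mono f.deg 1 0) * kser F := Cx.koszul_zero_series f hf F _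

/-- A mark that does not occur. -/
theorem kser_free [Finite M] (F : List (HElt (mvGr M))) :
    (1 - Cx.mono 2 0 0) * kser (F.map (HElt.map (ren (some : M → Option M)))) = kser F := by
  -- The splitting for `δ = 0` of degree 0. The zero rows contribute `1 + a q²` on the left and `q²
  -- (1 + a)` on the right; the terms in `a` cancel and leave `1 - q²`.
  have h := kser_mul_X (HElt.zero _ 0) (HElt.zero _ 2) rfl (by simp [HElt.zero]) F
  rw [List.map_cons, kser_zero _ rfl, kser_zero _ (by simp [HElt.zero])] at h
  have h2 := mono_mul_mono 2 0 0 1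
  simp only [HElt.zero, HElt.map_deg, add_zero, zero_add] at h h2
  linear_combination h + kser (F.map (HElt.map (ren (some : M → Option M)))) * h2

/-- The quotient by a monic quadratic is free over the smaller ring on `1, X`, in degrees 0 and 2.
It is obtained from the splitting rule by adding a zero linear row and cancelling: `(1 + a q⁴) + q²
(1 + a) = (1 + q²)(1 + a q²)`. -/
theorem kser_monic_quadratic [Finite M] (b e : TotalRing M) (hb : b ∈ mvGr M 2)
    (he : e ∈ mvGr M 4) (p : HElt (mvGr (Option M))) (hp : p.deg = 4)
    (hpv : p.val = MvPolynomial.X none ^ 2 +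
      (MvPolynomial.rename some b * MvPolynomial.X none + MvPolynomial.rename some e))
    (F : List (HElt (mvGr M))) :
    kser (p :: F.map (HElt.map (ren some))) = (1 + Cx.mono 2 0 0) * kser F := by
  have h := kser_quadratic b e hb he (HElt.zero _ 0) (HElt.zero _ 4) p (HElt.zero _ 2) hp hpv rfl
    (by simp [HElt.zero]) rfl (by simp [HElt.zero]) F
  rw [kser_perm (List.Perm.swap _ _ _), kser_zero (HElt.zero _ 2) rfl,
    kser_zero (HElt.zero _ 4) rfl, kser_zero (HElt.zero _ 0) rfl] at h
  have h1 := mono_mul_mono 2 0 0 1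
  have h2 := mono_mul_mono 2 0 2 1
  simp only [HElt.zero, add_zero, zero_add] at h h1 h2
  norm_num at h2
  refine mul_left_cancel₀ (one_add_mono_ne_zero two_ne_zero 1 0) ?_
  linear_combination h + kser F * h1 - kser F * h2

end Marks

/-! ## Koszul elements of the pieces -/

section Elements

variable {M N : Type}

open MvPolynomial

/-- The Koszul element of an arc. -/
noncomputable def arcE (x y : M) : HElt (mvGr M) :=
  ⟨2, X y - X x, sub_mem (X_mem_mvGr y) (X_mem_mvGr x)⟩

/-- The linear Koszul element of a MOY vertex. -/
noncomputable def sumE (x₁ x₂ y₁ y₂ : M) : HElt (mvGr M) :=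
  ⟨2, X x₁ + X x₂ - X y₁ - X y₂, sub_mem (sub_mem (add_mem (X_mem_mvGr _) (X_mem_mvGr _))
    (X_mem_mvGr _)) (X_mem_mvGr _)⟩

theorem mul_mem_mvGr {i j : ℤ} {p r : TotalRing M} (hp : p ∈ mvGr M i) (hr : r ∈ mvGr M j) :
    p * r ∈ mvGr M (i + j) := MvPolynomial.IsWeightedHomogeneous.mul hp hr

theorem mul_mem_mvGr_four {p r : TotalRing M} (hp : p ∈ mvGr M 2) (hr : r ∈ mvGr M 2) :
    p * r ∈ mvGr M 4 := mul_mem_mvGr hp hr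

theorem mul_mem_mvGr_six {p r : TotalRing M} (hp : p ∈ mvGr M 2) (hr : r ∈ mvGr M 4) :
    p * r ∈ mvGr M 6 := mul_mem_mvGr hp hr

theorem one_mem_mvGr : (1 : TotalRing M) ∈ mvGr M 0 := isQHomogeneous_one

theorem X_sub_X_mem (x y : M) : (X x - X y : TotalRing M) ∈ mvGr M 2 :=
  sub_mem (X_mem_mvGr x) (X_mem_mvGr y)

/-- The quadratic Koszul element of a MOY vertex. -/
noncomputable def quadE (x₁ x₂ y₁ : M) : HElt (mvGr M) :=
  ⟨4, (X y₁ - X x₁) * (X y₁ - X x₂), mul_mem_mvGr_four (X_sub_X_mem _ _) (X_sub_X_mem _ _)⟩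

variable [Finite N]

theorem arcE_map (ρ : M → N) (x y : M) : (arcE x y).map (ren ρ) = arcE (ρ x) (ρ y) :=
  HElt.ext rfl (by simp [arcE])

theorem sumE_map (ρ : M → N) (x₁ x₂ y₁ y₂ : M) :
    (sumE x₁ x₂ y₁ y₂).map (ren ρ) = sumE (ρ x₁) (ρ x₂) (ρ y₁) (ρ y₂) :=
  HElt.ext rfl (by simp [sumE])

theorem quadE_map (ρ : M → N) (x₁ x₂ y₁ : M) :
    (quadE x₁ x₂ y₁).map (ren ρ) = quadE (ρ x₁) (ρ x₂) (ρ y₁) :=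
  HElt.ext rfl (by simp [quadE])

end Elements

/-! ## The state sum -/

section States

variable {M N : Type}

/-- The resolutions of a piece: coefficients and Koszul elements. -/
noncomputable def pieceTerms : Piece M → List (LaurentSeries (RatFunc ℚ) × List (HElt (mvGr M)))
  | .arc x y => [(1, [arcE x y])]
  | .wide x₁ x₂ y₁ y₂ => [(1, [sumE x₁ x₂ y₁ y₂, quadE x₁ x₂ y₁])]
  | .pos x₁ x₂ y₁ y₂ => [(1, [arcE x₁ y₁, arcE x₂ y₂]),
      (-Cx.mono (-2) 0 0, [sumE x₁ x₂ y₁ y₂, quadE x₁ x₂ y₁])]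
  | .neg x₁ x₂ y₁ y₂ => [(1, [arcE x₁ y₁, arcE x₂ y₂]),
      (-1, [sumE x₁ x₂ y₁ y₂, quadE x₁ x₂ y₁])]

theorem pieceTerms_map [Finite N] (ρ : M → N) (p : Piece M) :
    pieceTerms (p.map ρ) =
      (pieceTerms p).map fun t => (t.1, t.2.map (HElt.map (ren ρ))) := by
  cases p <;> simp [pieceTerms, Piece.map, arcE_map, sumE_map, quadE_map]

/-- The sum over all resolutions of the crossings. -/
noncomputable def stateSum [Finite M] :
    List (HElt (mvGr M)) → List (Piece M) → LaurentSeries (RatFunc ℚ)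
  | F, [] => kser F
  | F, p :: L => ((pieceTerms p).map fun t => t.1 * stateSum (t.2 ++ F) L).sum

theorem stateSum_perm_left [Finite M] {F G : List (HElt (mvGr M))} (h : F.Perm G)
    (L : List (Piece M)) : stateSum F L = stateSum G L := by
  induction L generalizing F G with
  | nil => exact kser_perm h
  | cons p L ih => simp only [stateSum, fun t : List (HElt (mvGr M)) => ih (h.append_left t)]

theorem sum_map_comm {α β R : Type*} [AddCommMonoid R] (l : List α) (l' : List β)
    (f : α → β → R) :
    (l.map fun s => (l'.map fun t => f s t).sum).sum =
      (l'.map fun t => (l.map fun s => f s t).sum).sum := by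
  simpa using Multiset.sum_map_sum_map (l : Multiset α) (l' : Multiset β) (f := f)

theorem stateSum_perm [Finite M] {L L' : List (Piece M)} (h : L.Perm L')
    (F : List (HElt (mvGr M))) : stateSum F L = stateSum F L' := by
  induction h generalizing F with
  | nil => rfl
  | cons p _ ih => simp only [stateSum, ih]
  | trans _ _ ih1 ih2 => exact (ih1 F).trans (ih2 F)
  | swap p p' L =>
    simp only [stateSum, ← List.sum_map_mul_left]
    rw [sum_map_comm]
    refine congrArg _ (List.map_congr_left fun s _ => congrArg _ (List.map_congr_left fun t _ => ?_))
    rw [stateSum_perm_left (List.perm_append_comm_assoc _ _ _), mul_left_comm]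

/-- A summand of a linear relation between diagrams with a common part marked by `M`. -/
structure Term (M : Type) where
  N : Type
  [finite : Finite N]
  ρ : M → N
  K : List (Piece N)
  c : LaurentSeries (RatFunc ℚ)

attribute [instance] Term.finite

/-- A linear relation between tangles gives a relation between diagrams. -/
theorem stateSum_relation (l : List (Term M))
    (h : ∀ G : List (HElt (mvGr M)),
      (l.map fun t => t.c * stateSum (G.map (HElt.map (ren t.ρ))) t.K).sum = 0)
    (L : List (Piece M)) (G : List (HElt (mvGr M))) :
    (l.map fun t => t.c * stateSum (G.map (HElt.map (ren t.ρ)))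
      (t.K ++ L.map (Piece.map t.ρ))).sum = 0 := by
  suffices (l.map fun t => t.c * stateSum (G.map (HElt.map (ren t.ρ)))
      (L.map (Piece.map t.ρ) ++ t.K)).sum = 0 by
    rw [← this]
    exact congrArg _ (List.map_congr_left fun t _ =>
      congrArg _ (stateSum_perm List.perm_append_comm _))
  induction L generalizing G with
  | nil => exact h G
  | cons p L ih =>
    simp only [List.map_cons, List.cons_append, stateSum, pieceTerms_map, List.map_map,
      ← List.sum_map_mul_left]
    -- The piece `p` has the same resolutions in every term, up to the renaming `t.ρ`. Summing over
    -- them last, each resolution can be absorbed into the additional rows `G`, over which the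
    -- induction hypothesis is quantified.
    rw [sum_map_comm]
    refine List.sum_eq_zero fun z hz => ?_
    obtain ⟨s, -, rfl⟩ := List.mem_map.mp hz
    rw [← mul_zero s.1, ← ih (s.2 ++ G), ← List.sum_map_mul_left]
    refine congrArg _ (List.map_congr_left fun t _ => ?_)
    rw [Function.comp_apply, List.map_append, mul_left_comm]

theorem map_ren_map_ren {M' : Type} [Finite N] [Finite M'] (ρ : M → N) (σ : N → M')
    (G : List (HElt (mvGr M))) :
    (G.map (HElt.map (ren ρ))).map (HElt.map (ren σ)) = G.map (HElt.map (ren (σ ∘ ρ))) := by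
  rw [List.map_map]
  refine List.map_congr_left fun f _ => HElt.ext rfl ?_
  simp [MvPolynomial.rename_rename]

theorem map_ren_id [Finite M] (G : List (HElt (mvGr M))) :
    G.map (HElt.map (ren (id : M → M))) = G := by
  conv_rhs => rw [← List.map_id G]
  refine List.map_congr_left fun f _ => HElt.ext rfl ?_
  simp

theorem stateSum_equiv [Finite M] [Finite N] (e : M ≃ N) (G : List (HElt (mvGr M)))
    (L : List (Piece M)) :
    stateSum (G.map (HElt.map (ren e))) (L.map (Piece.map e)) = stateSum G L := by
  induction L generalizing G with
  | nil => exact kser_equiv e G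
  | cons p L ih =>
    simp only [List.map_cons, stateSum, pieceTerms_map, List.map_map]
    refine congrArg _ (List.map_congr_left fun t _ => ?_)
    rw [Function.comp_apply, ← List.map_append, ih]

end States

/-! ## Relations between Koszul complexes -/

section Relations

open MvPolynomial

variable {M : Type} [Finite M]

theorem kser_rowop (g f f' : HElt (mvGr M)) (c : TotalRing M) (e : ℤ) (hc : c ∈ mvGr M e)
    (he : e + g.deg = f.deg) (hdeg : f'.deg = f.deg) (hval : f.val = f'.val + c * g.val)
    (F : List (HElt (mvGr M))) : kser (g :: f :: F) = kser (g :: f' :: F) :=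
  Cx.koszul_rowop_series f f' g c hdeg (by rwa [← he, add_sub_cancel_right]) hval F _

theorem kser_neg (f f' : HElt (mvGr M)) (hdeg : f'.deg = f.deg) (hval : f'.val = -f.val)
    (F : List (HElt (mvGr M))) : kser (f :: F) = kser (f' :: F) :=
  Cx.koszul_neg_series f f' hdeg hval F _

theorem map_elim_ren (p : TotalRing M) (hp : p ∈ mvGr M 2) (G : List (HElt (mvGr M))) :
    (G.map (HElt.map (ren some))).map (HElt.map (elim p hp)) = G := by
  rw [List.map_map]
  conv_rhs => rw [← List.map_id G]
  refine List.map_congr_left fun f _ => HElt.ext rfl ?_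
  simp only [Function.comp_apply, HElt.map_val, ren_hom, elim_hom, aeval_rename, id]
  exact aeval_X_left_apply f.val

/-- The translation of the additional mark. -/
noncomputable def translate (p : TotalRing M) (hp : p ∈ mvGr M 2) :
    GrHom (mvGr (Option M)) (mvGr (Option M)) :=
  mvHom (aeval fun o => o.elim (X none + rename some p) fun m => X (some m)) fun o => by
    rw [aeval_X]
    cases o
    · exact add_mem (X_mem_mvGr _) ((ren some).map_mem hp)
    · exact X_mem_mvGr _

@[simp] theorem translate_hom (p : TotalRing M) (hp : p ∈ mvGr M 2) (f : TotalRing (Option M)) :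
    (translate p hp).hom f =
      aeval (fun o => o.elim (X none + rename some p) fun m => X (some m)) f := rfl

theorem translate_rename (p : TotalRing M) (hp : p ∈ mvGr M 2) (f : TotalRing M) :
    (translate p hp).hom (rename some f) = rename some f := by
  have : (translate p hp).hom.comp (rename some) = rename some :=
    algHom_ext fun m => by simp
  exact DFunLike.congr_fun this f

theorem translate_translate (p r : TotalRing M) (hp : p ∈ mvGr M 2) (hr : r ∈ mvGr M 2)
    (h : p + r = 0) (f : TotalRing (Option M)) :
    (translate p hp).hom ((translate r hr).hom f) = f := by
  have : (translate p hp).hom.comp (translate r hr).hom = AlgHom.id ℚ _ := by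
    refine algHom_ext fun o => ?_
    cases o
    · rw [AlgHom.comp_apply, translate_hom r, aeval_X]
      simp only [Option.elim, map_add, translate_rename]
      rw [translate_hom, aeval_X]
      simp only [Option.elim, add_assoc, ← map_add, h, map_zero, add_zero]
      rfl
    · rw [AlgHom.comp_apply, translate_hom r, aeval_X]
      simp only [Option.elim]
      rw [translate_hom, aeval_X]
      rfl
  exact DFunLike.congr_fun this f

theorem kser_translate (p : TotalRing M) (hp : p ∈ mvGr M 2) (F : List (HElt (mvGr (Option M)))) :
    kser F = kser (F.map (HElt.map (translate p hp))) :=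
  Cx.koszul_equiv_series (translate p hp) (translate (-p) (neg_mem hp))
    (translate_translate _ _ _ _ (neg_add_cancel p))
    (translate_translate _ _ _ _ (add_neg_cancel p)) F

theorem map_translate_ren (p : TotalRing M) (hp : p ∈ mvGr M 2) (G : List (HElt (mvGr M))) :
    (G.map (HElt.map (ren some))).map (HElt.map (translate p hp)) =
      G.map (HElt.map (ren some)) := by
  rw [List.map_map]
  exact List.map_congr_left fun f _ => HElt.ext rfl (translate_rename p hp f.val)

/-- Left-right reflection of a MOY vertex. -/
theorem kser_vertex_swap (x₁ x₂ y₁ y₂ : M) (G : List (HElt (mvGr M))) :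
    kser (sumE x₁ x₂ y₁ y₂ :: quadE x₁ x₂ y₁ :: G) =
      kser (sumE x₂ x₁ y₂ y₁ :: quadE x₂ x₁ y₂ :: G) := by
  refine (kser_rowop (sumE x₁ x₂ y₁ y₂) (quadE x₁ x₂ y₁) (quadE x₂ x₁ y₂) (-(X y₁ - X y₂)) 2 (neg_mem (X_sub_X_mem _ _)) rfl rfl
    (by simp only [quadE, sumE]; ring) _).trans ?_
  exact congrArg kser (congrArg₂ List.cons (HElt.ext rfl (by simp only [sumE]; ring)) rfl)

/-- With the right ends joined, the linear row is `x - y` up to naming of the marks and divides the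
quadratic row. The latter reduces to zero, whence `1 + a q⁴`, and then the joined mark no longer
occurs, whence `1 - q²`. -/
theorem kser_curl (x y : M) (G : List (HElt (mvGr M))) :
    (1 - Cx.mono 2 0 0) * kser (sumE (some x) none (some y) none :: quadE (some x) none (some y) ::
      G.map (HElt.map (ren some))) = (1 + Cx.mono 4 1 0) * kser (arcE x y :: G) := by
  have h : kser (sumE (some x) none (some y) none :: quadE (some x) none (some y) ::
      G.map (HElt.map (ren some))) =
      (1 + Cx.mono 4 1 0) * kser ((arcE x y :: G).map (HElt.map (ren some))) := by
    calc _ = kser (sumE (some x) none (some y) none :: HElt.zero _ 4 ::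
          G.map (HElt.map (ren some))) :=
          kser_rowop (sumE (some x) none (some y) none) (quadE (some x) none (some y))
            (HElt.zero _ 4) (-(X (some y) - X none)) 2 (neg_mem (X_sub_X_mem _ _)) rfl rfl
            (by simp only [quadE, sumE, HElt.zero]; ring) _
      _ = kser (HElt.zero _ 4 :: sumE (some x) none (some y) none ::
          G.map (HElt.map (ren some))) := kser_perm (List.Perm.swap _ _ _)
      _ = (1 + Cx.mono 4 1 0) * kser (sumE (some x) none (some y) none ::
          G.map (HElt.map (ren some))) := kser_zero (HElt.zero _ 4) rfl _
      _ = _ := by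
          rw [List.map_cons, kser_neg (sumE (some x) none (some y) none)
            ((arcE x y).map (ren some)) rfl (by simp [sumE, arcE]; ring)]
  rw [h, ← kser_free (arcE x y :: G)]
  ring

/-- The lower linear row eliminates the right inner mark, and the upper linear row becomes that of
the outer ends. Let `s` be the left inner mark. The two quadratic rows add up to `(y₁ - x₁)(y₁ -
x₂)`, so that `s` survives only in the monic row `(s - x₁)(s - x₂)`, which gives `1 + q²`. -/
theorem kser_two_vertices (x₁ x₂ y₁ y₂ : M) (G : List (HElt (mvGr M))) :
    kser (sumE (some (some x₁)) (some (some x₂)) (some none) none ::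
      quadE (some (some x₁)) (some (some x₂)) (some none) ::
      sumE (some none) none (some (some y₁)) (some (some y₂)) ::
      quadE (some none) none (some (some y₁)) ::
      (G.map (HElt.map (ren some))).map (HElt.map (ren some))) =
    (1 + Cx.mono 2 0 0) * kser (sumE x₁ x₂ y₁ y₂ :: quadE x₁ x₂ y₁ :: G) := by
  have hp : (X (some x₁) + X (some x₂) - X none : TotalRing (Option M)) ∈ mvGr (Option M) 2 :=
    sub_mem (add_mem (X_mem_mvGr _) (X_mem_mvGr _)) (X_mem_mvGr _)
  let D : HElt (mvGr (Option M)) :=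
    ⟨4, (X (some y₁) - X none) * (X (some y₁) - (X (some x₁) + X (some x₂) - X none)),
      mul_mem_mvGr_four (X_sub_X_mem _ _) (sub_mem (X_mem_mvGr _) hp)⟩
  refine (kser_neg (sumE (some (some x₁)) (some (some x₂)) (some none) none)
    ⟨2, X none - rename some _, sub_mem (X_mem_mvGr _) ((ren some).map_mem hp)⟩ rfl
    (by simp only [sumE, map_sub, map_add, rename_X]; ring) _).trans ?_
  refine (kser_eliminate _ hp _ rfl rfl _).trans ?_
  simp only [List.map_cons]
  rw [map_elim_ren]
  calc _ = kser (quadE (some x₁) (some x₂) none :: (sumE x₁ x₂ y₁ y₂).map (ren some) :: D ::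
        G.map (HElt.map (ren some))) := by
        refine congrArg kser (congrArg₂ List.cons (HElt.ext rfl ?_) (congrArg₂ List.cons
          (HElt.ext rfl ?_) (congrArg₂ List.cons (HElt.ext rfl ?_) rfl))) <;>
        simp [quadE, sumE, D]
    _ = kser (quadE (some x₁) (some x₂) none :: D :: (sumE x₁ x₂ y₁ y₂).map (ren some) ::
        G.map (HElt.map (ren some))) := kser_perm ((List.Perm.swap _ _ _).cons _)
    _ = kser (quadE (some x₁) (some x₂) none :: (quadE x₁ x₂ y₁).map (ren some) ::
        (sumE x₁ x₂ y₁ y₂).map (ren some) :: G.map (HElt.map (ren some))) :=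
        kser_rowop (quadE (some x₁) (some x₂) none) D ((quadE x₁ x₂ y₁).map (ren some)) (-1) 0
          (neg_mem one_mem_mvGr) rfl rfl (by simp [quadE, D]; ring) _
    _ = (1 + Cx.mono 2 0 0) * kser (quadE x₁ x₂ y₁ :: sumE x₁ x₂ y₁ y₂ :: G) := by
        refine kser_monic_quadratic (-(X x₁ + X x₂)) (X x₁ * X x₂)
          (neg_mem (add_mem (X_mem_mvGr _) (X_mem_mvGr _)))
          (mul_mem_mvGr_four (X_mem_mvGr _) (X_mem_mvGr _)) _ rfl ?_
          (quadE x₁ x₂ y₁ :: sumE x₁ x₂ y₁ y₂ :: G)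
        simp [quadE]
        ring
    _ = _ := congrArg _ (kser_perm (List.Perm.swap _ _ _))

/-- The virtual crossing next to a MOY vertex. -/
theorem kser_virtual (x u y v : M) (G : List (HElt (mvGr M))) :
    kser (arcE (some none) (some (some y)) :: arcE (some (some x)) none ::
      sumE (some (some u)) none (some (some v)) (some none) ::
      quadE (some (some u)) none (some (some v)) ::
      (G.map (HElt.map (ren some))).map (HElt.map (ren some))) =
    kser (sumE u x v y :: quadE x u y :: G) := by
  have hx : (X (some x) : TotalRing (Option M)) ∈ mvGr (Option M) 2 := X_mem_mvGr _
  have hy : (X y : TotalRing M) ∈ mvGr M 2 := X_mem_mvGr _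
  refine (kser_perm (List.Perm.swap _ _ _)).trans ?_
  refine (kser_eliminate _ hx (arcE (some (some x)) none) rfl (by simp [arcE]) _).trans ?_
  simp only [List.map_cons]
  rw [map_elim_ren]
  refine (kser_neg ((arcE (some none) (some (some y))).map (elim _ hx)) (arcE (some y) none) rfl
    (by simp [arcE]) _).trans ?_
  refine (kser_eliminate _ hy (arcE (some y) none) rfl (by simp [arcE]) _).trans ?_
  simp only [List.map_cons]
  rw [map_elim_ren]
  calc _ = kser (sumE u x v y :: quadE u x v :: G) := by
        refine congrArg kser (congrArg₂ List.cons (HElt.ext rfl ?_) (congrArg₂ List.cons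
          (HElt.ext rfl ?_) rfl)) <;>
        simp [quadE, sumE]
    _ = _ := kser_rowop (sumE u x v y) (quadE u x v) (quadE x u y) (X y - X v) 2 (X_sub_X_mem _ _) rfl rfl
          (by simp only [quadE, sumE]; ring) _

/-- Let `s` be the inner mark `some none`. The first linear row eliminates the other inner mark as
`x + s - y`, after which the second linear row is free of `s`. Row operations turn the quadratic
rows into `(y - x)(s - u)` and `(y - x)(y - u)`, and a translation of `s` makes the first `(y - x)
s`. Splitting off the constants leaves a single vertex, which is also the value of the graph with
the virtual crossing; in the other summand the row `y - x` turns the vertex into arcs. -/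
theorem kser_antiparallel (x u y v : M) (G : List (HElt (mvGr M))) :
    (1 - Cx.mono 2 0 0) * kser (sumE (some (some x)) (some none) (some (some y)) none ::
      quadE (some (some x)) (some none) (some (some y)) ::
      sumE (some (some u)) none (some (some v)) (some none) ::
      quadE (some (some u)) none (some (some v)) ::
      (G.map (HElt.map (ren some))).map (HElt.map (ren some))) =
    (1 - Cx.mono 2 0 0) * kser (sumE u x v y :: quadE x u y :: G) +
      (Cx.mono 2 0 0 + Cx.mono 6 1 0) * kser (arcE x y :: arcE u v :: G) := by
  have hp : (X (some x) + X none - X (some y) : TotalRing (Option M)) ∈ mvGr (Option M) 2 :=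
    sub_mem (add_mem (X_mem_mvGr _) (X_mem_mvGr _)) (X_mem_mvGr _)
  have hu : (X u : TotalRing M) ∈ mvGr M 2 := X_mem_mvGr _
  let Q : HElt (mvGr (Option M)) :=
    ⟨4, (X (some v) - X (some u)) * (X (some v) - (X (some x) + X none - X (some y))),
      mul_mem_mvGr_four (X_sub_X_mem _ _) (sub_mem (X_mem_mvGr _) hp)⟩
  let Q' : HElt (mvGr (Option M)) :=
    ⟨4, (X (some y) - X (some x)) * (X none - X (some u)),
      mul_mem_mvGr_four (X_sub_X_mem _ _) (X_sub_X_mem _ _)⟩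
  let Q'' : HElt (mvGr (Option M)) :=
    ⟨4, (X (some y) - X (some x)) * X none, mul_mem_mvGr_four (X_sub_X_mem _ _) (X_mem_mvGr _)⟩
  have h1 : kser (sumE (some (some x)) (some none) (some (some y)) none ::
      quadE (some (some x)) (some none) (some (some y)) ::
      sumE (some (some u)) none (some (some v)) (some none) ::
      quadE (some (some u)) none (some (some v)) ::
      (G.map (HElt.map (ren some))).map (HElt.map (ren some))) =
      kser (Q'' :: (sumE u x v y :: quadE x u y :: G).map (HElt.map (ren some))) := by
    refine (kser_neg (sumE (some (some x)) (some none) (some (some y)) none)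
      ⟨2, X none - rename some _, sub_mem (X_mem_mvGr _) ((ren some).map_mem hp)⟩ rfl
      (by simp only [sumE, map_sub, map_add, rename_X]; ring) _).trans ?_
    refine (kser_eliminate _ hp _ rfl rfl _).trans ?_
    simp only [List.map_cons]
    rw [map_elim_ren]
    calc _ = kser (quadE (some x) none (some y) :: (sumE u x v y).map (ren some) :: Q ::
          G.map (HElt.map (ren some))) := by
          refine congrArg kser (congrArg₂ List.cons (HElt.ext rfl ?_) (congrArg₂ List.cons
            (HElt.ext rfl ?_) (congrArg₂ List.cons (HElt.ext rfl ?_) rfl))) <;>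
          simp [quadE, sumE, Q]
          ring
      _ = kser ((sumE u x v y).map (ren some) :: Q :: quadE (some x) none (some y) ::
          G.map (HElt.map (ren some))) :=
          kser_perm ((List.Perm.swap _ _ _).trans ((List.Perm.swap _ _ _).cons _))
      _ = kser ((sumE u x v y).map (ren some) :: Q' :: quadE (some x) none (some y) ::
          G.map (HElt.map (ren some))) :=
          kser_rowop ((sumE u x v y).map (ren some)) Q Q' (-(X (some v) - X none)) 2
            (neg_mem (X_sub_X_mem _ _)) rfl rfl (by simp [sumE, Q, Q']; ring) _
      _ = kser (Q' :: quadE (some x) none (some y) :: (sumE u x v y).map (ren some) ::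
          G.map (HElt.map (ren some))) :=
          kser_perm ((List.Perm.swap _ _ _).trans ((List.Perm.swap _ _ _).cons _))
      _ = kser (Q' :: (quadE x u y).map (ren some) :: (sumE u x v y).map (ren some) ::
          G.map (HElt.map (ren some))) :=
          kser_rowop Q' (quadE (some x) none (some y)) ((quadE x u y).map (ren some)) (-1) 0
            (neg_mem one_mem_mvGr) rfl rfl (by simp [quadE, Q']; ring) _
      _ = kser (Q' :: (sumE u x v y :: quadE x u y :: G).map (HElt.map (ren some))) :=
          kser_perm (by simp only [List.map_cons]; exact (List.Perm.swap _ _ _).cons _)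
      _ = _ := by
          rw [kser_translate _ hu, List.map_cons, map_translate_ren]
          refine congrArg kser (congrArg₂ List.cons (HElt.ext rfl ?_) rfl)
          simp [Q', Q'']
  have h2 := kser_mul_X (arcE x y) Q'' rfl (by simp [Q'', arcE]) (sumE u x v y :: quadE x u y :: G)
  have h3 := kser_free (arcE x y :: sumE u x v y :: quadE x u y :: G)
  -- In the presence of `y - x` the quadratic row of the vertex reduces to zero, which gives `1 + a
  -- q⁴`, and its linear row to the second arc.
  have h4 : kser (arcE x y :: sumE u x v y :: quadE x u y :: G) =
      (1 + Cx.mono 4 1 0) * kser (arcE x y :: arcE u v :: G) := by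
    calc _ = kser (arcE x y :: quadE x u y :: sumE u x v y :: G) :=
          kser_perm ((List.Perm.swap _ _ _).cons _)
      _ = kser (arcE x y :: HElt.zero _ 4 :: sumE u x v y :: G) :=
          kser_rowop (arcE x y) (quadE x u y) (HElt.zero _ 4) (X y - X u) 2 (X_sub_X_mem _ _) rfl rfl
            (by simp only [quadE, arcE, HElt.zero]; ring) _
      _ = kser (HElt.zero _ 4 :: arcE x y :: sumE u x v y :: G) :=
          kser_perm (List.Perm.swap _ _ _)
      _ = (1 + Cx.mono 4 1 0) * kser (arcE x y :: sumE u x v y :: G) :=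
          kser_zero (HElt.zero _ 4) rfl _
      _ = (1 + Cx.mono 4 1 0) * kser (arcE x y :: arcE v u :: G) :=
          congrArg _ (kser_rowop (arcE x y) (sumE u x v y) (arcE v u) (-1) 0 (neg_mem one_mem_mvGr) rfl rfl
            (by simp only [sumE, arcE]; ring) _)
      _ = (1 + Cx.mono 4 1 0) * kser (arcE v u :: arcE x y :: G) := by
          rw [kser_perm (List.Perm.swap (arcE v u) (arcE x y) G)]
      _ = (1 + Cx.mono 4 1 0) * kser (arcE u v :: arcE x y :: G) := by
          rw [kser_neg (arcE v u) (arcE u v) rfl (by simp [arcE])]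
      _ = _ := congrArg _ (kser_perm (List.Perm.swap _ _ _))
  have h5 := mono_mul_mono 2 0 4 1
  norm_num at h5
  rw [h1, h2]
  linear_combination Cx.mono 2 0 0 * h3 + Cx.mono 2 0 0 * h4 +
    kser (arcE x y :: arcE u v :: G) * h5

end Relations

/-! ## Relations between state sums -/

section Tangles

open MvPolynomial

variable {M : Type}

/-- The Koszul elements that identify the symmetric functions of the ends of three strands. -/
noncomputable def symE (x₁ x₂ x₃ y₁ y₂ y₃ : M) : List (HElt (mvGr M)) :=
  [⟨2, X x₁ + X x₂ + X x₃ - (X y₁ + X y₂ + X y₃), sub_mem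
      (add_mem (add_mem (X_mem_mvGr _) (X_mem_mvGr _)) (X_mem_mvGr _))
      (add_mem (add_mem (X_mem_mvGr _) (X_mem_mvGr _)) (X_mem_mvGr _))⟩,
    ⟨4, X x₁ * X x₂ + X x₁ * X x₃ + X x₂ * X x₃ - (X y₁ * X y₂ + X y₁ * X y₃ + X y₂ * X y₃),
      sub_mem
        (add_mem (add_mem (mul_mem_mvGr_four (X_mem_mvGr _) (X_mem_mvGr _))
          (mul_mem_mvGr_four (X_mem_mvGr _) (X_mem_mvGr _)))
          (mul_mem_mvGr_four (X_mem_mvGr _) (X_mem_mvGr _)))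
        (add_mem (add_mem (mul_mem_mvGr_four (X_mem_mvGr _) (X_mem_mvGr _))
          (mul_mem_mvGr_four (X_mem_mvGr _) (X_mem_mvGr _)))
          (mul_mem_mvGr_four (X_mem_mvGr _) (X_mem_mvGr _)))⟩,
    ⟨6, X x₁ * (X x₂ * X x₃) - X y₁ * (X y₂ * X y₃), sub_mem
      (mul_mem_mvGr_six (X_mem_mvGr _) (mul_mem_mvGr_four (X_mem_mvGr _) (X_mem_mvGr _)))
      (mul_mem_mvGr_six (X_mem_mvGr _) (mul_mem_mvGr_four (X_mem_mvGr _) (X_mem_mvGr _)))⟩]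

theorem symE_reverse (x₁ x₂ x₃ y₁ y₂ y₃ : M) : symE x₃ x₂ x₁ y₃ y₂ y₁ = symE x₁ x₂ x₃ y₁ y₂ y₃ :=
  congrArg₂ List.cons (HElt.ext rfl (by ring)) (congrArg₂ List.cons (HElt.ext rfl (by ring))
    (congrArg₂ List.cons (HElt.ext rfl (by ring)) rfl))

variable [Finite M]

/-- Eliminating a mark in favour of another mark is a renaming, so an arc just identifies its two
ends. -/
theorem kser_arc (x : M) (F : List (HElt (mvGr (Option M)))) :
    kser (arcE (some x) none :: F) = kser (F.map (HElt.map (ren fun o => o.getD x))) := by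
  rw [kser_eliminate (X x) (X_mem_mvGr x) (arcE (some x) none) rfl (by simp [arcE])]
  refine congrArg kser (List.map_congr_left fun f _ => HElt.ext rfl ?_)
  rw [HElt.map_val, HElt.map_val, elim_hom, ren_hom, rename_eq_aeval]
  congr 2
  funext o
  cases o <;> rfl

theorem stateSum_arcE (x : M) (F : List (HElt (mvGr (Option M)))) (L : List (Piece (Option M))) :
    stateSum (arcE (some x) none :: F) L =
      stateSum (F.map (HElt.map (ren fun o => o.getD x)))
        (L.map (Piece.map fun o => o.getD x)) := by
  induction L generalizing F with
  | nil => exact kser_arc x F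
  | cons p L ih =>
    simp only [List.map_cons, stateSum, pieceTerms_map, List.map_map]
    refine congrArg _ (List.map_congr_left fun t _ => ?_)
    rw [Function.comp_apply, ← List.map_append, ← ih, stateSum_perm_left List.perm_middle]

theorem stateSum_arc_cons (x y : M) (F : List (HElt (mvGr M))) (L : List (Piece M)) :
    stateSum F (.arc x y :: L) = stateSum (arcE x y :: F) L := by
  simp [stateSum, pieceTerms]

theorem stateSum_wide_cons (x₁ x₂ y₁ y₂ : M) (F : List (HElt (mvGr M))) (L : List (Piece M)) :
    stateSum F (.wide x₁ x₂ y₁ y₂ :: L) =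
      stateSum (sumE x₁ x₂ y₁ y₂ :: quadE x₁ x₂ y₁ :: F) L := by
  simp [stateSum, pieceTerms]

theorem stateSum_pos_cons (x₁ x₂ y₁ y₂ : M) (F : List (HElt (mvGr M))) (L : List (Piece M)) :
    stateSum F (.pos x₁ x₂ y₁ y₂ :: L) = stateSum F (.arc x₁ y₁ :: .arc x₂ y₂ :: L) -
      Cx.mono (-2) 0 0 * stateSum F (.wide x₁ x₂ y₁ y₂ :: L) := by
  rw [stateSum_arc_cons, stateSum_arc_cons, stateSum_wide_cons,
    stateSum_perm_left (List.Perm.swap (arcE x₁ y₁) _ _)]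
  simp only [stateSum, pieceTerms, List.map_cons, List.map_nil, List.sum_cons, List.sum_nil,
    List.cons_append, List.nil_append]
  ring

theorem stateSum_neg_cons (x₁ x₂ y₁ y₂ : M) (F : List (HElt (mvGr M))) (L : List (Piece M)) :
    stateSum F (.neg x₁ x₂ y₁ y₂ :: L) = stateSum F (.arc x₁ y₁ :: .arc x₂ y₂ :: L) -
      stateSum F (.wide x₁ x₂ y₁ y₂ :: L) := by
  rw [stateSum_arc_cons, stateSum_arc_cons, stateSum_wide_cons,
    stateSum_perm_left (List.Perm.swap (arcE x₁ y₁) _ _)]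
  simp only [stateSum, pieceTerms, List.map_cons, List.map_nil, List.sum_cons, List.sum_nil,
    List.cons_append, List.nil_append]
  ring

theorem stateSum_mark (x : M) (F : List (HElt (mvGr (Option M)))) (L : List (Piece (Option M))) :
    stateSum F (.arc (some x) none :: L) =
      stateSum (F.map (HElt.map (ren fun o => o.getD x)))
        (L.map (Piece.map fun o => o.getD x)) := by
  rw [stateSum_arc_cons, stateSum_arcE]

/-- Congruence of state sums: pieces can be replaced by a combination of others. -/
theorem stateSum_congr_head {F F' : List (HElt (mvGr M))} (h : ∀ G, kser (F ++ G) = kser (F' ++ G))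
    (G : List (HElt (mvGr M))) (L : List (Piece M)) :
    stateSum (F ++ G) L = stateSum (F' ++ G) L := by
  induction L generalizing G with
  | nil => exact h G
  | cons p L ih =>
    simp only [stateSum]
    refine congrArg _ (List.map_congr_left fun t _ => ?_)
    rw [stateSum_perm_left (List.perm_append_comm_assoc t.2 F G), ih,
      stateSum_perm_left (List.perm_append_comm_assoc t.2 F' G)]

theorem stateSum_mark_left (x : M) (F : List (HElt (mvGr (Option M))))
    (L : List (Piece (Option M))) :
    stateSum F (.arc none (some x) :: L) =
      stateSum (F.map (HElt.map (ren fun o => o.getD x)))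
        (L.map (Piece.map fun o => o.getD x)) := by
  rw [stateSum_arc_cons, ← stateSum_arcE]
  exact stateSum_congr_head (F := [arcE none (some x)]) (F' := [arcE (some x) none])
    (fun G => kser_neg (arcE none (some x)) (arcE (some x) none) rfl (by simp [arcE]) G) F L

theorem stateSum_wide_swap (x₁ x₂ y₁ y₂ : M) (F : List (HElt (mvGr M))) (L : List (Piece M)) :
    stateSum F (.wide x₁ x₂ y₁ y₂ :: L) = stateSum F (.wide x₂ x₁ y₂ y₁ :: L) := by
  rw [stateSum_wide_cons, stateSum_wide_cons]
  exact stateSum_congr_head (F := [_, _]) (F' := [_, _])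
    (fun G => kser_vertex_swap x₁ x₂ y₁ y₂ G) F L

theorem stateSum_pos_swap (x₁ x₂ y₁ y₂ : M) (F : List (HElt (mvGr M))) (L : List (Piece M)) :
    stateSum F (.pos x₁ x₂ y₁ y₂ :: L) = stateSum F (.pos x₂ x₁ y₂ y₁ :: L) := by
  rw [stateSum_pos_cons, stateSum_pos_cons, stateSum_wide_swap,
    stateSum_perm (List.Perm.swap _ _ _)]

/-- Elements of `ℚ[M]` in the presence of an additional mark. -/
noncomputable abbrev up (G : List (HElt (mvGr M))) : List (HElt (mvGr (Option M))) :=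
  G.map (HElt.map (ren some))

theorem map_up_getD (x : M) (G : List (HElt (mvGr M))) :
    (up G).map (HElt.map (ren fun o => o.getD x)) = G := by
  rw [map_ren_map_ren]
  exact map_ren_id G

theorem mono_mul_cancel (m : ℤ) : Cx.mono m 0 0 * Cx.mono (-m) 0 0 = 1 := by
  rw [mono_mul_mono, add_neg_cancel, add_zero, Cx.mono]
  simp

theorem stateSum_swap (p p' : Piece M) (F : List (HElt (mvGr M))) (L : List (Piece M)) :
    stateSum F (p :: p' :: L) = stateSum F (p' :: p :: L) :=
  stateSum_perm (List.Perm.swap _ _ _) F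

theorem stateSum_rotate (p p' p'' : Piece M) (F : List (HElt (mvGr M))) (L : List (Piece M)) :
    stateSum F (p :: p' :: p'' :: L) = stateSum F (p'' :: p :: p' :: L) :=
  stateSum_perm (List.perm_middle (l₁ := [p, p'])) F

/-! ### Two pieces stacked on two strands. -/

theorem stateSum_wide_wide (x₁ x₂ y₁ y₂ : M) (G : List (HElt (mvGr M))) :
    stateSum (up (up G)) [.wide (some none) none (some (some y₁)) (some (some y₂)),
      .wide (some (some x₁)) (some (some x₂)) (some none) none] =
    (1 + Cx.mono 2 0 0) * stateSum G [.wide x₁ x₂ y₁ y₂] := by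
  simp only [stateSum_wide_cons]
  exact kser_two_vertices x₁ x₂ y₁ y₂ G

theorem stateSum_arcs_wide (x₁ x₂ y₁ y₂ : M) (G : List (HElt (mvGr M))) :
    stateSum (up (up G)) [.wide (some none) none (some (some y₁)) (some (some y₂)),
      .arc (some (some x₁)) (some none), .arc (some (some x₂)) none] =
    stateSum G [.wide x₁ x₂ y₁ y₂] := by
  rw [stateSum_rotate, stateSum_mark, map_up_getD]
  simp only [List.map_cons, List.map_nil, Piece.map, Option.getD]
  rw [stateSum_swap, stateSum_mark, map_up_getD]
  simp only [List.map_cons, List.map_nil, Piece.map, Option.getD]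

theorem stateSum_wide_arcs (x₁ x₂ y₁ y₂ : M) (G : List (HElt (mvGr M))) :
    stateSum (up (up G)) [.arc (some none) (some (some y₁)), .arc none (some (some y₂)),
      .wide (some (some x₁)) (some (some x₂)) (some none) none] =
    stateSum G [.wide x₁ x₂ y₁ y₂] := by
  rw [stateSum_swap, stateSum_mark_left, map_up_getD]
  simp only [List.map_cons, List.map_nil, Piece.map, Option.getD]
  rw [stateSum_mark_left, map_up_getD]
  simp only [List.map_cons, List.map_nil, Piece.map, Option.getD]

theorem stateSum_arcs_arcs (x₁ x₂ y₁ y₂ : M) (G : List (HElt (mvGr M))) :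
    stateSum (up (up G)) [.arc (some none) (some (some y₁)), .arc none (some (some y₂)),
      .arc (some (some x₁)) (some none), .arc (some (some x₂)) none] =
    stateSum G [.arc x₁ y₁, .arc x₂ y₂] := by
  rw [stateSum_swap, stateSum_mark_left, map_up_getD]
  simp only [List.map_cons, List.map_nil, Piece.map, Option.getD]
  rw [stateSum_mark_left, map_up_getD]
  simp only [List.map_cons, List.map_nil, Piece.map, Option.getD]

/-- $(1 - q^{-2}b)^2 = 1 + (q^{-4} - q^{-2})b$, by $b^2 = (1+q^2)b$. It is needed in the expansion
of $\sigma_1\sigma_2\sigma_1$, where the middle crossing may be smoothed. -/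
theorem stateSum_pos_pos (x₁ x₂ y₁ y₂ : M) (G : List (HElt (mvGr M))) :
    stateSum (up (up G)) [.pos (some (some x₁)) (some (some x₂)) (some none) none,
      .pos (some none) none (some (some y₁)) (some (some y₂))] =
    stateSum G [.arc x₁ y₁, .arc x₂ y₂] +
      (Cx.mono (-4) 0 0 - Cx.mono (-2) 0 0) * stateSum G [.wide x₁ x₂ y₁ y₂] := by
  rw [stateSum_pos_cons, stateSum_rotate, stateSum_pos_cons, stateSum_swap (.wide _ _ _ _) (.pos _ _ _ _),
    stateSum_pos_cons, stateSum_arcs_arcs, stateSum_arcs_wide, stateSum_wide_arcs,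
    stateSum_wide_wide]
  have h1 := mono_mul_mono (-2) 0 (-2) 0
  have h2 := mono_mul_cancel 2
  norm_num at h1 h2
  linear_combination (stateSum G [.wide x₁ x₂ y₁ y₂]) * (h1 + Cx.mono (-2) 0 0 * h2)

/-- In $(1 - q^{-2}b)(1 - b)$ the square contributes $q^{-2}(1+q^2)b$, which cancels the two linear
terms. -/
theorem stateSum_pos_neg (x₁ x₂ y₁ y₂ : M) (G : List (HElt (mvGr M))) :
    stateSum (up (up G)) [.pos (some (some x₁)) (some (some x₂)) (some none) none,
      .neg (some none) none (some (some y₁)) (some (some y₂))] =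
    stateSum G [.arc x₁ y₁, .arc x₂ y₂] := by
  rw [stateSum_pos_cons, stateSum_rotate, stateSum_neg_cons, stateSum_swap (.wide _ _ _ _) (.neg _ _ _ _),
    stateSum_neg_cons, stateSum_arcs_arcs, stateSum_arcs_wide, stateSum_wide_arcs,
    stateSum_wide_wide]
  linear_combination (stateSum G [.wide x₁ x₂ y₁ y₂]) * mono_mul_cancel 2

theorem stateSum_neg_pos (x₁ x₂ y₁ y₂ : M) (G : List (HElt (mvGr M))) :
    stateSum (up (up G)) [.neg (some (some x₁)) (some (some x₂)) (some none) none,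
      .pos (some none) none (some (some y₁)) (some (some y₂))] =
    stateSum G [.arc x₁ y₁, .arc x₂ y₂] := by
  rw [stateSum_neg_cons, stateSum_rotate, stateSum_pos_cons, stateSum_swap (.wide _ _ _ _) (.pos _ _ _ _),
    stateSum_pos_cons, stateSum_arcs_arcs, stateSum_arcs_wide, stateSum_wide_arcs,
    stateSum_wide_wide]
  linear_combination (stateSum G [.wide x₁ x₂ y₁ y₂]) * mono_mul_cancel 2

theorem perm_reverse_three {α : Type*} (x y z : α) (l : List α) :
    (x :: y :: z :: l).Perm (z :: y :: x :: l) :=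
  (List.reverse_perm [z, y, x]).append_right l

/-! ### Three strands -/

/-- The linear rows of the last and the first vertex eliminate two inner marks. Let `s` be the
remaining one, `c = x₁ + x₂ - y₁ - y₂` and `m = y₁ + y₂ - x₃`. The quadratic rows are then `(s -
x₁)(s - x₂)`, `c (s - m)` and `(y₁ - s)(s - y₂)`; adding the first two to the third removes `s` from
it. After translating `s` by `m`, the splitting rule for a monic quadratic and a multiple of `s`
applies. Its shifted summand contains the row `c` and is the vertex next to an arc; the other
contains `c (m - x₁)(m - x₂)` and turns out to be symmetric in the strands. -/
theorem kser_three_vertices (x₁ x₂ x₃ y₁ y₂ y₃ : M) (G : List (HElt (mvGr M))) :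
    kser (sumE (some (some (some x₁))) (some (some (some x₂))) (some (some none)) (some none) ::
      quadE (some (some (some x₁))) (some (some (some x₂))) (some (some none)) ::
      sumE (some none) (some (some (some x₃))) none (some (some (some y₃))) ::
      quadE (some none) (some (some (some x₃))) none ::
      sumE (some (some none)) none (some (some (some y₁))) (some (some (some y₂))) ::
      quadE (some (some none)) none (some (some (some y₁))) :: up (up (up G))) =
    Cx.mono 2 0 0 * kser (sumE x₁ x₂ y₁ y₂ :: quadE x₁ x₂ y₁ :: arcE x₃ y₃ :: G) +
      kser (symE x₁ x₂ x₃ y₁ y₂ y₃ ++ G) := by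
  have hY (a b : M) : (X (some (some a)) + X (some (some b)) - X (some none) :
      TotalRing (Option (Option M))) ∈ mvGr (Option (Option M)) 2 :=
    sub_mem (add_mem (X_mem_mvGr _) (X_mem_mvGr _)) (X_mem_mvGr _)
  have hA (a b : M) : (X (some a) + X (some b) - X none :
      TotalRing (Option M)) ∈ mvGr (Option M) 2 :=
    sub_mem (add_mem (X_mem_mvGr _) (X_mem_mvGr _)) (X_mem_mvGr _)
  have hm : (X y₁ + X y₂ - X x₃ : TotalRing M) ∈ mvGr M 2 :=
    sub_mem (add_mem (X_mem_mvGr _) (X_mem_mvGr _)) (X_mem_mvGr _)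
  let m : TotalRing M := X y₁ + X y₂ - X x₃
  let c : HElt (mvGr M) := sumE x₁ x₂ y₁ y₂
  let E1 : HElt (mvGr M) := ⟨2, X x₁ + X x₂ + X x₃ - (X y₁ + X y₂ + X y₃), sub_mem
      (add_mem (add_mem (X_mem_mvGr _) (X_mem_mvGr _)) (X_mem_mvGr _))
      (add_mem (add_mem (X_mem_mvGr _) (X_mem_mvGr _)) (X_mem_mvGr _))⟩
  let E2 : HElt (mvGr M) := ⟨4, X x₁ * X x₂ - X y₁ * X y₂ - c.val * m, sub_mem
    (sub_mem (mul_mem_mvGr_four (X_mem_mvGr _) (X_mem_mvGr _))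
      (mul_mem_mvGr_four (X_mem_mvGr _) (X_mem_mvGr _)))
    (mul_mem_mvGr_four c.mem hm)⟩
  let B : HElt (mvGr (Option M)) := ⟨4, rename some c.val * (X none - rename some m),
    mul_mem_mvGr_four ((ren some).map_mem c.mem)
      (sub_mem (X_mem_mvGr _) ((ren some).map_mem hm))⟩
  let B' : HElt (mvGr (Option M)) := ⟨4, rename some c.val * X none,
    mul_mem_mvGr_four ((ren some).map_mem c.mem) (X_mem_mvGr _)⟩
  let C : HElt (mvGr (Option M)) := ⟨4, (X (some y₁) - X none) * (X none - X (some y₂)),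
    mul_mem_mvGr_four (X_sub_X_mem _ _) (X_sub_X_mem _ _)⟩
  let C' : HElt (mvGr (Option M)) := ⟨4, rename some E2.val - B.val,
    sub_mem ((ren some).map_mem E2.mem) B.mem⟩
  let P : HElt (mvGr (Option M)) := ⟨4, (X none + rename some m - X (some x₁)) *
      (X none + rename some m - X (some x₂)), mul_mem_mvGr_four
    (sub_mem (add_mem (X_mem_mvGr _) ((ren some).map_mem hm)) (X_mem_mvGr _))
    (sub_mem (add_mem (X_mem_mvGr _) ((ren some).map_mem hm)) (X_mem_mvGr _))⟩
  have hmx (x : M) : m - X x ∈ mvGr M 2 := sub_mem hm (X_mem_mvGr _)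
  let e : TotalRing M := (m - X x₁) * (m - X x₂)
  have he : e ∈ mvGr M 4 := mul_mem_mvGr_four (hmx _) (hmx _)
  let ce : HElt (mvGr M) := ⟨6, c.val * e, mul_mem_mvGr_six c.mem he⟩
  have h1 : kser (sumE (some (some (some x₁))) (some (some (some x₂))) (some (some none))
        (some none) ::
      quadE (some (some (some x₁))) (some (some (some x₂))) (some (some none)) ::
      sumE (some none) (some (some (some x₃))) none (some (some (some y₃))) ::
      quadE (some none) (some (some (some x₃))) none ::
      sumE (some (some none)) none (some (some (some y₁))) (some (some (some y₂))) ::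
      quadE (some (some none)) none (some (some (some y₁))) :: up (up (up G))) =
      kser (quadE (some x₁) (some x₂) none :: C :: B :: up (E1 :: G)) := by
    refine (kser_perm (List.perm_middle (l₁ := [_, _, _, _]))).trans ?_
    refine (kser_eliminate _ (hY y₁ y₂)
      (sumE (some (some none)) none (some (some (some y₁))) (some (some (some y₂)))) rfl
      (by simp only [sumE, map_sub, map_add, rename_X]; ring) _).trans ?_
    simp only [List.map_cons, List.cons_append, List.nil_append]
    rw [map_elim_ren]
    refine (kser_neg ((sumE (some (some (some x₁))) (some (some (some x₂))) (some (some none))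
      (some none)).map (elim _ (hY y₁ y₂)))
      ⟨2, X none - rename some _, sub_mem (X_mem_mvGr _) ((ren some).map_mem (hA x₁ x₂))⟩ rfl
      (by simp [sumE]) _).trans ?_
    refine (kser_eliminate _ (hA x₁ x₂) _ rfl rfl _).trans ?_
    simp only [List.map_cons]
    rw [map_elim_ren]
    calc _ = kser (quadE (some x₁) (some x₂) none :: E1.map (ren some) :: B :: C :: up G) := by
          refine congrArg kser (congrArg₂ List.cons (HElt.ext rfl ?_) (congrArg₂ List.cons
            (HElt.ext rfl ?_) (congrArg₂ List.cons (HElt.ext rfl ?_)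
              (congrArg₂ List.cons (HElt.ext rfl ?_) rfl)))) <;>
          simp [-mul_eq_mul_left_iff, -mul_eq_mul_right_iff, quadE, sumE, E1, B, C, c, m] <;> ring
      _ = _ := kser_perm ((perm_reverse_three _ _ _ _).cons _)
  have h2 : kser (quadE (some x₁) (some x₂) none :: C :: B :: up (E1 :: G)) =
      kser (quadE (some x₁) (some x₂) none :: B :: up (E2 :: E1 :: G)) := by
    calc _ = kser (quadE (some x₁) (some x₂) none :: C' :: B :: up (E1 :: G)) :=
          kser_rowop (quadE (some x₁) (some x₂) none) C C' (-1) 0 (neg_mem one_mem_mvGr) rfl rfl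
            (by simp [quadE, C, C', B, E2, c, m, sumE]; ring) _
      _ = kser (B :: C' :: quadE (some x₁) (some x₂) none :: up (E1 :: G)) :=
          kser_perm (perm_reverse_three _ _ _ _)
      _ = kser (B :: E2.map (ren some) :: quadE (some x₁) (some x₂) none :: up (E1 :: G)) :=
          kser_rowop B C' (E2.map (ren some)) (-1) 0 (neg_mem one_mem_mvGr) rfl rfl
            (by simp [C']; ring) _
      _ = _ := kser_perm (List.perm_middle (l₁ := [_, _]))
  have h3 : kser (quadE (some x₁) (some x₂) none :: B :: up (E2 :: E1 :: G)) =
      kser (P :: B' :: up (E2 :: E1 :: G)) := by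
    rw [kser_translate _ hm, List.map_cons, List.map_cons, map_translate_ren]
    refine congrArg kser (congrArg₂ List.cons (HElt.ext rfl ?_)
      (congrArg₂ List.cons (HElt.ext rfl ?_) rfl))
    · simp [quadE, P, m]
    · rw [HElt.map_val]
      simp only [B, B']
      rw [map_mul, map_sub, translate_rename, translate_rename]
      simp [m]
  have h4 := kser_quadratic (m + m - (X x₁ + X x₂)) e
    (sub_mem (add_mem hm hm) (add_mem (X_mem_mvGr _) (X_mem_mvGr _))) he
    c ce P B' rfl (by simp [P, e, m]; ring) rfl rfl rfl rfl (E2 :: E1 :: G)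
  -- Modulo the linear row `c` of the vertex, `E2` is its quadratic row and `E1` is the arc on the
  -- third strand.
  have h5 : kser (c :: E2 :: E1 :: G) =
      kser (sumE x₁ x₂ y₁ y₂ :: quadE x₁ x₂ y₁ :: arcE x₃ y₃ :: G) := by
    calc _ = kser (c :: quadE x₁ x₂ y₁ :: E1 :: G) :=
          kser_rowop c E2 (quadE x₁ x₂ y₁) (X y₁ - m) 2 (sub_mem (X_mem_mvGr _) hm) rfl rfl
            (by simp only [c, E2, quadE, sumE, m]; ring) _
      _ = kser (c :: E1 :: quadE x₁ x₂ y₁ :: G) := kser_perm ((List.Perm.swap _ _ _).cons _)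
      _ = kser (c :: arcE y₃ x₃ :: quadE x₁ x₂ y₁ :: G) :=
          kser_rowop c E1 (arcE y₃ x₃) 1 0 one_mem_mvGr rfl rfl
            (by simp only [c, E1, sumE, arcE]; ring) _
      _ = kser (arcE y₃ x₃ :: c :: quadE x₁ x₂ y₁ :: G) := kser_perm (List.Perm.swap _ _ _)
      _ = kser (arcE x₃ y₃ :: c :: quadE x₁ x₂ y₁ :: G) :=
          kser_neg (arcE y₃ x₃) (arcE x₃ y₃) rfl (by simp [arcE]) _
      _ = _ := kser_perm (List.perm_middle (l₁ := [_, _])).symm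
  -- The identity behind the row operations is `c e = y₁ y₂ E1 - (m - x₁ - x₂) E2 - (x₁ x₂ x₃ - y₁
  -- y₂ y₃)`. Then `E2` is changed by a multiple of `E1` into the difference of the second
  -- elementary symmetric functions.
  have h6 : kser (ce :: E2 :: E1 :: G) = kser (symE x₁ x₂ x₃ y₁ y₂ y₃ ++ G) := by
    let T : HElt (mvGr M) := ⟨6, c.val * e - X y₁ * X y₂ * E1.val, sub_mem ce.mem
      (mul_mem_mvGr (mul_mem_mvGr_four (X_mem_mvGr _) (X_mem_mvGr _)) E1.mem)⟩
    let T' : HElt (mvGr M) := ⟨6, -(X x₁ * (X x₂ * X x₃) - X y₁ * (X y₂ * X y₃)), neg_mem (sub_mem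
      (mul_mem_mvGr_six (X_mem_mvGr _) (mul_mem_mvGr_four (X_mem_mvGr _) (X_mem_mvGr _)))
      (mul_mem_mvGr_six (X_mem_mvGr _) (mul_mem_mvGr_four (X_mem_mvGr _) (X_mem_mvGr _))))⟩
    let S₂ : HElt (mvGr M) :=
      ⟨4, X x₁ * X x₂ + X x₁ * X x₃ + X x₂ * X x₃ - (X y₁ * X y₂ + X y₁ * X y₃ + X y₂ * X y₃),
      sub_mem
        (add_mem (add_mem (mul_mem_mvGr_four (X_mem_mvGr _) (X_mem_mvGr _))
          (mul_mem_mvGr_four (X_mem_mvGr _) (X_mem_mvGr _)))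
          (mul_mem_mvGr_four (X_mem_mvGr _) (X_mem_mvGr _)))
        (add_mem (add_mem (mul_mem_mvGr_four (X_mem_mvGr _) (X_mem_mvGr _))
          (mul_mem_mvGr_four (X_mem_mvGr _) (X_mem_mvGr _)))
          (mul_mem_mvGr_four (X_mem_mvGr _) (X_mem_mvGr _)))⟩
    let S₃ : HElt (mvGr M) := ⟨6, X x₁ * (X x₂ * X x₃) - X y₁ * (X y₂ * X y₃), sub_mem
      (mul_mem_mvGr_six (X_mem_mvGr _) (mul_mem_mvGr_four (X_mem_mvGr _) (X_mem_mvGr _)))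
      (mul_mem_mvGr_six (X_mem_mvGr _) (mul_mem_mvGr_four (X_mem_mvGr _) (X_mem_mvGr _)))⟩
    calc _ = kser (E1 :: ce :: E2 :: G) := kser_perm (List.perm_middle (l₁ := [_, _]))
      _ = kser (E1 :: T :: E2 :: G) :=
          kser_rowop E1 ce T (X y₁ * X y₂) 4 (mul_mem_mvGr_four (X_mem_mvGr _) (X_mem_mvGr _))
            rfl rfl (by simp only [ce, T]; ring) _
      _ = kser (E2 :: T :: E1 :: G) :=
          kser_perm (perm_reverse_three _ _ _ _)
      _ = kser (E2 :: T' :: E1 :: G) :=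
          kser_rowop E2 T T' (-(m - (X x₁ + X x₂))) 2
            (neg_mem (sub_mem hm (add_mem (X_mem_mvGr _) (X_mem_mvGr _))))
            rfl rfl (by simp only [T, T', E1, E2, c, e, m, sumE]; ring) _
      _ = kser (T' :: E1 :: E2 :: G) := kser_perm (List.perm_middle (l₁ := [_, _])).symm
      _ = kser (S₃ :: E1 :: E2 :: G) :=
          kser_neg T' S₃ rfl (by simp only [T', S₃]; ring) _
      _ = kser (E1 :: E2 :: S₃ :: G) :=
          kser_perm (List.perm_middle (l₁ := [_, _])).symm
      _ = _ := kser_rowop E1 E2 S₂ (-(X y₁ + X y₂)) 2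
            (neg_mem (add_mem (X_mem_mvGr _) (X_mem_mvGr _))) rfl rfl
            (by simp only [E1, E2, S₂, c, m, sumE]; ring) _
  rw [h1, h2, h3, h4, h5, h6, add_comm]

end Tangles

/-! ## Tangles with three strands -/

section Marks

variable {M N : Type}

theorem Piece.map_comp {N' : Type} (f : M → N) (g : N → N') (L : List (Piece M)) :
    (L.map (Piece.map f)).map (Piece.map g) = L.map (Piece.map (g ∘ f)) := by
  rw [List.map_map]
  refine List.map_congr_left fun p _ => ?_
  cases p <;> rfl

/-- Exchange of two additional marks. -/
def optionSwap (M : Type) : Option (Option M) ≃ Option (Option M) where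
  toFun
    | none => some none
    | some none => none
    | some (some m) => some (some m)
  invFun
    | none => some none
    | some none => none
    | some (some m) => some (some m)
  left_inv o := by rcases o with _ | _ | _ <;> rfl
  right_inv o := by rcases o with _ | _ | _ <;> rfl

/-- Two additional marks. -/
def optionTwo (M : Type) : Option (Option M) ≃ M ⊕ Fin 2 where
  toFun
    | none => Sum.inr 1
    | some none => Sum.inr 0
    | some (some m) => Sum.inl m
  invFun := Sum.elim (fun m => some (some m)) ![some none, none]
  left_inv o := by rcases o with _ | _ | _ <;> rfl
  right_inv o := by
    rcases o with m | i
    · rfl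
    · fin_cases i <;> rfl

/-- Three additional marks. -/
def optionThree (M : Type) : Option (Option (Option M)) ≃ M ⊕ Fin 3 where
  toFun
    | none => Sum.inr 2
    | some none => Sum.inr 1
    | some (some none) => Sum.inr 0
    | some (some (some m)) => Sum.inl m
  invFun := Sum.elim (fun m => some (some (some m))) ![some (some none), some none, none]
  left_inv o := by rcases o with _ | _ | _ | _ <;> rfl
  right_inv o := by
    rcases o with m | i
    · rfl
    · fin_cases i <;> rfl

/-- Three additional marks, in a different order. -/
def optionThree' (M : Type) : Option (Option (Option M)) ≃ M ⊕ Fin 3 where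
  toFun
    | none => Sum.inr 2
    | some none => Sum.inr 0
    | some (some none) => Sum.inr 1
    | some (some (some m)) => Sum.inl m
  invFun := Sum.elim (fun m => some (some (some m))) ![some none, some (some none), none]
  left_inv o := by rcases o with _ | _ | _ | _ <;> rfl
  right_inv o := by
    rcases o with m | i
    · rfl
    · fin_cases i <;> rfl

variable [Finite M]

/-- The rule for an arc at the outermost mark, conjugated by the exchange of the two additional
marks; the substitution now leaves the outermost mark alone. -/
theorem stateSum_mark_second (x : M) (F : List (HElt (mvGr (Option (Option M)))))
    (L : List (Piece (Option (Option M)))) :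
    stateSum F (.arc (some (some x)) (some none) :: L) =
      stateSum (F.map (HElt.map (ren (Option.map fun o => o.getD x))))
        (L.map (Piece.map (Option.map fun o => o.getD x))) := by
  have h : (fun o => o.getD (some x)) ∘ optionSwap M = Option.map fun o => o.getD x := by
    funext o
    rcases o with _ | _ | _ <;> rfl
  rw [← stateSum_equiv (optionSwap M), List.map_cons]
  refine (stateSum_mark (some x) _ _).trans ?_
  rw [Piece.map_comp, map_ren_map_ren, h]

theorem stateSum_mark_second_left (x : M) (F : List (HElt (mvGr (Option (Option M)))))
    (L : List (Piece (Option (Option M)))) :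
    stateSum F (.arc (some none) (some (some x)) :: L) =
      stateSum (F.map (HElt.map (ren (Option.map fun o => o.getD x))))
        (L.map (Piece.map (Option.map fun o => o.getD x))) := by
  have h : (fun o => o.getD (some x)) ∘ optionSwap M = Option.map fun o => o.getD x := by
    funext o
    rcases o with _ | _ | _ <;> rfl
  rw [← stateSum_equiv (optionSwap M), List.map_cons]
  refine (stateSum_mark_left (some x) _ _).trans ?_
  rw [Piece.map_comp, map_ren_map_ren, h]

theorem map_up_getD_second (x : M) (G : List (HElt (mvGr M))) :
    (up (up G)).map (HElt.map (ren (Option.map fun o => o.getD x))) = up G := by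
  rw [map_ren_map_ren, map_ren_map_ren]
  rfl

theorem stateSum_three_wides (x₁ x₂ x₃ y₁ y₂ y₃ : M) (G : List (HElt (mvGr M))) :
    stateSum (up (up (up G)))
      [.wide (some (some none)) none (some (some (some y₁))) (some (some (some y₂))),
        .wide (some none) (some (some (some x₃))) none (some (some (some y₃))),
        .wide (some (some (some x₁))) (some (some (some x₂))) (some (some none)) (some none)] =
    Cx.mono 2 0 0 * stateSum G [.wide x₁ x₂ y₁ y₂, .arc x₃ y₃] +
      kser (symE x₁ x₂ x₃ y₁ y₂ y₃ ++ G) := by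
  rw [stateSum_swap (.wide x₁ x₂ y₁ y₂)]
  simp only [stateSum_wide_cons, stateSum_arc_cons]
  exact kser_three_vertices x₁ x₂ x₃ y₁ y₂ y₃ G

/-- The value of `σ₁σ₂σ₁`, symmetric under the left-right reflection. -/
noncomputable def braidSum (x₁ x₂ x₃ y₁ y₂ y₃ : M) (G : List (HElt (mvGr M))) :
    LaurentSeries (RatFunc ℚ) :=
  stateSum G [.arc x₁ y₁, .arc x₂ y₂, .arc x₃ y₃] -
    Cx.mono (-2) 0 0 * (stateSum G [.wide x₁ x₂ y₁ y₂, .arc x₃ y₃] +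
      stateSum G [.wide x₂ x₃ y₂ y₃, .arc x₁ y₁]) +
    Cx.mono (-4) 0 0 * (stateSum (up G) [.wide (some x₂) (some x₃) none (some y₃),
        .wide (some x₁) none (some y₁) (some y₂)] +
      stateSum (up G) [.wide (some x₁) (some x₂) (some y₁) none,
        .wide none (some x₃) (some y₂) (some y₃)]) -
    Cx.mono (-6) 0 0 * kser (symE x₁ x₂ x₃ y₁ y₂ y₃ ++ G)

/-- Reflection exchanges $b_1$ with $b_2$ and $b_1b_2$ with $b_2b_1$, which have equal coefficients,
and fixes the arcs and the symmetric term. -/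
theorem braidSum_reverse (x₁ x₂ x₃ y₁ y₂ y₃ : M) (G : List (HElt (mvGr M))) :
    braidSum x₃ x₂ x₁ y₃ y₂ y₁ G = braidSum x₁ x₂ x₃ y₁ y₂ y₃ G := by
  rw [braidSum, braidSum, symE_reverse, stateSum_perm (perm_reverse_three _ _ _ _),
    stateSum_wide_swap x₃, stateSum_wide_swap x₂ x₁, stateSum_wide_swap (some x₃),
    stateSum_swap (.wide (some x₂) _ _ _), stateSum_wide_swap (some x₃),
    stateSum_swap (.wide (some x₂) (some x₃) none (some y₃)) (.wide none _ _ _),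
    stateSum_wide_swap none (some x₁), stateSum_swap (.wide (some x₁) none _ _),
    stateSum_swap (.wide none (some x₃) _ _), stateSum_wide_swap (some x₂) (some x₁)]
  ring

theorem stateSum_pos_pos_cons (x₁ x₂ y₁ y₂ x₁' x₂' y₁' y₂' : M) (F : List (HElt (mvGr M)))
    (L : List (Piece M)) :
    stateSum F (.pos x₁ x₂ y₁ y₂ :: .pos x₁' x₂' y₁' y₂' :: L) =
      stateSum F (.arc x₁ y₁ :: .arc x₂ y₂ :: .arc x₁' y₁' :: .arc x₂' y₂' :: L) -
      Cx.mono (-2) 0 0 * (stateSum F (.arc x₁ y₁ :: .arc x₂ y₂ :: .wide x₁' x₂' y₁' y₂' :: L) +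
        stateSum F (.wide x₁ x₂ y₁ y₂ :: .arc x₁' y₁' :: .arc x₂' y₂' :: L)) +
      Cx.mono (-4) 0 0 * stateSum F (.wide x₁ x₂ y₁ y₂ :: .wide x₁' x₂' y₁' y₂' :: L) := by
  have h := mono_mul_mono (-2) 0 (-2) 0
  norm_num at h
  simp only [stateSum_pos_cons, stateSum_arc_cons, stateSum_wide_cons]
  linear_combination h * stateSum (sumE x₁' x₂' y₁' y₂' :: quadE x₁' x₂' y₁' ::
    sumE x₁ x₂ y₁ y₂ :: quadE x₁ x₂ y₁ :: F) L

/-- In $(1 - q^{-2}b_1)(1 - q^{-2}b_2)(1 - q^{-2}b_1)$ substitute $b_1^2 = (1+q^2)b_1$ and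
$b_1b_2b_1 = q^2b_1 + S$. The coefficient of $b_1$ becomes $-2q^{-2} + q^{-4}(1+q^2) - q^{-4} =
-q^{-2}$, the same as that of $b_2$. -/
theorem stateSum_three_pos (x₁ x₂ x₃ y₁ y₂ y₃ : M) (G : List (HElt (mvGr M))) :
    stateSum (up (up (up G)))
      [.pos (some none) (some (some (some x₃))) none (some (some (some y₃))),
        .pos (some (some (some x₁))) (some (some (some x₂))) (some (some none)) (some none),
        .pos (some (some none)) none (some (some (some y₁))) (some (some (some y₂)))] =
    braidSum x₁ x₂ x₃ y₁ y₂ y₃ G := by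
  have h1 : stateSum (up (up (up G)))
      [.arc (some none) none, .arc (some (some (some x₃))) (some (some (some y₃))),
        .pos (some (some (some x₁))) (some (some (some x₂))) (some (some none)) (some none),
        .pos (some (some none)) none (some (some (some y₁))) (some (some (some y₂)))] =
      stateSum G [.arc x₁ y₁, .arc x₂ y₂, .arc x₃ y₃] +
        (Cx.mono (-4) 0 0 - Cx.mono (-2) 0 0) *
          stateSum G [.wide x₁ x₂ y₁ y₂, .arc x₃ y₃] := by
    rw [stateSum_mark, map_up_getD]
    simp only [List.map_cons, List.map_nil, Piece.map, Option.getD]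
    rw [stateSum_arc_cons, ← arcE_map some, ← arcE_map some, ← List.map_cons, ← List.map_cons,
      stateSum_pos_pos, ← stateSum_arc_cons, ← stateSum_arc_cons, stateSum_rotate (.arc x₁ y₁),
      stateSum_swap (.wide x₁ x₂ y₁ y₂)]
  have h2 : stateSum (up (up (up G)))
      [.arc (some (some (some x₁))) (some (some none)), .arc (some (some (some x₂))) (some none),
        .arc (some (some none)) (some (some (some y₁))), .arc none (some (some (some y₂))),
        .wide (some none) (some (some (some x₃))) none (some (some (some y₃)))] =
      stateSum G [.wide x₂ x₃ y₂ y₃, .arc x₁ y₁] := by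
    rw [stateSum_swap, stateSum_mark_second, map_up_getD_second]
    simp only [List.map_cons, List.map_nil, Piece.map, Option.map, Option.getD]
    rw [stateSum_mark_second, map_up_getD_second]
    simp only [List.map_cons, List.map_nil, Piece.map, Option.map, Option.getD]
    rw [stateSum_swap, stateSum_mark_left, map_up_getD]
    simp only [List.map_cons, List.map_nil, Piece.map, Option.getD]
    rw [stateSum_swap]
  have h3 : stateSum (up (up (up G)))
      [.arc (some (some (some x₁))) (some (some none)), .arc (some (some (some x₂))) (some none),
        .wide (some (some none)) none (some (some (some y₁))) (some (some (some y₂))),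
        .wide (some none) (some (some (some x₃))) none (some (some (some y₃)))] =
      stateSum (up G) [.wide (some x₂) (some x₃) none (some y₃),
        .wide (some x₁) none (some y₁) (some y₂)] := by
    rw [stateSum_swap, stateSum_mark_second, map_up_getD_second]
    simp only [List.map_cons, List.map_nil, Piece.map, Option.map, Option.getD]
    rw [stateSum_mark_second, map_up_getD_second]
    simp only [List.map_cons, List.map_nil, Piece.map, Option.map, Option.getD]
    rw [stateSum_swap]
  have h4 : stateSum (up (up (up G)))
      [.wide (some (some (some x₁))) (some (some (some x₂))) (some (some none)) (some none),
        .arc (some (some none)) (some (some (some y₁))), .arc none (some (some (some y₂))),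
        .wide (some none) (some (some (some x₃))) none (some (some (some y₃)))] =
      stateSum (up G) [.wide (some x₁) (some x₂) (some y₁) none,
        .wide none (some x₃) (some y₂) (some y₃)] := by
    rw [stateSum_rotate, stateSum_mark_left, map_up_getD]
    simp only [List.map_cons, List.map_nil, Piece.map, Option.getD]
    rw [stateSum_swap, stateSum_mark_second_left, map_up_getD_second]
    simp only [List.map_cons, List.map_nil, Piece.map, Option.map, Option.getD]
  rw [stateSum_pos_cons, h1, stateSum_rotate (.wide (some none) _ _ _),
    stateSum_rotate (.pos (some (some none)) _ _ _), stateSum_pos_pos_cons, h2, h3, h4,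
    stateSum_rotate (.wide (some (some (some x₁))) _ _ _),
    stateSum_rotate (.wide (some none) _ _ _), stateSum_three_wides, braidSum]
  have h5 := mono_mul_mono (-2) 0 (-2) 0
  have h6 := mono_mul_mono (-2) 0 (-4) 0
  have h7 := mono_mul_mono (-6) 0 2 0
  norm_num at h5 h6 h7
  generalize stateSum G [.wide x₁ x₂ y₁ y₂, .arc x₃ y₃] = B₁
  generalize kser (symE x₁ x₂ x₃ y₁ y₂ y₃ ++ G) = S
  generalize stateSum (up G) [.wide (some x₂) (some x₃) none (some y₃),
    .wide (some x₁) none (some y₁) (some y₂)] = Z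
  generalize stateSum (up G) [.wide (some x₁) (some x₂) (some y₁) none,
    .wide none (some x₃) (some y₂) (some y₃)] = Z'
  linear_combination (Z + Z') * h5 - (Cx.mono 2 0 0 * B₁ + S) * h6 - B₁ * h7

/-! ### Relations between diagrams -/

theorem stateSum_two_terms [Finite N] (ρ : M → N) (K : List (Piece N))
    (K' : List (Piece M)) (c : LaurentSeries (RatFunc ℚ))
    (h : ∀ G, stateSum (G.map (HElt.map (ren ρ))) K = c * stateSum G K') (L : List (Piece M)) :
    stateSum [] (K ++ L.map (Piece.map ρ)) = c * stateSum [] (K' ++ L) := by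
  have hid : L.map (Piece.map id) = L := by
    conv_rhs => rw [← List.map_id L]
    exact List.map_congr_left fun p _ => by cases p <;> rfl
  have := stateSum_relation (M := M) [⟨N, ρ, K, 1⟩, ⟨M, id, K', -c⟩] (fun G => by
    simp only [List.map_cons, List.map_nil, List.sum_cons, List.sum_nil, map_ren_id, h]
    ring) L []
  simp only [List.map_cons, List.map_nil, List.sum_cons, List.sum_nil, hid] at this
  linear_combination this

/-- Inner marks are added as iterated `Option`s in the computations, where they can be removed one
at a time, and as `Sum.inr _` in the diagrams. -/
theorem stateSum_optionTwo (K : List (Piece (Option (Option M)))) (G : List (HElt (mvGr M))) :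
    stateSum (G.map (HElt.map (ren Sum.inl))) (K.map (Piece.map (optionTwo M))) =
      stateSum (up (up G)) K := by
  rw [← stateSum_equiv (optionTwo M), map_ren_map_ren, map_ren_map_ren]
  rfl

theorem stateSum_optionThree (K : List (Piece (Option (Option (Option M)))))
    (G : List (HElt (mvGr M))) :
    stateSum (G.map (HElt.map (ren Sum.inl))) (K.map (Piece.map (optionThree M))) =
      stateSum (up (up (up G))) K := by
  rw [← stateSum_equiv (optionThree M), map_ren_map_ren, map_ren_map_ren, map_ren_map_ren]
  rfl

theorem stateSum_optionThree' (K : List (Piece (Option (Option (Option M)))))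
    (G : List (HElt (mvGr M))) :
    stateSum (G.map (HElt.map (ren Sum.inl))) (K.map (Piece.map (optionThree' M))) =
      stateSum (up (up (up G))) K := by
  rw [← stateSum_equiv (optionThree' M), map_ren_map_ren, map_ren_map_ren, map_ren_map_ren]
  rfl

theorem stateSum_reidIIa_pos_neg (x₁ x₂ y₁ y₂ : M) (L : List (Piece M)) :
    stateSum [] (Piece.pos (Sum.inl x₁) (Sum.inl x₂) (Sum.inr 0) (Sum.inr 1) ::
        Piece.neg (Sum.inr 0) (Sum.inr 1) (Sum.inl y₁) (Sum.inl y₂) ::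
        L.map (Piece.map (Sum.inl : M → M ⊕ Fin 2))) =
      stateSum [] (Piece.arc x₁ y₁ :: Piece.arc x₂ y₂ :: L) :=
  (stateSum_two_terms Sum.inl [_, _] [_, _] 1 (fun G =>
    (stateSum_optionTwo [_, _] G).trans ((stateSum_pos_neg x₁ x₂ y₁ y₂ G).trans
      (one_mul _).symm)) L).trans (one_mul _)

theorem stateSum_reidIIa_neg_pos (x₁ x₂ y₁ y₂ : M) (L : List (Piece M)) :
    stateSum [] (Piece.neg (Sum.inl x₁) (Sum.inl x₂) (Sum.inr 0) (Sum.inr 1) ::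
        Piece.pos (Sum.inr 0) (Sum.inr 1) (Sum.inl y₁) (Sum.inl y₂) ::
        L.map (Piece.map (Sum.inl : M → M ⊕ Fin 2))) =
      stateSum [] (Piece.arc x₁ y₁ :: Piece.arc x₂ y₂ :: L) :=
  (stateSum_two_terms Sum.inl [_, _] [_, _] 1 (fun G =>
    (stateSum_optionTwo [_, _] G).trans ((stateSum_neg_pos x₁ x₂ y₁ y₂ G).trans
      (one_mul _).symm)) L).trans (one_mul _)

theorem stateSum_moyIIa (x₁ x₂ y₁ y₂ : M) (L : List (Piece M)) :
    stateSum [] (Piece.wide (Sum.inl x₁) (Sum.inl x₂) (Sum.inr 0) (Sum.inr 1) ::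
        Piece.wide (Sum.inr 0) (Sum.inr 1) (Sum.inl y₁) (Sum.inl y₂) ::
        L.map (Piece.map (Sum.inl : M → M ⊕ Fin 2))) =
      (1 + Cx.mono 2 0 0) * stateSum [] (Piece.wide x₁ x₂ y₁ y₂ :: L) :=
  stateSum_two_terms Sum.inl [_, _] [_] _ (fun G => by
    rw [← stateSum_wide_wide, ← stateSum_optionTwo, stateSum_swap]
    rfl) L

/-- The right-hand tangle is the left-right reflection of the left-hand one, so both are evaluated
by the same expansion, whose value does not change under reflection. -/
theorem stateSum_reidIII (x₁ x₂ x₃ y₁ y₂ y₃ : M) (L : List (Piece M)) :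
    stateSum [] (Piece.pos (Sum.inl x₁) (Sum.inl x₂) (Sum.inr 0) (Sum.inr 1) ::
        Piece.pos (Sum.inr 1) (Sum.inl x₃) (Sum.inr 2) (Sum.inl y₃) ::
        Piece.pos (Sum.inr 0) (Sum.inr 2) (Sum.inl y₁) (Sum.inl y₂) ::
        L.map (Piece.map (Sum.inl : M → M ⊕ Fin 3))) =
    stateSum [] (Piece.pos (Sum.inl x₂) (Sum.inl x₃) (Sum.inr 0) (Sum.inr 1) ::
        Piece.pos (Sum.inl x₁) (Sum.inr 0) (Sum.inl y₁) (Sum.inr 2) ::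
        Piece.pos (Sum.inr 2) (Sum.inr 1) (Sum.inl y₂) (Sum.inl y₃) ::
        L.map (Piece.map (Sum.inl : M → M ⊕ Fin 3))) := by
  have key := stateSum_relation (M := M)
    [⟨M ⊕ Fin 3, Sum.inl, [Piece.pos (Sum.inl x₁) (Sum.inl x₂) (Sum.inr 0) (Sum.inr 1),
        Piece.pos (Sum.inr 1) (Sum.inl x₃) (Sum.inr 2) (Sum.inl y₃),
        Piece.pos (Sum.inr 0) (Sum.inr 2) (Sum.inl y₁) (Sum.inl y₂)], 1⟩,
      ⟨M ⊕ Fin 3, Sum.inl, [Piece.pos (Sum.inl x₂) (Sum.inl x₃) (Sum.inr 0) (Sum.inr 1),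
        Piece.pos (Sum.inl x₁) (Sum.inr 0) (Sum.inl y₁) (Sum.inr 2),
        Piece.pos (Sum.inr 2) (Sum.inr 1) (Sum.inl y₂) (Sum.inl y₃)], -1⟩] (fun G => by
    have h1 := (stateSum_optionThree [_, _, _] G).trans
      (stateSum_three_pos x₁ x₂ x₃ y₁ y₂ y₃ G)
    -- Reflection exchanges the roles of the inner marks 0 and 1, hence the second numbering.
    have h2 := (stateSum_optionThree' [_, _, _] G).trans
      (stateSum_three_pos x₃ x₂ x₁ y₃ y₂ y₁ G)
    simp only [List.map_cons, List.map_nil, Piece.map, optionThree, optionThree',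
      Equiv.coe_fn_mk] at h1 h2
    rw [braidSum_reverse, stateSum_pos_swap, stateSum_swap, stateSum_pos_swap, stateSum_rotate,
      stateSum_pos_swap, ← stateSum_rotate] at h2
    simp only [List.map_cons, List.map_nil, List.sum_cons, List.sum_nil]
    rw [stateSum_swap, h1, h2]
    ring) L []
  simp only [List.map_cons, List.map_nil, List.sum_cons, List.sum_nil, List.cons_append,
    List.nil_append] at key
  linear_combination key

/-- Both $b_1b_2b_1 - q^2b_1$ and its reflection $b_2b_1b_2 - q^2b_2$ are the symmetric Koszul
complex. -/
theorem stateSum_moyIII (x₁ x₂ x₃ y₁ y₂ y₃ : M) (L : List (Piece M)) :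
    stateSum [] (Piece.wide (Sum.inl x₁) (Sum.inl x₂) (Sum.inr 0) (Sum.inr 1) ::
        Piece.wide (Sum.inr 1) (Sum.inl x₃) (Sum.inr 2) (Sum.inl y₃) ::
        Piece.wide (Sum.inr 0) (Sum.inr 2) (Sum.inl y₁) (Sum.inl y₂) ::
        L.map (Piece.map (Sum.inl : M → M ⊕ Fin 3))) +
      Cx.mono 2 0 0 * stateSum [] (Piece.arc x₁ y₁ :: Piece.wide x₂ x₃ y₂ y₃ :: L) =
    Cx.mono 2 0 0 * stateSum [] (Piece.wide x₁ x₂ y₁ y₂ :: Piece.arc x₃ y₃ :: L) +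
    stateSum [] (Piece.wide (Sum.inl x₂) (Sum.inl x₃) (Sum.inr 0) (Sum.inr 1) ::
        Piece.wide (Sum.inl x₁) (Sum.inr 0) (Sum.inl y₁) (Sum.inr 2) ::
        Piece.wide (Sum.inr 2) (Sum.inr 1) (Sum.inl y₂) (Sum.inl y₃) ::
        L.map (Piece.map (Sum.inl : M → M ⊕ Fin 3))) := by
  have hid : L.map (Piece.map id) = L := by
    conv_rhs => rw [← List.map_id L]
    exact List.map_congr_left fun p _ => by cases p <;> rfl
  have key := stateSum_relation (M := M)
    [⟨M ⊕ Fin 3, Sum.inl, [Piece.wide (Sum.inl x₁) (Sum.inl x₂) (Sum.inr 0) (Sum.inr 1),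
        Piece.wide (Sum.inr 1) (Sum.inl x₃) (Sum.inr 2) (Sum.inl y₃),
        Piece.wide (Sum.inr 0) (Sum.inr 2) (Sum.inl y₁) (Sum.inl y₂)], 1⟩,
      ⟨M, id, [Piece.arc x₁ y₁, Piece.wide x₂ x₃ y₂ y₃], Cx.mono 2 0 0⟩,
      ⟨M, id, [Piece.wide x₁ x₂ y₁ y₂, Piece.arc x₃ y₃], -Cx.mono 2 0 0⟩,
      ⟨M ⊕ Fin 3, Sum.inl, [Piece.wide (Sum.inl x₂) (Sum.inl x₃) (Sum.inr 0) (Sum.inr 1),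
        Piece.wide (Sum.inl x₁) (Sum.inr 0) (Sum.inl y₁) (Sum.inr 2),
        Piece.wide (Sum.inr 2) (Sum.inr 1) (Sum.inl y₂) (Sum.inl y₃)], -1⟩] (fun G => by
    have h1 := (stateSum_optionThree [_, _, _] G).trans
      (stateSum_three_wides x₁ x₂ x₃ y₁ y₂ y₃ G)
    have h2 := (stateSum_optionThree' [_, _, _] G).trans
      (stateSum_three_wides x₃ x₂ x₁ y₃ y₂ y₁ G)
    simp only [List.map_cons, List.map_nil, Piece.map, optionThree, optionThree',
      Equiv.coe_fn_mk] at h1 h2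
    rw [stateSum_perm (perm_reverse_three _ _ _ _)] at h1
    rw [symE_reverse, stateSum_wide_swap x₃, stateSum_wide_swap (Sum.inr 1), stateSum_swap,
      stateSum_wide_swap (Sum.inr 0), stateSum_rotate, stateSum_wide_swap (Sum.inl x₃)] at h2
    simp only [List.map_cons, List.map_nil, List.sum_cons, List.sum_nil, map_ren_id]
    rw [h1, h2, stateSum_swap (.arc x₁ y₁)]
    ring) L []
  simp only [List.map_cons, List.map_nil, List.sum_cons, List.sum_nil, List.cons_append,
    List.nil_append, hid] at key
  linear_combination key

theorem stateSum_moyI (x y : M) (L : List (Piece M)) :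
    (1 - Cx.mono 2 0 0) * stateSum [] (Piece.wide (some x) none (some y) none ::
      L.map (Piece.map (some : M → Option M))) =
    (1 + Cx.mono 4 1 0) * stateSum [] (Piece.arc x y :: L) := by
  have hid : L.map (Piece.map id) = L := by
    conv_rhs => rw [← List.map_id L]
    exact List.map_congr_left fun p _ => by cases p <;> rfl
  have key := stateSum_relation (M := M)
    [⟨Option M, some, [Piece.wide (some x) none (some y) none], 1 - Cx.mono 2 0 0⟩,
      ⟨M, id, [Piece.arc x y], -(1 + Cx.mono 4 1 0)⟩] (fun G => by
    have h := kser_curl x y G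
    simp only [List.map_cons, List.map_nil, List.sum_cons, List.sum_nil, map_ren_id,
      stateSum_wide_cons, stateSum_arc_cons]
    simp only [stateSum]
    linear_combination h) L []
  simp only [List.map_cons, List.map_nil, List.sum_cons, List.sum_nil, List.cons_append,
    List.nil_append, hid] at key
  linear_combination key

theorem stateSum_moyIIb (x u y v : M) (L : List (Piece M)) :
    (1 - Cx.mono 2 0 0) * stateSum [] (Piece.wide (Sum.inl x) (Sum.inr 0) (Sum.inl y) (Sum.inr 1) ::
        Piece.wide (Sum.inl u) (Sum.inr 1) (Sum.inl v) (Sum.inr 0) ::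
        L.map (Piece.map (Sum.inl : M → M ⊕ Fin 2))) =
      (1 - Cx.mono 2 0 0) * stateSum [] (virt (Sum.inl x) (Sum.inr 0) (Sum.inl y) (Sum.inr 1) ++
        Piece.wide (Sum.inl u) (Sum.inr 1) (Sum.inl v) (Sum.inr 0) ::
        L.map (Piece.map (Sum.inl : M → M ⊕ Fin 2))) +
      (Cx.mono 2 0 0 + Cx.mono 6 1 0) * stateSum [] (Piece.arc x y :: Piece.arc u v :: L) := by
  have hid : L.map (Piece.map id) = L := by
    conv_rhs => rw [← List.map_id L]
    exact List.map_congr_left fun p _ => by cases p <;> rfl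
  -- The pieces are listed in reverse, since expanding a piece puts its rows in front of those
  -- already present.
  have key := stateSum_relation (M := M)
    [⟨M ⊕ Fin 2, Sum.inl, [Piece.wide (Sum.inl u) (Sum.inr 1) (Sum.inl v) (Sum.inr 0),
        Piece.wide (Sum.inl x) (Sum.inr 0) (Sum.inl y) (Sum.inr 1)], 1 - Cx.mono 2 0 0⟩,
      ⟨M ⊕ Fin 2, Sum.inl, [Piece.wide (Sum.inl u) (Sum.inr 1) (Sum.inl v) (Sum.inr 0),
        Piece.arc (Sum.inl x) (Sum.inr 1), Piece.arc (Sum.inr 0) (Sum.inl y)],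
        -(1 - Cx.mono 2 0 0)⟩,
      ⟨M, id, [Piece.arc u v, Piece.arc x y], -(Cx.mono 2 0 0 + Cx.mono 6 1 0)⟩] (fun G => by
    have h1 := stateSum_optionTwo [.wide (some (some u)) none (some (some v)) (some none),
      .wide (some (some x)) (some none) (some (some y)) none] G
    have h2 := stateSum_optionTwo [.wide (some (some u)) none (some (some v)) (some none),
      .arc (some (some x)) none, .arc (some none) (some (some y))] G
    have h := kser_antiparallel x u y v G
    rw [← kser_virtual x u y v G] at h
    simp only [List.map_cons, List.map_nil, Piece.map, optionTwo, Equiv.coe_fn_mk] at h1 h2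
    simp only [List.map_cons, List.map_nil, List.sum_cons, List.sum_nil, map_ren_id]
    rw [h1, h2]
    simp only [stateSum_wide_cons, stateSum_arc_cons]
    simp only [stateSum]
    linear_combination h) L []
  simp only [List.map_cons, List.map_nil, List.sum_cons, List.sum_nil, List.cons_append,
    List.nil_append, hid] at key
  have h : stateSum [] (virt (Sum.inl x) (Sum.inr 0) (Sum.inl y) (Sum.inr 1) ++
      Piece.wide (Sum.inl u) (Sum.inr 1) (Sum.inl v) (Sum.inr 0) ::
      L.map (Piece.map (Sum.inl : M → M ⊕ Fin 2))) = _ :=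
    stateSum_perm (perm_reverse_three _ _ _ _) _
  rw [h, stateSum_swap (.wide (Sum.inl x) _ _ _), stateSum_swap (.arc x y)]
  linear_combination key

/-- The row of a closed arc is zero of degree 2, whence `1 + a q²`, and its mark occurs nowhere
else, whence `1 - q²`. -/
theorem stateSum_circle (L : List (Piece M)) :
    (1 - Cx.mono 2 0 0) * stateSum [] (Piece.arc none none ::
      L.map (Piece.map (some : M → Option M))) = (1 + Cx.mono 2 1 0) * stateSum [] L := by
  have hid : L.map (Piece.map id) = L := by
    conv_rhs => rw [← List.map_id L]
    exact List.map_congr_left fun p _ => by cases p <;> rfl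
  have key := stateSum_relation (M := M)
    [⟨Option M, some, [Piece.arc none none], 1 - Cx.mono 2 0 0⟩,
      ⟨M, id, [], -(1 + Cx.mono 2 1 0)⟩] (fun G => by
    have h := kser_free G
    have h' := kser_zero (arcE none none) (by simp [arcE]) (up G)
    simp only [List.map_cons, List.map_nil, List.sum_cons, List.sum_nil, map_ren_id,
      stateSum_arc_cons]
    simp only [stateSum]
    rw [h', show (arcE (none : Option M) none).deg = 2 from rfl]
    linear_combination (1 + Cx.mono 2 1 0) * h) L []
  simp only [List.map_cons, List.map_nil, List.sum_cons, List.sum_nil, List.cons_append,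
    List.nil_append, hid] at key
  linear_combination key

end Marks

/-! ## The complex `(C(D), d_g)` -/

section Link

variable {M : Type}

theorem FreeBicomplex.dgMap_apply (B : FreeBicomplex M) (v : B.Chains) (g : B.G) :
    B.dgMap v g = ∑ h, B.dg g h * v h := rfl

theorem FreeBicomplex.dcMap_apply (B : FreeBicomplex M) (v : B.Chains) (g : B.G) :
    B.dcMap v g = ∑ h, B.dc g h * v h := rfl

theorem FreeBicomplex.dgMap_dgMap (B : FreeBicomplex M) (v : B.Chains) :
    B.dgMap (B.dgMap v) = 0 := by
  change B.dg *ᵥ (B.dg *ᵥ v) = 0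
  rw [Matrix.mulVec_mulVec, B.dg_sq, Matrix.zero_mulVec]

theorem FreeBicomplex.dgMap_mem (B : FreeBicomplex M) {i j k : ℤ} {v : B.Chains}
    (hv : v ∈ B.chainsPart i (j + 1) k) : B.dgMap v ∈ B.chainsPart i j k := by
  refine fun g => ⟨?_, fun hne => ?_⟩
  · rw [dgMap_apply]
    refine Submodule.sum_mem (mvGr M _) fun h _ => ?_
    have := mul_mem_mvGr (B.dg_qdeg g h) (hv h).1
    rwa [sub_add_sub_cancel'] at this
  · rw [dgMap_apply] at hne
    obtain ⟨h, -, hh⟩ := Finset.exists_ne_zero_of_sum_ne_zero hne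
    have h1 := B.dg_deg g h (left_ne_zero_of_mul hh)
    have h2 := (hv h).2 (right_ne_zero_of_mul hh)
    omega

theorem FreeBicomplex.dcMap_mem (B : FreeBicomplex M) {i j k : ℤ} {v : B.Chains}
    (hv : v ∈ B.chainsPart i j k) : B.dcMap v ∈ B.chainsPart i j (k + 1) := by
  refine fun g => ⟨?_, fun hne => ?_⟩
  · rw [dcMap_apply]
    refine Submodule.sum_mem (mvGr M _) fun h _ => ?_
    have := mul_mem_mvGr (B.dc_qdeg g h) (hv h).1
    rwa [sub_add_sub_cancel'] at this
  · rw [dcMap_apply] at hne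
    obtain ⟨h, -, hh⟩ := Finset.exists_ne_zero_of_sum_ne_zero hne
    have h1 := B.dc_deg g h (left_ne_zero_of_mul hh)
    have h2 := (hv h).2 (right_ne_zero_of_mul hh)
    omega

variable [Finite M]

instance FreeBicomplex.finite_chainsPart (B : FreeBicomplex M) (i j k : ℤ) :
    FiniteDimensional ℚ (B.chainsPart i j k) := by
  have (g : B.G) : FiniteDimensional ℚ (mvGr M (i - B.qdeg g)) := GradedAlg.finite _
  refine Module.Finite.of_injective
    (LinearMap.pi fun g => ((LinearMap.proj g).comp (B.chainsPart i j k).subtype).codRestrict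
      (mvGr M (i - B.qdeg g)) (fun v => (v.2 g).1) :
        B.chainsPart i j k →ₗ[ℚ] ∀ g, mvGr M (i - B.qdeg g)) fun v w h => ?_
  refine Subtype.ext (funext fun g => ?_)
  exact congrArg Subtype.val (congrFun h g)

/-- The complex of free modules with differential `d_g`. -/
noncomputable def FreeBicomplex.toCx (B : FreeBicomplex M) : Cx (mvGr M) where
  V := B.Chains
  part := B.chainsPart
  d := B.dgMap
  d_sq := B.dgMap_dgMap
  d_mem := B.dgMap_mem
  smul_mem {e i j k r v} hr hv g := by
    refine ⟨?_, fun hne => (hv g).2 (right_ne_zero_of_mul hne)⟩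
    rw [add_sub_assoc]
    exact mul_mem_mvGr hr (hv g).1
  finite := B.finite_chainsPart
  bounded := by
    refine ⟨∑ g, (|B.qdeg g| + |B.adeg g| + |B.tdeg g|), fun i j k h => ?_⟩
    obtain ⟨v, hv, hne⟩ := Submodule.exists_mem_ne_zero_of_ne_bot h
    obtain ⟨g, hg⟩ := Function.ne_iff.mp hne
    have h1 : |B.qdeg g| + |B.adeg g| + |B.tdeg g| ≤
        ∑ g, (|B.qdeg g| + |B.adeg g| + |B.tdeg g|) :=
      Finset.single_le_sum (f := fun g => |B.qdeg g| + |B.adeg g| + |B.tdeg g|)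
        (fun g _ => by positivity) (Finset.mem_univ g)
    have h2 : 0 ≤ i - B.qdeg g := by
      by_contra hc
      have := (hv g).1
      have h0 : v g ∈ mvGr M (i - B.qdeg g) := this
      rw [GradedAlg.eq_bot (gr := mvGr M) _ (by omega)] at h0
      exact hg h0
    obtain ⟨rfl, rfl⟩ := (hv g).2 hg
    have := neg_abs_le (B.qdeg g)
    have := abs_nonneg (B.qdeg g)
    have := abs_nonneg (B.adeg g)
    have := abs_nonneg (B.tdeg g)
    omega

theorem Cx.mem_part_congr {A : Type} [CommRing A] [Algebra ℚ A] {gr : ℤ → Submodule ℚ A}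
    (C : Cx gr) {v : C.V} {i j k i' j' k' : ℤ} (h : v ∈ C.part i j k) (hi : i = i') (hj : j = j')
    (hk : k = k') : v ∈ C.part i' j' k' := by rwa [hi, hj, hk] at h

-- Chains of a tensor product are tuples of chains of the second factor, indexed by the basis of the
-- first; in these terms the differential becomes that of an iterated cone.
omit [Finite M] in
theorem tensorD_mulVec {G H : Type} [Fintype G] [Fintype H] [DecidableEq G] [DecidableEq H]
    (f : G → ℤ) (A : Matrix G G (TotalRing M)) (B : Matrix H H (TotalRing M))
    (v : G × H → TotalRing M) (x : G) :
    (fun g => (FreeBicomplex.tensorD f A B *ᵥ v) (x, g)) = ∑ y, A x y • (fun g => v (y, g)) +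
      (((Int.negOnePow (f x) : ℤˣ) : ℤ) : TotalRing M) • (B *ᵥ fun g => v (x, g)) := by
  funext g
  rw [Pi.add_apply, Finset.sum_apply, Pi.smul_apply, smul_eq_mul]
  change ∑ z : G × H, FreeBicomplex.tensorD f A B (x, g) z * v z = _ + _ * ∑ h, _ * _
  rw [Fintype.sum_prod_type]
  simp only [FreeBicomplex.tensorD, Matrix.add_apply, Matrix.kronecker_apply, add_mul,
    Finset.sum_add_distrib]
  congr 1
  · refine Finset.sum_congr rfl fun y _ => ?_
    rw [Finset.sum_eq_single g (fun h _ hne => by rw [Matrix.one_apply_ne hne.symm]; ring)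
      (fun h => absurd (Finset.mem_univ _) h), Matrix.one_apply_eq, mul_one]
    rfl
  · rw [Finset.sum_eq_single x (fun y _ hne => Finset.sum_eq_zero fun h _ => by
      rw [FreeBicomplex.signs, Matrix.diagonal_apply_ne _ hne.symm]; ring)
      (fun h => absurd (Finset.mem_univ _) h), Finset.mul_sum]
    refine Finset.sum_congr rfl fun h _ => ?_
    rw [FreeBicomplex.signs, Matrix.diagonal_apply_eq, mul_assoc]

theorem mem_tensor_part {A B : FreeBicomplex M} {v : A.G × B.G → TotalRing M}
    {i j k : ℤ} : v ∈ (A.tensor B).toCx.part i j k ↔ ∀ x, (fun g => v (x, g)) ∈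
      B.toCx.part (i - A.qdeg x) (j - A.adeg x) (k - A.tdeg x) := by
  constructor
  · intro h x g
    obtain ⟨h1, h2⟩ := h (x, g)
    refine ⟨?_, fun hne => ?_⟩
    · rw [sub_sub]; exact h1
    · obtain ⟨h3, h4⟩ := h2 hne
      change A.adeg x + B.adeg g = j at h3
      change A.tdeg x + B.tdeg g = k at h4
      omega
  · rintro h ⟨x, g⟩
    obtain ⟨h1, h2⟩ := h x g
    refine ⟨?_, fun hne => ?_⟩
    · rw [sub_sub] at h1; exact h1
    · obtain ⟨h3, h4⟩ := h2 hne
      change A.adeg x + B.adeg g = j ∧ A.tdeg x + B.tdeg g = k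
      omega

theorem isQ_unit : Cx.IsQ (C := (FreeBicomplex.unit M).toCx) (C' := Cx.base (mvGr M))
    (LinearMap.proj ()) := by
  refine Cx.IsQ.of_injective ?_ ?_ ?_ ?_
  · intro v
    change ∑ h : Unit, (0 : TotalRing M) * v h = 0
    simp
  · intro i j k v hv
    have h := hv ()
    refine (Cx.mem_base (gr := mvGr M)).mpr ⟨?_, fun hne => ?_⟩
    · have := h.1
      rwa [show (FreeBicomplex.unit M).qdeg () = 0 from rfl, sub_zero] at this
    · have := h.2 hne
      exact ⟨this.1.symm, this.2.symm⟩
  · intro i j k v hv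
    obtain ⟨h1, h2⟩ := (Cx.mem_base (gr := mvGr M)).mp hv
    refine ⟨fun _ => v, fun g => ⟨?_, fun hne => ?_⟩, rfl⟩
    · rw [show (FreeBicomplex.unit M).qdeg g = 0 from rfl, sub_zero]
      exact h1
    · have := h2 hne
      exact ⟨this.1.symm, this.2.symm⟩
  · intro v hv
    funext x
    exact hv

/-- Tensoring with the two-term complex of an arc is taking the cone of `y - x`; the sign of the
tensor differential on the Hochschild degree 1 summand is the sign in the cone. -/
theorem isQ_arc (x y : M) (B : FreeBicomplex M) :
    Cx.IsQ (C := ((arcC x y).tensor B).toCx) (C' := Cx.cone (arcE x y) B.toCx)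
      ((LinearMap.funLeft _ _ fun g => ((0 : Fin 2), g)).prod
        (LinearMap.funLeft _ _ fun g => ((1 : Fin 2), g))) := by
  refine Cx.IsQ.of_injective ?_ ?_ ?_ ?_
  · intro (v : Fin 2 × B.G → TotalRing M)
    have h := tensorD_mulVec (![0, 1] : Fin 2 → ℤ) (arcD x y) B.dg v
    refine Prod.ext ((h 0).trans ?_) ((h 1).trans ?_)
    · change _ = B.dg *ᵥ (fun g => v (0, g)) + (arcE x y).val • (fun g => v (1, g))
      simp [Fin.sum_univ_two, arcD, arcE, add_comm]
    · change _ = -(B.dg *ᵥ (fun g => v (1, g)))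
      simp [Fin.sum_univ_two, arcD]
  · intro i j k v hv
    have h := mem_tensor_part.mp hv
    exact ⟨Cx.mem_part_congr _ (h (0 : Fin 2)) (sub_zero _) (sub_zero _) (sub_zero _),
      Cx.mem_part_congr _ (h (1 : Fin 2)) rfl rfl (sub_zero _)⟩
  · rintro i j k ⟨v, w⟩ ⟨hv, hw⟩
    refine ⟨fun z : Fin 2 × B.G => (![v, w] : Fin 2 → B.G → TotalRing M) z.1 z.2,
      mem_tensor_part.mpr fun (z : Fin 2) => ?_, rfl⟩
    fin_cases z
    · exact Cx.mem_part_congr _ hv (sub_zero _).symm (sub_zero _).symm (sub_zero _).symm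
    · exact Cx.mem_part_congr _ hw rfl rfl (sub_zero _).symm
  · intro (v : Fin 2 × B.G → TotalRing M) hv
    funext (z : Fin 2 × B.G)
    obtain ⟨z, g⟩ := z
    fin_cases z
    · exact congrFun (congrArg Prod.fst hv) g
    · exact congrFun (congrArg Prod.snd hv) g

/-! ### Koszul complexes with two rows as double cones. -/

section Four

variable (B : FreeBicomplex M) (f₁ f₂ : HElt (mvGr M))

/-- The chains of a Koszul complex with two rows, as a double cone. -/
noncomputable def fourMap : (Fin 4 × B.G → TotalRing M) →ₗ[TotalRing M]
    (B.Chains × B.Chains) × (B.Chains × B.Chains) :=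
  ((LinearMap.funLeft _ _ fun g => ((0 : Fin 4), g)).prod
    (LinearMap.funLeft _ _ fun g => ((1 : Fin 4), g))).prod
  ((LinearMap.funLeft _ _ fun g => ((2 : Fin 4), g)).prod
    (LinearMap.funLeft _ _ fun g => ((3 : Fin 4), g)))

/-- The entry `-f₁` in the last column comes from the outer cone, which negates the differential of
the inner one. The given matrices have this shape, so `f₁` is the row of the inner cone. -/
theorem fourMap_comm (D : Matrix (Fin 4) (Fin 4) (TotalRing M))
    (hD : D = !![0, f₁.val, f₂.val, 0; 0, 0, 0, f₂.val; 0, 0, 0, -f₁.val; 0, 0, 0, 0])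
    (v : Fin 4 × B.G → TotalRing M) :
    fourMap B (FreeBicomplex.tensorD koszulA D B.dg *ᵥ v) =
      (Cx.cone f₂ (Cx.cone f₁ B.toCx)).d (fourMap B v) := by
  have h := tensorD_mulVec koszulA D B.dg v
  refine Prod.ext (Prod.ext ((h 0).trans ?_) ((h 1).trans ?_))
    (Prod.ext ((h 2).trans ?_) ((h 3).trans ?_))
  · change _ = B.dg *ᵥ (fun g => v (0, g)) + f₁.val • (fun g => v (1, g)) +
      f₂.val • (fun g => v (2, g))
    simp [Fin.sum_univ_four, hD, koszulA]
    abel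
  · change _ = -(B.dg *ᵥ (fun g => v (1, g))) + f₂.val • (fun g => v (3, g))
    simp [Fin.sum_univ_four, hD, koszulA]
    abel
  · change _ = -(B.dg *ᵥ (fun g => v (2, g)) + f₁.val • (fun g => v (3, g)))
    simp [Fin.sum_univ_four, hD, koszulA]
  · change _ = -(-(B.dg *ᵥ (fun g => v (3, g))))
    simp [Fin.sum_univ_four, hD, koszulA, Int.negOnePow_even 2 (by decide)]

theorem fourMap_mem (Q : Fin 4 → ℤ) (hQ : Q = ![0, f₁.deg, f₂.deg, f₁.deg + f₂.deg])
    (v : Fin 4 × B.G → TotalRing M) (i j k : ℤ) :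
    fourMap B v ∈ (Cx.cone f₂ (Cx.cone f₁ B.toCx)).part i j k ↔
      ∀ x, (fun g => v (x, g)) ∈ B.toCx.part (i - Q x) (j - koszulA x) k := by
  subst hQ
  constructor
  · rintro ⟨⟨h0, h1⟩, h2, h3⟩ x
    fin_cases x
    · exact Cx.mem_part_congr _ h0 (sub_zero _).symm (sub_zero _).symm rfl
    · exact Cx.mem_part_congr _ h1 rfl rfl rfl
    · exact Cx.mem_part_congr _ h2 rfl rfl rfl
    · exact Cx.mem_part_congr _ h3 (by simp; ring) (by simp [koszulA]; ring) rfl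
  · intro h
    refine ⟨⟨?_, ?_⟩, ?_, ?_⟩
    · exact Cx.mem_part_congr _ (h 0) (sub_zero _) (sub_zero _) rfl
    · exact Cx.mem_part_congr _ (h 1) rfl rfl rfl
    · exact Cx.mem_part_congr _ (h 2) rfl rfl rfl
    · exact Cx.mem_part_congr _ (h 3) (by simp; ring) (by simp [koszulA]; ring) rfl

omit [Finite M] in
theorem fourMap_surj (w : (B.Chains × B.Chains) × (B.Chains × B.Chains)) :
    ∃ v, fourMap B v = w :=
  ⟨fun z => (![w.1.1, w.1.2, w.2.1, w.2.2] : Fin 4 → B.Chains) z.1 z.2, rfl⟩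

omit [Finite M] in
theorem fourMap_inj (v : Fin 4 × B.G → TotalRing M) (hv : fourMap B v = 0) : v = 0 := by
  funext ⟨z, g⟩
  fin_cases z
  · exact congrFun (congrArg (fun w => w.1.1) hv) g
  · exact congrFun (congrArg (fun w => w.1.2) hv) g
  · exact congrFun (congrArg (fun w => w.2.1) hv) g
  · exact congrFun (congrArg (fun w => w.2.2) hv) g

end Four

theorem isQ_wide (x₁ x₂ y₁ y₂ : M) (B : FreeBicomplex M) :
    Cx.IsQ (C := ((wideC x₁ x₂ y₁ y₂).tensor B).toCx)
      (C' := Cx.cone (quadE x₁ x₂ y₁) (Cx.cone (sumE x₁ x₂ y₁ y₂) B.toCx)) (fourMap B) := by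
  have hm (v : Fin 4 × B.G → TotalRing M) (i j k : ℤ) :
      v ∈ ((wideC x₁ x₂ y₁ y₂).tensor B).toCx.part i j k ↔ fourMap B v ∈
        (Cx.cone (quadE x₁ x₂ y₁) (Cx.cone (sumE x₁ x₂ y₁ y₂) B.toCx)).part i j k := by
    rw [fourMap_mem B _ _ wideQ rfl]
    refine mem_tensor_part.trans (forall_congr' fun x => ?_)
    rw [show (wideC x₁ x₂ y₁ y₂).tdeg x = 0 from rfl, sub_zero]
    rfl
  refine Cx.IsQ.of_injective (fun v => ?_) (fun {i j k v} => (hm v i j k).mp) ?_ (fourMap_inj B)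
  · refine fourMap_comm B _ _ (wideD x₁ x₂ y₁ y₂) ?_ v
    ext1 a b
    fin_cases a <;> fin_cases b <;> simp [wideD, sumE, quadE]
    ring
  · intro i j k w hw
    obtain ⟨v, rfl⟩ := fourMap_surj B w
    exact ⟨v, (hm v i j k).mpr hw, rfl⟩

omit [Finite M] in
theorem tensorD_fromBlocks_inl {G G' H : Type} [Fintype G] [Fintype G'] [Fintype H]
    [DecidableEq G] [DecidableEq G'] [DecidableEq H] (f : G → ℤ) (f' : G' → ℤ)
    (A : Matrix G G (TotalRing M)) (A' : Matrix G' G' (TotalRing M)) (B : Matrix H H (TotalRing M))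
    (v : (G ⊕ G') × H → TotalRing M) :
    (fun z : G × H => (FreeBicomplex.tensorD (Sum.elim f f') (Matrix.fromBlocks A 0 0 A') B *ᵥ v)
      (Sum.inl z.1, z.2)) = FreeBicomplex.tensorD f A B *ᵥ fun z => v (Sum.inl z.1, z.2) := by
  funext ⟨x, g⟩
  refine (congrFun (tensorD_mulVec _ _ B v (Sum.inl x)) g).trans
    (Eq.trans ?_ (congrFun (tensorD_mulVec f A B _ x) g).symm)
  simp [Fintype.sum_sum_type]

omit [Finite M] in
theorem tensorD_fromBlocks_inr {G G' H : Type} [Fintype G] [Fintype G'] [Fintype H]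
    [DecidableEq G] [DecidableEq G'] [DecidableEq H] (f : G → ℤ) (f' : G' → ℤ)
    (A : Matrix G G (TotalRing M)) (A' : Matrix G' G' (TotalRing M)) (B : Matrix H H (TotalRing M))
    (v : (G ⊕ G') × H → TotalRing M) :
    (fun z : G' × H => (FreeBicomplex.tensorD (Sum.elim f f') (Matrix.fromBlocks A 0 0 A') B *ᵥ v)
      (Sum.inr z.1, z.2)) = FreeBicomplex.tensorD f' A' B *ᵥ fun z => v (Sum.inr z.1, z.2) := by
  funext ⟨x, g⟩
  refine (congrFun (tensorD_mulVec _ _ B v (Sum.inr x)) g).trans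
    (Eq.trans ?_ (congrFun (tensorD_mulVec f' A' B _ x) g).symm)
  simp [Fintype.sum_sum_type]

-- In the given basis the inner row is `x₂ - y₂`, the element of the second arc with its ends
-- exchanged.
omit [Finite M] in
theorem arcsD_eq (x₁ x₂ y₁ y₂ : M) : arcsD x₁ x₂ y₁ y₂ =
    !![0, (arcE y₂ x₂).val, (arcE x₁ y₁).val, 0; 0, 0, 0, (arcE x₁ y₁).val;
      0, 0, 0, -(arcE y₂ x₂).val; 0, 0, 0, 0] := by
  ext1 a b
  fin_cases a <;> fin_cases b <;> simp [arcsD, arcE]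

omit [Finite M] in
theorem wideD_eq (x₁ x₂ y₁ y₂ : M) : wideD x₁ x₂ y₁ y₂ =
    !![0, (sumE x₁ x₂ y₁ y₂).val, (quadE x₁ x₂ y₁).val, 0; 0, 0, 0, (quadE x₁ x₂ y₁).val;
      0, 0, 0, -(sumE x₁ x₂ y₁ y₂).val; 0, 0, 0, 0] := by
  ext1 a b
  fin_cases a <;> fin_cases b <;> simp [wideD, sumE, quadE]
  ring

/-- The chains of a direct sum of two Koszul complexes with two rows. -/
noncomputable def crossingMap (B : FreeBicomplex M) :
    ((Fin 4 ⊕ Fin 4) × B.G → TotalRing M) →ₗ[TotalRing M]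
    ((B.Chains × B.Chains) × (B.Chains × B.Chains)) ×
      ((B.Chains × B.Chains) × (B.Chains × B.Chains)) :=
  ((fourMap B).comp (LinearMap.funLeft _ _ fun z => (Sum.inl z.1, z.2))).prod
    ((fourMap B).comp (LinearMap.funLeft _ _ fun z => (Sum.inr z.1, z.2)))

omit [Finite M] in
theorem crossingMap_surj (B : FreeBicomplex M)
    (w : ((B.Chains × B.Chains) × (B.Chains × B.Chains)) ×
      ((B.Chains × B.Chains) × (B.Chains × B.Chains))) : ∃ v, crossingMap B v = w := by
  obtain ⟨v, hv⟩ := fourMap_surj B w.1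
  obtain ⟨v', hv'⟩ := fourMap_surj B w.2
  exact ⟨fun z => z.1.elim (fun x => v (x, z.2)) fun x => v' (x, z.2), Prod.ext hv hv'⟩

omit [Finite M] in
theorem crossingMap_inj (B : FreeBicomplex M) (v : (Fin 4 ⊕ Fin 4) × B.G → TotalRing M)
    (hv : crossingMap B v = 0) : v = 0 := by
  have h1 := fourMap_inj B _ (congrArg Prod.fst hv)
  have h2 := fourMap_inj B _ (congrArg Prod.snd hv)
  funext ⟨z, g⟩
  rcases z with z | z
  · exact congrFun h1 (z, g)
  · exact congrFun h2 (z, g)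

/-- Only `d_g` is kept, and its matrix is block diagonal: the map `χᵢ` is lost and the crossing is a
direct sum. -/
theorem isQ_pos (x₁ x₂ y₁ y₂ : M) (B : FreeBicomplex M) :
    Cx.IsQ (C := ((posC x₁ x₂ y₁ y₂).tensor B).toCx)
      (C' := (Cx.cone (arcE x₁ y₁) (Cx.cone (arcE y₂ x₂) B.toCx)).prod
        (Cx.shift (-2) 0 1 (Cx.cone (quadE x₁ x₂ y₁) (Cx.cone (sumE x₁ x₂ y₁ y₂) B.toCx))))
      (crossingMap B) := by
  have hm (v : (Fin 4 ⊕ Fin 4) × B.G → TotalRing M) (i j k : ℤ) :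
      v ∈ ((posC x₁ x₂ y₁ y₂).tensor B).toCx.part i j k ↔ crossingMap B v ∈
        ((Cx.cone (arcE x₁ y₁) (Cx.cone (arcE y₂ x₂) B.toCx)).prod
        (Cx.shift (-2) 0 1 (Cx.cone (quadE x₁ x₂ y₁)
          (Cx.cone (sumE x₁ x₂ y₁ y₂) B.toCx)))).part i j k := by
    refine mem_tensor_part.trans (Sum.forall.trans (and_congr ?_ ?_))
    · refine Iff.trans ?_ (fourMap_mem B (arcE y₂ x₂) (arcE x₁ y₁) arcsQ rfl _ i j k).symm
      refine forall_congr' fun x => ?_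
      rw [show (posC x₁ x₂ y₁ y₂).tdeg (Sum.inl x) = 0 from rfl, sub_zero]
      rfl
    · refine Iff.trans ?_ (fourMap_mem B (sumE x₁ x₂ y₁ y₂) (quadE x₁ x₂ y₁) wideQ rfl _
        (i - -2) (j - 0) (k - 1)).symm
      refine forall_congr' fun x => ?_
      rw [show (posC x₁ x₂ y₁ y₂).tdeg (Sum.inr x) = 1 from rfl,
        show (posC x₁ x₂ y₁ y₂).qdeg (Sum.inr x) = wideQ x - 2 from rfl,
        show i - (wideQ x - 2) = i - -2 - wideQ x by ring, sub_zero]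
      rfl
  refine Cx.IsQ.of_injective (fun v => ?_) (fun {i j k v} => (hm v i j k).mp) ?_
    (crossingMap_inj B)
  · refine Prod.ext ?_ ?_
    · exact (congrArg (fourMap B) (tensorD_fromBlocks_inl _ _ _ _ _ v)).trans
        (fourMap_comm B _ _ _ (arcsD_eq x₁ x₂ y₁ y₂) _)
    · exact (congrArg (fourMap B) (tensorD_fromBlocks_inr _ _ _ _ _ v)).trans
        (fourMap_comm B _ _ _ (wideD_eq x₁ x₂ y₁ y₂) _)
  · intro i j k w hw
    obtain ⟨v, rfl⟩ := crossingMap_surj B w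
    exact ⟨v, (hm v i j k).mpr hw, rfl⟩

theorem isQ_neg (x₁ x₂ y₁ y₂ : M) (B : FreeBicomplex M) :
    Cx.IsQ (C := ((negC x₁ x₂ y₁ y₂).tensor B).toCx)
      (C' := (Cx.shift 0 0 (-1) (Cx.cone (quadE x₁ x₂ y₁)
        (Cx.cone (sumE x₁ x₂ y₁ y₂) B.toCx))).prod
        (Cx.cone (arcE x₁ y₁) (Cx.cone (arcE y₂ x₂) B.toCx)))
      (crossingMap B) := by
  have hm (v : (Fin 4 ⊕ Fin 4) × B.G → TotalRing M) (i j k : ℤ) :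
      v ∈ ((negC x₁ x₂ y₁ y₂).tensor B).toCx.part i j k ↔ crossingMap B v ∈
        ((Cx.shift 0 0 (-1) (Cx.cone (quadE x₁ x₂ y₁)
        (Cx.cone (sumE x₁ x₂ y₁ y₂) B.toCx))).prod
        (Cx.cone (arcE x₁ y₁) (Cx.cone (arcE y₂ x₂) B.toCx))).part i j k := by
    refine mem_tensor_part.trans (Sum.forall.trans (and_congr ?_ ?_))
    · refine Iff.trans ?_ (fourMap_mem B (sumE x₁ x₂ y₁ y₂) (quadE x₁ x₂ y₁) wideQ rfl _
        (i - 0) (j - 0) (k - -1)).symm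
      refine forall_congr' fun x => ?_
      rw [sub_zero, sub_zero]
      rfl
    · refine Iff.trans ?_ (fourMap_mem B (arcE y₂ x₂) (arcE x₁ y₁) arcsQ rfl _ i j k).symm
      refine forall_congr' fun x => ?_
      rw [show (negC x₁ x₂ y₁ y₂).tdeg (Sum.inr x) = 0 from rfl, sub_zero]
      rfl
  refine Cx.IsQ.of_injective (fun v => ?_) (fun {i j k v} => (hm v i j k).mp) ?_
    (crossingMap_inj B)
  · refine Prod.ext ?_ ?_
    · exact (congrArg (fourMap B) (tensorD_fromBlocks_inl _ _ _ _ _ v)).trans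
        (fourMap_comm B _ _ _ (wideD_eq x₁ x₂ y₁ y₂) _)
    · exact (congrArg (fourMap B) (tensorD_fromBlocks_inr _ _ _ _ _ v)).trans
        (fourMap_comm B _ _ _ (arcsD_eq x₁ x₂ y₁ y₂) _)
  · intro i j k w hw
    obtain ⟨v, rfl⟩ := crossingMap_surj B w
    exact ⟨v, (hm v i j k).mpr hw, rfl⟩

/-- The Poincaré series of `H(C(D), d_g)` is the state sum. -/
theorem koszul_foldr_series (F : List (HElt (mvGr M))) (L : List (Piece M)) :
    (Cx.koszul F (L.foldr (fun p B => p.bicomplex.tensor B)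
      (FreeBicomplex.unit M)).toCx).series = stateSum F L := by
  induction L generalizing F with
  | nil => exact isQ_unit.koszul_series F
  | cons p L ih =>
    -- The second arc occurs with its ends exchanged; this is a sign of its row, which does not
    -- affect the series.
    have harcs (x₁ x₂ y₁ y₂ : M) : stateSum (arcE y₂ x₂ :: arcE x₁ y₁ :: F) L =
        stateSum F (.arc x₁ y₁ :: .arc x₂ y₂ :: L) := by
      rw [stateSum_arc_cons, stateSum_arc_cons]
      exact stateSum_congr_head (F := [arcE y₂ x₂]) (F' := [arcE x₂ y₂])
        (fun G => kser_neg (arcE y₂ x₂) (arcE x₂ y₂) rfl (by simp [arcE]) G) _ L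
    cases p with
    | arc x y =>
      rw [stateSum_arc_cons, ← ih]
      exact (isQ_arc x y _).koszul_series F
    | wide x₁ x₂ y₁ y₂ =>
      rw [stateSum_wide_cons, ← ih]
      exact (isQ_wide x₁ x₂ y₁ y₂ _).koszul_series F
    | pos x₁ x₂ y₁ y₂ =>
      have h1 : (Cx.koszul F (Cx.cone (arcE x₁ y₁) (Cx.cone (arcE y₂ x₂) _))).series = _ :=
        (ih (arcE y₂ x₂ :: arcE x₁ y₁ :: F)).trans (harcs x₁ x₂ y₁ y₂)
      have h2 : (Cx.koszul F (Cx.cone (quadE x₁ x₂ y₁) (Cx.cone (sumE x₁ x₂ y₁ y₂) _))).series = _ :=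
        ih (sumE x₁ x₂ y₁ y₂ :: quadE x₁ x₂ y₁ :: F)
      refine ((isQ_pos x₁ x₂ y₁ y₂ _).koszul_series F).trans ?_
      rw [Cx.koszul_prod_series, Cx.koszul_shift_series, stateSum_pos_cons, h1, h2,
        stateSum_wide_cons, show Cx.mono (-2) 0 1 = -Cx.mono (-2) 0 0 by simp [Cx.mono]]
      ring
    | neg x₁ x₂ y₁ y₂ =>
      have h1 : (Cx.koszul F (Cx.cone (arcE x₁ y₁) (Cx.cone (arcE y₂ x₂) _))).series = _ :=
        (ih (arcE y₂ x₂ :: arcE x₁ y₁ :: F)).trans (harcs x₁ x₂ y₁ y₂)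
      have h2 : (Cx.koszul F (Cx.cone (quadE x₁ x₂ y₁) (Cx.cone (sumE x₁ x₂ y₁ y₂) _))).series = _ :=
        ih (sumE x₁ x₂ y₁ y₂ :: quadE x₁ x₂ y₁ :: F)
      refine ((isQ_neg x₁ x₂ y₁ y₂ _).koszul_series F).trans ?_
      rw [Cx.koszul_prod_series, Cx.koszul_shift_series, stateSum_neg_cons, h1, h2,
        stateSum_wide_cons, show Cx.mono 0 0 (-1) = -1 by simp [Cx.mono]]
      ring

theorem bicomplex_series (D : Diagram) [Finite D.Mark] :
    D.bicomplex.toCx.series = stateSum [] D.pieces := koszul_foldr_series [] D.pieces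

end Link

/-! ## Euler characteristics -/

section HomologyPart

variable {R V : Type} [CommRing R] [Algebra ℚ R] [AddCommGroup V] [Module R V] [Module ℚ V]
  [IsScalarTower ℚ R V]

theorem mem_homologyPart {d : V →ₗ[R] V} {W : Submodule ℚ V} {x : Homology d} :
    x ∈ homologyPart d W ↔ ∃ v : LinearMap.ker d, v.1 ∈ W ∧ Submodule.Quotient.mk v = x := by
  rfl

theorem homologyPart_eq_bot (d : V →ₗ[R] V) {W : Submodule ℚ V} (h : W = ⊥) :
    homologyPart d W = ⊥ := by
  refine eq_bot_iff.mpr fun x hx => ?_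
  obtain ⟨v, hv, rfl⟩ := mem_homologyPart.mp hx
  rw [h, Submodule.mem_bot] at hv
  have : v = 0 := Subtype.ext hv
  rw [this]
  exact zero_mem _

/-- The differential as a `ℚ`-linear map. -/
abbrev ratMap (d : V →ₗ[R] V) : V →ₗ[ℚ] V := d.restrictScalars ℚ

theorem comap_ker_map (d : V →ₗ[R] V) (W : Submodule ℚ V) :
    (W.comap ((LinearMap.ker d).subtype.restrictScalars ℚ)).map
      ((LinearMap.ker d).subtype.restrictScalars ℚ) = LinearMap.ker (ratMap d) ⊓ W := by
  ext v
  constructor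
  · rintro ⟨w, hw, rfl⟩
    exact ⟨w.2, hw⟩
  · rintro ⟨h1, h2⟩
    exact ⟨⟨v, h1⟩, h2, rfl⟩

instance finite_comap_ker (d : V →ₗ[R] V) (W : Submodule ℚ V) [FiniteDimensional ℚ W] :
    FiniteDimensional ℚ (W.comap ((LinearMap.ker d).subtype.restrictScalars ℚ)) := by
  have e := Submodule.equivMapOfInjective ((LinearMap.ker d).subtype.restrictScalars ℚ)
    Subtype.val_injective (W.comap ((LinearMap.ker d).subtype.restrictScalars ℚ))
  rw [comap_ker_map] at e
  have : FiniteDimensional ℚ (LinearMap.ker (ratMap d) ⊓ W : Submodule ℚ V) :=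
    Submodule.finiteDimensional_of_le inf_le_right
  exact Module.Finite.equiv e.symm

instance finite_homologyPart (d : V →ₗ[R] V) (W : Submodule ℚ V) [FiniteDimensional ℚ W] :
    FiniteDimensional ℚ (homologyPart d W) := by
  unfold homologyPart
  infer_instance

/-- Rank–nullity for the projection from the cycles in `W` to homology. Its kernel consists of the
boundaries that lie in `W`, and `h`, `h'` say that these are the images of `W'`. In the applications
`W'` is the component that the differential maps to `W`. -/
theorem finrank_homologyPart (d : V →ₗ[R] V) (W W' : Submodule ℚ V) [FiniteDimensional ℚ W]
    (hd : ∀ v, d (d v) = 0) (h : ∀ v, d v ∈ W → ∃ w ∈ W', d w = d v)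
    (h' : ∀ w ∈ W', d w ∈ W) :
    Module.finrank ℚ (LinearMap.ker (ratMap d) ⊓ W : Submodule ℚ V) =
      Module.finrank ℚ (homologyPart d W) + Module.finrank ℚ (W'.map (ratMap d)) := by
  set ι := (LinearMap.ker d).subtype.restrictScalars ℚ with hι
  have hinj : Function.Injective ι := Subtype.val_injective
  set T := W.comap ι with hT
  set p := ((LinearMap.range d).submoduleOf (LinearMap.ker d)).mkQ.restrictScalars ℚ with hp
  rw [← comap_ker_map, ← (Submodule.equivMapOfInjective ι hinj T).finrank_eq,
    finrank_eq_map_add_ker p T]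
  have key : (LinearMap.ker p ⊓ T).map ι = W'.map (ratMap d) := by
    ext v
    constructor
    · rintro ⟨x, ⟨hx1, hx2⟩, rfl⟩
      have hx : x ∈ (LinearMap.range d).submoduleOf (LinearMap.ker d) :=
        (Submodule.Quotient.mk_eq_zero _).mp hx1
      obtain ⟨u, hu⟩ := hx
      have hu' : d u = x.1 := hu
      obtain ⟨w, hw, hwu⟩ := h u (by rw [hu']; exact hx2)
      exact ⟨w, hw, hwu.trans hu'⟩
    · rintro ⟨w, hw, rfl⟩
      refine ⟨⟨d w, hd w⟩, ⟨?_, h' w hw⟩, rfl⟩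
      exact (Submodule.Quotient.mk_eq_zero _).mpr ⟨w, rfl⟩
  rw [(Submodule.equivMapOfInjective ι hinj (LinearMap.ker p ⊓ T)).finrank_eq, key]
  rfl

end HomologyPart

/-! ### Projections to homogeneous components, and passage to the homology of `d_{c*}`. -/

section Projection

variable {M : Type}

noncomputable instance : GradedAlgebra (mvGr M) :=
  MvPolynomial.weightedGradedAlgebra ℚ (fun _ : M => (2 : ℤ))

/-- The projection to a homogeneous component of `ℚ[M]`. -/
noncomputable def mvProj (i : ℤ) : TotalRing M →ₗ[ℚ] TotalRing M := GradedAlgebra.proj (mvGr M) i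

theorem mvProj_mem (i : ℤ) (p : TotalRing M) : mvProj i p ∈ mvGr M i :=
  (DirectSum.decompose (mvGr M) p i).2

theorem mvProj_of_mem {i : ℤ} {p : TotalRing M} (h : p ∈ mvGr M i) : mvProj i p = p :=
  DirectSum.decompose_of_mem_same _ h

theorem mvProj_mul {e i : ℤ} {r : TotalRing M} (hr : r ∈ mvGr M e) (p : TotalRing M) :
    mvProj (e + i) (r * p) = r * mvProj i p :=
  DirectSum.coe_decompose_mul_add_of_left_mem _ hr

namespace FreeBicomplex

/-- The projection to a homogeneous component. -/
noncomputable def proj (B : FreeBicomplex M) (i j k : ℤ) : B.Chains →ₗ[ℚ] B.Chains :=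
  LinearMap.pi fun g => if B.adeg g = j ∧ B.tdeg g = k then
    (mvProj (i - B.qdeg g)).comp (LinearMap.proj g) else 0

theorem proj_apply (B : FreeBicomplex M) (i j k : ℤ) (v : B.Chains) (g : B.G) :
    B.proj i j k v g = if B.adeg g = j ∧ B.tdeg g = k then mvProj (i - B.qdeg g) (v g) else 0 := by
  rw [proj, LinearMap.pi_apply]
  split_ifs <;> rfl

theorem proj_mem (B : FreeBicomplex M) (i j k : ℤ) (v : B.Chains) :
    B.proj i j k v ∈ B.chainsPart i j k := by
  refine fun g => ⟨?_, fun h => ?_⟩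
  · rw [proj_apply]
    split_ifs
    · exact mvProj_mem _ _
    · exact isQHomogeneous_zero _
  · by_contra hc
    rw [proj_apply, if_neg hc] at h
    exact h rfl

theorem proj_of_mem (B : FreeBicomplex M) {i j k : ℤ} {v : B.Chains}
    (h : v ∈ B.chainsPart i j k) : B.proj i j k v = v := by
  funext g
  rw [proj_apply]
  split_ifs with hc
  · exact mvProj_of_mem (h g).1
  · by_contra h0
    exact hc ((h g).2 (Ne.symm h0))

/-- A homogeneous matrix commutes with the projections up to the shift of degrees that its nonzero
entries prescribe; both differentials are instances. -/
theorem proj_matrix (B : FreeBicomplex M) (D : Matrix B.G B.G (TotalRing M))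
    (hq : ∀ g h, IsQHomogeneous (D g h) (B.qdeg h - B.qdeg g)) {j k j' k' : ℤ}
    (hD : ∀ g h, D g h ≠ 0 → ((B.adeg g = j ∧ B.tdeg g = k) ↔ (B.adeg h = j' ∧ B.tdeg h = k')))
    (i : ℤ) (v : B.Chains) : B.proj i j k (D *ᵥ v) = D *ᵥ B.proj i j' k' v := by
  funext g
  rw [proj_apply]
  change (if _ then mvProj _ (∑ h, D g h * v h) else 0) = ∑ h, D g h * B.proj i j' k' v h
  have h1 : (if B.adeg g = j ∧ B.tdeg g = k then mvProj (i - B.qdeg g) (∑ h, D g h * v h) else 0) =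
      ∑ h, if B.adeg g = j ∧ B.tdeg g = k then mvProj (i - B.qdeg g) (D g h * v h) else 0 := by
    split_ifs
    · exact map_sum _ _ _
    · exact Finset.sum_const_zero.symm
  refine h1.trans (Finset.sum_congr rfl fun h _ => ?_)
  rw [proj_apply]
  by_cases h0 : D g h = 0
  · rw [h0, zero_mul, zero_mul, map_zero, ite_self]
  · rw [mul_ite, mul_zero]
    refine if_congr (hD g h h0) ?_ rfl
    rw [← mvProj_mul (hq g h), sub_add_sub_cancel']

theorem proj_dgMap (B : FreeBicomplex M) (i j k : ℤ) (v : B.Chains) :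
    B.proj i j k (B.dgMap v) = B.dgMap (B.proj i (j + 1) k v) :=
  B.proj_matrix B.dg B.dg_qdeg (fun g h hne => by have := B.dg_deg g h hne; omega) i v

theorem proj_dcMap (B : FreeBicomplex M) (i j k : ℤ) (v : B.Chains) :
    B.proj i j (k + 1) (B.dcMap v) = B.dcMap (B.proj i j k v) :=
  B.proj_matrix B.dc B.dc_qdeg (fun g h hne => by have := B.dc_deg g h hne; omega) i v

/-- The homology of `d_g` in a given degree. -/
noncomputable abbrev hPart (B : FreeBicomplex M) (i j k : ℤ) : Submodule ℚ (Homology B.dgMap) :=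
  homologyPart B.dgMap (B.chainsPart i j k)

theorem dcStar_mk (B : FreeBicomplex M) (v : LinearMap.ker B.dgMap) :
    ∃ h : B.dcMap v.1 ∈ LinearMap.ker B.dgMap,
      B.dcStar (Submodule.Quotient.mk v) = Submodule.Quotient.mk ⟨B.dcMap v.1, h⟩ := ⟨_, rfl⟩

theorem dcStar_dcStar (B : FreeBicomplex M) (x : Homology B.dgMap) :
    B.dcStar (B.dcStar x) = 0 := by
  obtain ⟨v, rfl⟩ := Submodule.Quotient.mk_surjective _ x
  obtain ⟨h, e⟩ := B.dcStar_mk v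
  obtain ⟨h', e'⟩ := B.dcStar_mk ⟨B.dcMap v.1, h⟩
  rw [e, e', Submodule.Quotient.mk_eq_zero]
  have : (⟨B.dcMap (B.dcMap v.1), h'⟩ : LinearMap.ker B.dgMap) = 0 := by
    refine Subtype.ext ?_
    change B.dc *ᵥ (B.dc *ᵥ v.1) = 0
    rw [Matrix.mulVec_mulVec, B.dc_sq, Matrix.zero_mulVec]
  rw [this]
  exact zero_mem _

theorem dcStar_mem (B : FreeBicomplex M) {i j k : ℤ} {x : Homology B.dgMap}
    (hx : x ∈ B.hPart i j k) : B.dcStar x ∈ B.hPart i j (k + 1) := by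
  obtain ⟨v, hv, rfl⟩ := mem_homologyPart.mp hx
  obtain ⟨h, e⟩ := B.dcStar_mk v
  rw [e]
  exact mem_homologyPart.mpr ⟨_, B.dcMap_mem hv, rfl⟩

/-- Replace a representing cycle by its component in degree `(i, j, k)`. If `d_c u` agrees with a
homogeneous `v` up to a boundary `d_g w`, projecting this equation shows that `d_c` of the component
agrees with `v` up to the boundary of the projection of `w`. -/
theorem exists_dcStar_eq (B : FreeBicomplex M) {i j k : ℤ} {x : Homology B.dgMap}
    (hx : B.dcStar x ∈ B.hPart i j (k + 1)) : ∃ y ∈ B.hPart i j k, B.dcStar y = B.dcStar x := by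
  obtain ⟨u, rfl⟩ := Submodule.Quotient.mk_surjective _ x
  obtain ⟨v, hv, hvx⟩ := mem_homologyPart.mp hx
  obtain ⟨h, e⟩ := B.dcStar_mk u
  have hu : B.dgMap (B.proj i j k u.1) = 0 := by
    have := B.proj_dgMap i (j - 1) k u.1
    rw [sub_add_cancel] at this
    rw [← this, show B.dgMap u.1 = 0 from u.2, map_zero]
  obtain ⟨h', e'⟩ := B.dcStar_mk ⟨B.proj i j k u.1, hu⟩
  refine ⟨Submodule.Quotient.mk ⟨B.proj i j k u.1, hu⟩,
    mem_homologyPart.mpr ⟨_, B.proj_mem i j k u.1, rfl⟩, ?_⟩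
  rw [← hvx, e', Submodule.Quotient.eq]
  rw [e, Submodule.Quotient.eq] at hvx
  obtain ⟨w, hw⟩ := hvx
  have hw' : B.dgMap w = v.1 - B.dcMap u.1 := hw
  have := congrArg (B.proj i j (k + 1)) hw'
  rw [map_sub, B.proj_dgMap, B.proj_dcMap, B.proj_of_mem hv] at this
  refine ⟨-B.proj i (j + 1) (k + 1) w, ?_⟩
  change B.dgMap (-B.proj i (j + 1) (k + 1) w) = B.dcMap (B.proj i j k u.1) - v.1
  rw [map_neg, this, neg_sub]

variable [Finite M]

theorem finrank_hPart (B : FreeBicomplex M) (i j k : ℤ) :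
    (Module.finrank ℚ (B.hPart i j k) : ℤ) = B.toCx.hdim i j k := by
  have h := finrank_homologyPart B.dgMap (B.chainsPart i j k) (B.chainsPart i (j + 1) k)
    B.dgMap_dgMap (fun v hv => ⟨B.proj i (j + 1) k v, B.proj_mem _ _ _ _, by
      rw [← B.proj_dgMap, B.proj_of_mem hv]⟩) (fun w hw => B.dgMap_mem hw)
  rw [Cx.hdim]
  change _ = (Module.finrank ℚ (LinearMap.ker (ratMap B.dgMap) ⊓ B.chainsPart i j k :
    Submodule ℚ B.Chains) : ℤ) - Module.finrank ℚ
      ((B.chainsPart i (j + 1) k).map (ratMap B.dgMap))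
  rw [h]
  push_cast
  ring

/-- The homology of `d_{c*}` in a given degree. -/
noncomputable abbrev hhPart (B : FreeBicomplex M) (i j k : ℤ) : Submodule ℚ (Homology B.dcStar) :=
  homologyPart B.dcStar (B.hPart i j k)

/-- Dimension of the homology as the dimension of the space, less the ranks of the outgoing and of
the incoming differential. -/
theorem finrank_hhPart (B : FreeBicomplex M) (i j k : ℤ) :
    (Module.finrank ℚ (B.hhPart i j k) : ℤ) = Module.finrank ℚ (B.hPart i j k) -
      Module.finrank ℚ ((B.hPart i j k).map (ratMap B.dcStar)) -
      Module.finrank ℚ ((B.hPart i j (k - 1)).map (ratMap B.dcStar)) := by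
  have h := finrank_homologyPart B.dcStar (B.hPart i j k) (B.hPart i j (k - 1))
    B.dcStar_dcStar (fun x hx => B.exists_dcStar_eq (by rwa [sub_add_cancel]))
    (fun x hx => by have := B.dcStar_mem hx; rwa [sub_add_cancel] at this)
  have h' := finrank_eq_map_add_ker (ratMap B.dcStar) (B.hPart i j k)
  rw [h', h]
  push_cast
  ring

/-- Euler–Poincaré: the rank of `d_{c*}` out of degree `k` is subtracted in degrees `k` and `k + 1`,
with opposite signs. For this reason the maps `χᵢ` and `χₒ` do not matter for `P^b`. -/
theorem chi_toCx (B : FreeBicomplex M) (i j : ℤ) :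
    ∑ᶠ k : ℤ, ((Int.negOnePow k : ℤˣ) : ℤ) * (Module.finrank ℚ (B.hhPart i j k) : ℤ) =
      B.toCx.chi i j := by
  obtain ⟨N, hN⟩ := B.toCx.bounded
  have h0 (k : ℤ) (hk : k ∉ Set.Icc (-N) N) : B.hPart i j k = ⊥ := by
    refine homologyPart_eq_bot _ ?_
    by_contra hc
    exact hk (abs_le.mp (hN i j k hc).2.2)
  let r (k : ℤ) : ℤ := Module.finrank ℚ ((B.hPart i j k).map (ratMap B.dcStar))
  have hr (k : ℤ) (hk : k ∉ Set.Icc (-N) N) : r k = 0 := by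
    simp only [r]
    rw [h0 k hk, Submodule.map_bot, finrank_bot, Nat.cast_zero]
  have f1 : (Function.support fun k : ℤ => ((Int.negOnePow k : ℤˣ) : ℤ) * r k).Finite := by
    refine (Set.finite_Icc (-N) N).subset fun k hk => ?_
    by_contra hc
    exact hk (by simp only [hr k hc, mul_zero])
  have f2 : (Function.support fun k : ℤ => ((Int.negOnePow k : ℤˣ) : ℤ) * r (k - 1)).Finite := by
    refine (Set.finite_Icc (-N + 1) (N + 1)).subset fun k hk => ?_
    by_contra hc
    refine hk ?_
    beta_reduce
    rw [hr (k - 1) (fun h => hc ⟨by linarith [h.1], by linarith [h.2]⟩), mul_zero]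
  have e : ∑ᶠ k : ℤ, ((Int.negOnePow k : ℤˣ) : ℤ) * r (k - 1) =
      -∑ᶠ k : ℤ, ((Int.negOnePow k : ℤˣ) : ℤ) * r k := by
    rw [← finsum_neg_distrib]
    refine Eq.trans ?_ (finsum_comp_equiv (Equiv.subRight (1 : ℤ)))
    refine finsum_congr fun k => ?_
    rw [Equiv.subRight_apply, Int.negOnePow_sub, Int.negOnePow_one]
    push_cast
    ring
  have f3 : (Function.support fun k : ℤ => ((Int.negOnePow k : ℤˣ) : ℤ) * r k +
      ((Int.negOnePow k : ℤˣ) : ℤ) * r (k - 1)).Finite :=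
    (f1.union f2).subset (Function.support_add _ _)
  have e1 := finsum_sub_distrib (B.toCx.chi_support_finite i j) f3
  rw [finsum_add_distrib f1 f2, e, add_neg_cancel, sub_zero] at e1
  rw [Cx.chi, ← e1]
  refine finsum_congr fun k => ?_
  rw [finrank_hhPart, finrank_hPart]
  ring

theorem hhPart_finite (B : FreeBicomplex M) (i : ℤ) :
    {jk : ℤ × ℤ | B.hhPart i jk.1 jk.2 ≠ ⊥}.Finite := by
  obtain ⟨N, hN⟩ := B.toCx.bounded
  refine ((Set.finite_Icc (-N) N).prod (Set.finite_Icc (-N) N)).subset fun jk h => ?_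
  by_contra hc
  refine h (homologyPart_eq_bot _ (homologyPart_eq_bot _ ?_))
  by_contra h0
  have := hN i jk.1 jk.2 h0
  exact hc ⟨abs_le.mp this.2.1, abs_le.mp this.2.2⟩

end FreeBicomplex

end Projection

/-! ## Rationality -/

section Rational

open scoped RatFunc in
/-- The expansion of rational functions at `0` as a homomorphism. -/
noncomputable def expansionAtZero (F : Type) [Field F] : RatFunc F →+* LaurentSeries F :=
  algebraMap (RatFunc F) (LaurentSeries F)

theorem expansionAtZero_X (F : Type) [Field F] :
    expansionAtZero F RatFunc.X = HahnSeries.single 1 1 := RatFunc.coe_X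

theorem expansionAtZero_C {F : Type} [Field F] (c : F) :
    expansionAtZero F (RatFunc.C c) = HahnSeries.single 0 c := by
  have h := (RatFunc.coe_coe (Polynomial.C c)).symm
  rw [Polynomial.coe_C, PowerSeries.coe_C] at h
  refine Eq.trans ?_ h
  rw [← RatFunc.algebraMap_C]
  rfl

/-- The expansion at `q = 0` as a homomorphism. -/
noncomputable def expansionHom : Qqa →+* LaurentSeries (RatFunc ℚ) := expansionAtZero (RatFunc ℚ)

theorem laurentExpansion_eq (F : Qqa) : laurentExpansion F = expansionHom F := rfl

theorem expansionHom_injective : Function.Injective expansionHom := expansionHom.injective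

theorem expansionHom_q : expansionHom q = Cx.mono 1 0 0 := by
  refine (expansionAtZero_X (RatFunc ℚ)).trans ?_
  simp [Cx.mono]

theorem expansionHom_C (c : RatFunc ℚ) : expansionHom (RatFunc.C c) = HahnSeries.single 0 c :=
  expansionAtZero_C c

theorem expansionHom_a : expansionHom a = Cx.mono 0 1 0 := by
  rw [a, expansionHom_C]
  simp [Cx.mono]

theorem single_mem_range (i : ℤ) (c : RatFunc ℚ) :
    HahnSeries.single i c ∈ expansionHom.fieldRange := by
  have h1 : HahnSeries.single i (1 : RatFunc ℚ) ∈ expansionHom.fieldRange := by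
    rw [RatFunc.single_zpow]
    exact zpow_mem (⟨_, expansionAtZero_X (RatFunc ℚ)⟩ :
      HahnSeries.single 1 1 ∈ expansionHom.fieldRange) i
  have := mul_mem (⟨_, expansionHom_C c⟩ : HahnSeries.single 0 c ∈ expansionHom.fieldRange) h1
  rwa [HahnSeries.single_mul_single, zero_add, mul_one] at this

/-- Such a series is a Laurent polynomial in `q` with coefficients in `ℚ(a)`. -/
theorem mem_range_of_finite (f : LaurentSeries (RatFunc ℚ))
    (h : (Function.support f.coeff).Finite) : f ∈ expansionHom.fieldRange := by
  have : f = ∑ i ∈ h.toFinset, HahnSeries.single i (f.coeff i) := by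
    ext n
    rw [HahnSeries.coeff_sum]
    by_cases hn : f.coeff n = 0
    · rw [hn, Finset.sum_eq_zero fun i _ => ?_]
      by_cases hi : n = i
      · subst hi; rw [hn]; simp
      · exact HahnSeries.coeff_single_of_ne hi
    · rw [Finset.sum_eq_single n (fun i _ hi => HahnSeries.coeff_single_of_ne hi.symm)
        (fun h' => absurd (h.mem_toFinset.mpr hn) h'), HahnSeries.coeff_single_same]
  rw [this]
  exact sum_mem fun i _ => single_mem_range i _

/-! ### Hilbert series of homogeneous submodules. -/

namespace FreeBicomplex

variable {M : Type} (B : FreeBicomplex M)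

theorem proj_X_smul (i j k : ℤ) (m : M) (v : B.Chains) :
    B.proj (i + 2) j k ((MvPolynomial.X m : TotalRing M) • v) =
      (MvPolynomial.X m : TotalRing M) • B.proj i j k v := by
  funext g
  rw [proj_apply, Pi.smul_apply, Pi.smul_apply, proj_apply, smul_eq_mul, smul_eq_mul, mul_ite,
    mul_zero, ← mvProj_mul (X_mem_mvGr m), add_sub_right_comm, add_comm 2]

theorem proj_finite (j k : ℤ) (v : B.Chains) : {i | B.proj i j k v ≠ 0}.Finite := by
  have h (g : B.G) : {i | mvProj (i - B.qdeg g) (v g) ≠ 0}.Finite := by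
    classical
    have h1 : {i | mvProj i (v g) ≠ 0}.Finite := by
      refine (DirectSum.decompose (mvGr M) (v g)).support.finite_toSet.subset fun i hi => ?_
      exact DFinsupp.mem_support_iff.mpr fun h0 => hi (congrArg Subtype.val h0)
    exact h1.preimage (sub_left_injective.injOn)
  refine (Set.finite_iUnion h).subset fun i hi => ?_
  obtain ⟨g, hg⟩ := Function.ne_iff.mp hi
  refine Set.mem_iUnion.mpr ⟨g, fun h0 => hg ?_⟩
  rw [proj_apply, h0, ite_self]
  rfl

variable [Finite M] (j k : ℤ)

/-- The homogeneous component of a submodule. -/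
noncomputable def comp (A : Submodule (TotalRing M) B.Chains) (i : ℤ) : Submodule ℚ B.Chains :=
  A.restrictScalars ℚ ⊓ B.chainsPart i j k

instance (A : Submodule (TotalRing M) B.Chains) (i : ℤ) : FiniteDimensional ℚ (B.comp j k A i) :=
  Submodule.finiteDimensional_of_le inf_le_right

theorem comp_bddBelow (A : Submodule (TotalRing M) B.Chains) : BddBelow
    (Function.support fun i => (Module.finrank ℚ (B.comp j k A i) : RatFunc ℚ)) := by
  obtain ⟨N, hN⟩ := B.toCx.bounded
  refine ⟨-N, fun i hi => ?_⟩
  refine (hN i j k fun h => hi ?_).1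
  have : B.comp j k A i = ⊥ := eq_bot_iff.mpr (inf_le_right.trans_eq h)
  beta_reduce
  rw [this, finrank_bot, Nat.cast_zero]

/-- The Hilbert series of a submodule. -/
noncomputable def hilbert (A : Submodule (TotalRing M) B.Chains) : LaurentSeries (RatFunc ℚ) :=
  HahnSeries.ofSuppBddBelow _ (B.comp_bddBelow j k A)

theorem coeff_hilbert (A : Submodule (TotalRing M) B.Chains) (i : ℤ) :
    (B.hilbert j k A).coeff i = Module.finrank ℚ (B.comp j k A i) := rfl

/-- A submodule closed under projections to homogeneous components. -/
def IsHomogeneous (A : Submodule (TotalRing M) B.Chains) : Prop :=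
  ∀ i, ∀ v ∈ A, B.proj i j k v ∈ A

variable {B j k}

theorem X_smul_mem_chainsPart {i : ℤ} (m : M) {v : B.Chains} (h : v ∈ B.chainsPart i j k) :
    (MvPolynomial.X m : TotalRing M) • v ∈ B.chainsPart (i + 2) j k := by
  have := B.toCx.smul_mem (X_mem_mvGr m) h
  rwa [add_comm] at this

/-- The image under a variable. -/
noncomputable def mulX (m : M) : B.Chains →ₗ[TotalRing M] B.Chains :=
  (MvPolynomial.X m : TotalRing M) • LinearMap.id

omit [Finite M] in
theorem mulX_apply (m : M) (v : B.Chains) : mulX m v = (MvPolynomial.X m : TotalRing M) • v := rfl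

/-- Dimension formula for a sum, with `x A ∩ A' = x (A ∩ x⁻¹A')`. Multiplication by `x` has the same
kernel on `A` and on `A ∩ x⁻¹A'`, since `A'` contains zero, so the kernels cancel and need not
vanish. -/
theorem hilbert_mulX (A A' : Submodule (TotalRing M) B.Chains) (hA : B.IsHomogeneous j k A)
    (hA' : B.IsHomogeneous j k A') (m : M) :
    B.hilbert j k (A.map (mulX m) ⊔ A') = Cx.mono 2 0 0 * B.hilbert j k A + B.hilbert j k A' -
      Cx.mono 2 0 0 * B.hilbert j k (A ⊓ A'.comap (mulX m)) := by
  ext n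
  obtain ⟨i, rfl⟩ : ∃ i, n = i + 2 := ⟨n - 2, by ring⟩
  rw [HahnSeries.coeff_sub, HahnSeries.coeff_add, Cx.mono, HahnSeries.coeff_single_mul,
    HahnSeries.coeff_single_mul, add_sub_cancel_right]
  simp only [coeff_hilbert]
  set x := ratMap (mulX (B := B) m) with hx
  have h1 : B.comp j k (A.map (mulX m) ⊔ A') (i + 2) =
      (B.comp j k A i).map x ⊔ B.comp j k A' (i + 2) := by
    refine le_antisymm ?_ (sup_le ?_ ?_)
    · rintro v ⟨hv, hv'⟩
      obtain ⟨_, ⟨a, ha, rfl⟩, b, hb, rfl⟩ := Submodule.mem_sup.mp hv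
      rw [← B.proj_of_mem hv', map_add]
      refine add_mem (Submodule.mem_sup_left ⟨B.proj i j k a, ⟨hA _ _ ha, B.proj_mem _ _ _ _⟩,
        (B.proj_X_smul i j k m a).symm⟩)
        (Submodule.mem_sup_right ⟨hA' _ _ hb, B.proj_mem _ _ _ _⟩)
    · rintro _ ⟨a, ⟨ha, ha'⟩, rfl⟩
      exact ⟨Submodule.mem_sup_left ⟨a, ha, rfl⟩, X_smul_mem_chainsPart m ha'⟩
    · exact fun b hb => ⟨Submodule.mem_sup_right hb.1, hb.2⟩
  have h2 : (B.comp j k A i).map x ⊓ B.comp j k A' (i + 2) =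
      (B.comp j k (A ⊓ A'.comap (mulX m)) i).map x := by
    ext v
    constructor
    · rintro ⟨⟨a, ha, rfl⟩, hv⟩
      exact ⟨a, ⟨⟨ha.1, hv.1⟩, ha.2⟩, rfl⟩
    · rintro ⟨a, ⟨⟨ha, ha'⟩, ha''⟩, rfl⟩
      exact ⟨⟨a, ⟨ha, ha''⟩, rfl⟩, ha', X_smul_mem_chainsPart m ha''⟩
  have h3 : LinearMap.ker x ⊓ B.comp j k (A ⊓ A'.comap (mulX m)) i =
      LinearMap.ker x ⊓ B.comp j k A i := by
    ext v
    constructor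
    · rintro ⟨h, ⟨h', -⟩, h''⟩
      exact ⟨h, h', h''⟩
    · rintro ⟨h, h', h''⟩
      refine ⟨h, ⟨h', ?_⟩, h''⟩
      have h0 : mulX m v = 0 := h
      change mulX m v ∈ A'
      rw [h0]
      exact zero_mem _
  have e1 := Submodule.finrank_sup_add_finrank_inf_eq ((B.comp j k A i).map x)
    (B.comp j k A' (i + 2))
  have e2 := finrank_eq_map_add_ker x (B.comp j k A i)
  have e3 := finrank_eq_map_add_ker x (B.comp j k (A ⊓ A'.comap (mulX m)) i)
  rw [← h1, h2] at e1
  rw [h3] at e3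
  have e : Module.finrank ℚ (B.comp j k (A.map (mulX m) ⊔ A') (i + 2)) +
      Module.finrank ℚ (B.comp j k (A ⊓ A'.comap (mulX m)) i) =
      Module.finrank ℚ (B.comp j k A i) + Module.finrank ℚ (B.comp j k A' (i + 2)) := by omega
  have e' := congrArg (Nat.cast : ℕ → RatFunc ℚ) e
  push_cast at e'
  simp only [Int.negOnePow_zero, zpow_zero]
  push_cast
  linear_combination e'

-- A polynomial without constant term lies in the ideal of the variables, so only constants act on
-- `A/A'`.
omit [Finite M] in
theorem smul_sub_constant_mem {A A' : Submodule (TotalRing M) B.Chains}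
    (h : ∀ m, ∀ v ∈ A, (MvPolynomial.X m : TotalRing M) • v ∈ A') (r : TotalRing M)
    {v : B.Chains} (hv : v ∈ A) : r • v - MvPolynomial.constantCoeff r • v ∈ A' := by
  induction r using MvPolynomial.induction_on with
  | C c =>
    rw [MvPolynomial.constantCoeff_C, ← MvPolynomial.algebraMap_eq, algebraMap_smul, sub_self]
    exact zero_mem _
  | add p r hp hr =>
    rw [map_add, add_smul, add_smul, add_sub_add_comm]
    exact add_mem hp hr
  | mul_X p m _ =>
    rw [map_mul, MvPolynomial.constantCoeff_X, mul_zero, zero_smul, sub_zero, mul_smul]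
    exact A'.smul_mem _ (h m v hv)

/-- If all variables kill `A/A'`, then the quotient is spanned over `ℚ` by generators of `A`, of
which finitely many suffice by the Noetherian property; so it lives in the finitely many degrees in
which these have nonzero components. -/
theorem finite_of_X_smul_mem {A A' : Submodule (TotalRing M) B.Chains}
    (hA' : B.IsHomogeneous j k A')
    (h : ∀ m, ∀ v ∈ A, (MvPolynomial.X m : TotalRing M) • v ∈ A') :
    {i | ¬ B.comp j k A i ≤ B.comp j k A' i}.Finite := by
  obtain ⟨T, hT⟩ : A.FG := IsNoetherian.noetherian A
  refine ((T.finite_toSet).biUnion fun t _ => B.proj_finite j k t).subset fun i hi => ?_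
  by_contra hc
  refine hi fun v hv => ⟨?_, hv.2⟩
  have h0 : ∀ t ∈ T, B.proj i j k t = 0 := fun t ht => by
    by_contra h1
    exact hc (Set.mem_biUnion (Finset.mem_coe.mpr ht) h1)
  have key : ∀ w ∈ Submodule.span (TotalRing M) (T : Set B.Chains), B.proj i j k w ∈ A' := by
    intro w hw
    induction hw using Submodule.span_induction with
    | mem t ht => rw [h0 t ht]; exact zero_mem _
    | zero => rw [map_zero]; exact zero_mem _
    | add x y _ _ hx hy => rw [map_add]; exact add_mem hx hy
    | smul r x hx hpx =>
      have h1 := hA' i _ (smul_sub_constant_mem h r (hT ▸ hx))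
      rw [map_sub, (B.proj i j k).map_smul (MvPolynomial.constantCoeff r)] at h1
      have h2 := A'.smul_mem (algebraMap ℚ _ (MvPolynomial.constantCoeff r)) hpx
      rw [algebraMap_smul] at h2
      have := add_mem h1 h2
      rwa [sub_add_cancel] at this
  rw [← B.proj_of_mem hv.2]
  exact key v (hT ▸ hv.1)

/-- Hilbert–Serre for `A/A'`, by induction on a set `S` outside of which all variables kill the
quotient. For `x` in `S`, the cokernel `A/(xA + A')` and the kernel `(A ∩ x⁻¹A')/A'` of
multiplication by `x` are killed by `x` too, so the hypothesis applies to both. Without variables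
the quotient has finitely many degrees. -/
theorem hilbert_sub_mem_range (S : Finset M) (A A' : Submodule (TotalRing M) B.Chains)
    (hA : B.IsHomogeneous j k A) (hA' : B.IsHomogeneous j k A') (hle : A' ≤ A)
    (h : ∀ m, m ∉ S → ∀ v ∈ A, (MvPolynomial.X m : TotalRing M) • v ∈ A') :
    B.hilbert j k A - B.hilbert j k A' ∈ expansionHom.fieldRange := by
  classical
  induction S using Finset.induction_on generalizing A A' with
  | empty =>
    refine mem_range_of_finite _ ((finite_of_X_smul_mem hA'
      fun m => h m (Finset.notMem_empty m)).subset fun i hi hc => hi ?_)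
    have : B.comp j k A i = B.comp j k A' i :=
      le_antisymm hc fun v hv => ⟨hle hv.1, hv.2⟩
    rw [HahnSeries.coeff_sub, coeff_hilbert, coeff_hilbert, this, sub_self]
  | insert m S hm ih =>
    have hC : A.map (mulX m) ⊔ A' ≤ A := sup_le (by
      rintro _ ⟨a, ha, rfl⟩
      exact A.smul_mem _ ha) hle
    have hK : A' ≤ A ⊓ A'.comap (mulX m) := le_inf hle fun v hv => A'.smul_mem _ hv
    have h1 := ih A (A.map (mulX m) ⊔ A') hA (fun i v hv => by
        obtain ⟨_, ⟨a, ha, rfl⟩, b, hb, rfl⟩ := Submodule.mem_sup.mp hv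
        rw [map_add]
        refine add_mem (Submodule.mem_sup_left ⟨B.proj (i - 2) j k a, hA _ _ ha, ?_⟩)
          (Submodule.mem_sup_right (hA' _ _ hb))
        have := B.proj_X_smul (i - 2) j k m a
        rw [sub_add_cancel] at this
        exact this.symm) hC
      fun m' hm' v hv => by
        by_cases e : m' = m
        · rw [e]
          exact Submodule.mem_sup_left ⟨v, hv, rfl⟩
        · exact Submodule.mem_sup_right (h m' (by simp [e, hm']) v hv)
    have h2 := ih (A ⊓ A'.comap (mulX m)) A' (fun i v hv => by
        refine ⟨hA _ _ hv.1, ?_⟩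
        have := hA' (i + 2) _ hv.2
        rw [mulX_apply, B.proj_X_smul] at this
        exact this) hA' hK
      fun m' hm' v hv => by
        by_cases e : m' = m
        · rw [e]
          exact hv.2
        · exact h m' (by simp [e, hm']) v hv.1
    rw [hilbert_mulX A A' hA hA'] at h1
    have h3 : Cx.mono 2 0 0 ∈ expansionHom.fieldRange := single_mem_range _ _
    have h4 : (1 : LaurentSeries (RatFunc ℚ)) - Cx.mono 2 0 0 ≠ 0 := by
      have := one_add_mono_ne_zero (m := 2) two_ne_zero 0 1
      rwa [show Cx.mono 2 0 1 = -Cx.mono 2 0 0 by simp [Cx.mono], ← sub_eq_add_neg] at this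
    -- This difference, cokernel minus `q²` times kernel, is `1 - q²` times the Hilbert series of
    -- `A/A'`.
    have h5 := sub_mem h1 (mul_mem h3 h2)
    have h6 := mul_mem (inv_mem (sub_mem (one_mem expansionHom.fieldRange) h3)) h5
    convert h6 using 1
    rw [eq_inv_mul_iff_mul_eq₀ h4]
    ring

variable (B j k) in
omit [Finite M] in
theorem isHomogeneous_ker : B.IsHomogeneous j k (LinearMap.ker B.dgMap) := by
  intro i v hv
  have h := B.proj_dgMap i (j - 1) k v
  rw [LinearMap.mem_ker.mp hv, map_zero, sub_add_cancel] at h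
  exact h.symm

variable (B j k) in
omit [Finite M] in
theorem isHomogeneous_range : B.IsHomogeneous j k (LinearMap.range B.dgMap) := by
  rintro i _ ⟨w, rfl⟩
  exact ⟨_, (B.proj_dgMap i j k w).symm⟩

variable (B) in
theorem hdim_toCx (i j k : ℤ) : (B.toCx.hdim i j k : RatFunc ℚ) =
    (B.hilbert j k (LinearMap.ker B.dgMap) - B.hilbert j k (LinearMap.range B.dgMap)).coeff i := by
  have h1 : B.toCx.cycles i j k = B.comp j k (LinearMap.ker B.dgMap) i := rfl
  have h2 : B.toCx.bounds i j k = B.comp j k (LinearMap.range B.dgMap) i := by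
    refine le_antisymm ?_ ?_
    · rintro _ ⟨w, hw, rfl⟩
      exact ⟨⟨w, rfl⟩, B.dgMap_mem hw⟩
    · rintro _ ⟨⟨w, rfl⟩, hw⟩
      refine ⟨B.proj i (j + 1) k w, B.proj_mem _ _ _ _, ?_⟩
      exact (B.proj_dgMap i j k w).symm.trans (B.proj_of_mem hw)
  rw [HahnSeries.coeff_sub, coeff_hilbert, coeff_hilbert, ← h2, ← h1, Cx.hdim]
  push_cast
  rfl

-- By boundedness the series is a finite combination, over `j` and `k`, of the Hilbert series of
-- cycles modulo boundaries.
variable (B) in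
theorem series_mem_range : B.toCx.series ∈ expansionHom.fieldRange := by
  have := Fintype.ofFinite M
  obtain ⟨N, hN⟩ := B.toCx.bounded
  let T := Finset.Icc (-N) N
  have h0 (i j k : ℤ) (h : j ∉ T ∨ k ∉ T) : B.toCx.hdim i j k = 0 := by
    refine B.toCx.hdim_eq_zero ?_
    by_contra hc
    have := hN i j k hc
    rw [Finset.mem_Icc, Finset.mem_Icc, ← abs_le, ← abs_le] at h
    omega
  have e : B.toCx.series = ∑ j ∈ T, ∑ k ∈ T,
      HahnSeries.single 0 (((Int.negOnePow k : ℤˣ) : ℤ) * (RatFunc.X : RatFunc ℚ) ^ j) *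
        (B.hilbert j k (LinearMap.ker B.dgMap) - B.hilbert j k (LinearMap.range B.dgMap)) := by
    ext i
    change B.toCx.seriesCoeff i = _
    simp only [HahnSeries.coeff_sum, HahnSeries.coeff_single_mul, sub_zero, ← hdim_toCx]
    have h1 (j : ℤ) : B.toCx.chi i j =
        ∑ k ∈ T, ((Int.negOnePow k : ℤˣ) : ℤ) * B.toCx.hdim i j k := by
      refine finsum_eq_sum_of_support_subset _ fun k hk => ?_
      by_contra hc
      exact hk (by simp only [h0 i j k (Or.inr hc), mul_zero])
    rw [Cx.seriesCoeff, finsum_eq_sum_of_support_subset (s := T)]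
    · refine Finset.sum_congr rfl fun j _ => ?_
      rw [h1, Int.cast_sum, Finset.sum_mul]
      refine Finset.sum_congr rfl fun k _ => ?_
      push_cast
      ring
    · intro j hj
      by_contra hc
      refine hj ?_
      have : B.toCx.chi i j = 0 := by
        rw [h1]
        exact Finset.sum_eq_zero fun k _ => by rw [h0 i j k (Or.inl hc), mul_zero]
      simp only [this, Int.cast_zero, zero_mul]
  rw [e]
  refine sum_mem fun j _ => sum_mem fun k _ => mul_mem (single_mem_range _ _) ?_
  refine hilbert_sub_mem_range Finset.univ _ _ (B.isHomogeneous_ker j k)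
    (B.isHomogeneous_range j k) ?_ fun m hm => absurd (Finset.mem_univ m) hm
  rintro _ ⟨w, rfl⟩
  exact B.dgMap_dgMap w

end FreeBicomplex

end Rational

/-! ## The polynomial `P^b` as a state sum -/

/-- Every mark is a beginning of one of the finitely many pieces. -/
theorem Closed.finite {M : Type} {L : List (Piece M)} (h : Closed L) : Finite M := by
  refine Set.finite_univ_iff.mp ((L.flatMap Piece.ins).finite_toSet.subset fun m _ => h.mem_ins m)

/-- The finiteness conditions always hold, so being the Poincaré series is one equation between
Laurent series. As the expansion is injective, it has at most one solution. -/
theorem Diagram.isPoincareAtNegOne_iff (D : Diagram) [Finite D.Mark] (F : Qqa) :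
    D.IsPoincareAtNegOne F ↔ expansionHom F = stateSum [] D.pieces := by
  have e (i : ℤ) : (stateSum [] D.pieces).coeff i =
      ∑ᶠ j : ℤ, (D.coeffAtNegOne i j : RatFunc ℚ) * (RatFunc.X : RatFunc ℚ) ^ j := by
    rw [← bicomplex_series]
    change D.bicomplex.toCx.seriesCoeff i = _
    refine finsum_congr fun j => ?_
    rw [← FreeBicomplex.chi_toCx]
    rfl
  constructor
  · rintro ⟨-, -, h⟩
    ext i
    rw [e, ← h i, laurentExpansion_eq]
  · intro h
    refine ⟨fun i j k => ?_, fun i => D.bicomplex.hhPart_finite i, fun i => ?_⟩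
    · change FiniteDimensional ℚ (D.bicomplex.hhPart i j k)
      infer_instance
    · rw [laurentExpansion_eq, h, e]

theorem isPoincareAtNegOne_Pb (D : Diagram) : D.IsPoincareAtNegOne (Pb D) := by
  have := D.closed.finite
  obtain ⟨F, hF⟩ := D.bicomplex.series_mem_range
  have h : ∃ F, D.IsPoincareAtNegOne F :=
    ⟨F, (D.isPoincareAtNegOne_iff F).mpr (hF.trans (bicomplex_series D))⟩
  rw [Pb, dif_pos h]
  exact h.choose_spec

theorem expansionHom_Pb {M : Type} [Finite M] {L : List (Piece M)} (h : Closed L) :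
    expansionHom (Pb ⟨M, L, h⟩) = stateSum [] L :=
  have : Finite (Diagram.mk M L h).Mark := ‹_›
  (Diagram.isPoincareAtNegOne_iff ⟨M, L, h⟩ _).mp (isPoincareAtNegOne_Pb _)

theorem Pb_eq_of_step {D D' : Diagram} (h : BraidlikeStep D D') : Pb D = Pb D' := by
  apply expansionHom_injective
  have := D.closed.finite
  have := D'.closed.finite
  rw [(D.isPoincareAtNegOne_iff _).mp (isPoincareAtNegOne_Pb D),
    (D'.isPoincareAtNegOne_iff _).mp (isPoincareAtNegOne_Pb D')]
  cases h with
  | relabel _ _ e h => exact ((stateSum_perm h []).trans (stateSum_equiv e [] _)).symm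
  | @mark M m L h h' =>
    have : Finite M := h'.finite
    exact stateSum_mark m [] L
  | @reidIIa_pos_neg M x₁ x₂ y₁ y₂ L h h' =>
    have : Finite M := h'.finite
    exact stateSum_reidIIa_pos_neg x₁ x₂ y₁ y₂ L
  | @reidIIa_neg_pos M x₁ x₂ y₁ y₂ L h h' =>
    have : Finite M := h'.finite
    exact stateSum_reidIIa_neg_pos x₁ x₂ y₁ y₂ L
  | @reidIII M x₁ x₂ x₃ y₁ y₂ y₃ L h h' =>
    have := h.finite
    have : Finite M := Finite.of_injective (Sum.inl : M → M ⊕ Fin 3) Sum.inl_injective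
    exact stateSum_reidIII x₁ x₂ x₃ y₁ y₂ y₃ L

theorem Pb_eq_of_isotopic {D D' : Diagram} (h : BraidlikeIsotopic D D') : Pb D = Pb D' := by
  induction h with
  | rel _ _ h => exact Pb_eq_of_step h
  | refl => rfl
  | symm _ _ _ ih => exact ih.symm
  | trans _ _ _ _ _ ih ih' => exact ih.trans ih'

/-! ### Translation of relations -/

theorem expansionHom_q_sq : expansionHom (q ^ 2) = Cx.mono 2 0 0 := by
  rw [pow_two, map_mul, expansionHom_q, mono_mul_mono]
  rfl

theorem expansionHom_a_mul_q_pow (n : ℕ) : expansionHom (a * q ^ n) = Cx.mono n 1 0 := by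
  induction n with
  | zero => rw [pow_zero, mul_one, expansionHom_a, Nat.cast_zero]
  | succ n ih =>
    rw [pow_succ, ← mul_assoc, map_mul, ih, expansionHom_q, mono_mul_mono, Nat.cast_succ,
      add_zero]

theorem expansionHom_q_sq_inv : expansionHom (q ^ 2)⁻¹ = Cx.mono (-2) 0 0 := by
  rw [map_inv₀, expansionHom_q_sq]
  exact inv_eq_of_mul_eq_one_right (mono_mul_cancel 2)

theorem q_ne_zero : q ≠ 0 := RatFunc.X_ne_zero

theorem one_sub_q_sq_ne_zero : 1 - q ^ 2 ≠ 0 := by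
  intro h
  have h1 := congrArg expansionHom h
  rw [map_sub, map_one, map_zero, expansionHom_q_sq] at h1
  refine one_add_mono_ne_zero (m := 2) two_ne_zero 0 1 ?_
  rwa [show Cx.mono 2 0 1 = -Cx.mono 2 0 0 by simp [Cx.mono], ← sub_eq_add_neg]

/-! ### The empty diagram and the single circle. -/

theorem mvGr_eq_bot_of_isEmpty {M : Type} [IsEmpty M] {i : ℤ} (hi : i ≠ 0) : mvGr M i = ⊥ := by
  refine eq_bot_iff.mpr fun p hp => ?_
  by_contra h0
  have h1 : IsQHomogeneous p 0 := by
    rw [MvPolynomial.eq_C_of_isEmpty p]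
    exact MvPolynomial.isWeightedHomogeneous_C _ _
  exact hi (MvPolynomial.IsWeightedHomogeneous.inj_right h0 hp h1)

theorem finrank_mvGr_zero_of_isEmpty {M : Type} [IsEmpty M] :
    Module.finrank ℚ (mvGr M 0) = 1 := by
  have : mvGr M 0 = ⊤ := by
    refine eq_top_iff.mpr fun p _ => ?_
    rw [MvPolynomial.eq_C_of_isEmpty p]
    exact MvPolynomial.isWeightedHomogeneous_C _ _
  rw [this, finrank_top, (MvPolynomial.isEmptyAlgEquiv ℚ M).toLinearEquiv.finrank_eq,
    Module.finrank_self]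

theorem stateSum_empty {M : Type} [IsEmpty M] [Finite M] :
    stateSum [] ([] : List (Piece M)) = 1 := by
  change (Cx.base (mvGr M)).series = 1
  have h0 (i j k : ℤ) (h : i ≠ 0 ∨ j ≠ 0 ∨ k ≠ 0) : (Cx.base (mvGr M)).hdim i j k = 0 := by
    refine Cx.hdim_eq_zero _ ?_
    change (if j = 0 ∧ k = 0 then mvGr M i else ⊥) = ⊥
    split_ifs with h1
    · exact mvGr_eq_bot_of_isEmpty (by tauto)
    · rfl
  have h1 : (Cx.base (mvGr M)).hdim 0 0 0 = 1 := by
    have e1 : (Cx.base (mvGr M)).cycles 0 0 0 = mvGr M 0 := by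
      ext v
      exact ⟨fun h => h.2, fun h => ⟨rfl, h⟩⟩
    have e2 : (Cx.base (mvGr M)).bounds 0 0 0 = ⊥ := by
      refine eq_bot_iff.mpr ?_
      rintro _ ⟨w, -, rfl⟩
      exact zero_mem _
    have e3 : Module.finrank ℚ ((Cx.base (mvGr M)).cycles 0 0 0) = 1 := by
      rw [e1]
      exact finrank_mvGr_zero_of_isEmpty
    rw [Cx.hdim, e3, e2, finrank_bot]
    rfl
  have h2 (i j : ℤ) : (Cx.base (mvGr M)).chi i j = (Cx.base (mvGr M)).hdim i j 0 := by
    rw [Cx.chi, finsum_eq_single _ 0 fun k hk => by rw [h0 i j k (by tauto), mul_zero]]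
    simp
  have h3 (i : ℤ) : (Cx.base (mvGr M)).seriesCoeff i = (Cx.base (mvGr M)).hdim i 0 0 := by
    rw [Cx.seriesCoeff, finsum_eq_single _ 0 fun j hj => by rw [h2, h0 i j 0 (by tauto)]; simp]
    rw [h2, zpow_zero, mul_one]
  ext i
  change (Cx.base (mvGr M)).seriesCoeff i = _
  rw [h3]
  by_cases hi : i = 0
  · subst hi
    rw [h1]
    simp
  · rw [h0 i 0 0 (Or.inl hi), HahnSeries.coeff_one, if_neg hi, Int.cast_zero]

/-- The circle next to the empty diagram, whose series is that of `ℚ` in degree zero. -/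
theorem stateSum_unit_circle :
    (1 - Cx.mono 2 0 0) * stateSum [] [Piece.arc () ()] = 1 + Cx.mono 2 1 0 := by
  have h := stateSum_circle ([] : List (Piece Empty))
  rw [stateSum_empty, mul_one] at h
  rw [← h, ← stateSum_equiv (Equiv.ofUnique (Option Empty) Unit) []]
  rfl

/-! ### The relations -/

theorem Pb_pos {M : Type} {x₁ x₂ y₁ y₂ : M} {L : List (Piece M)}
    (hpos : Closed (Piece.pos x₁ x₂ y₁ y₂ :: L))
    (hzero : Closed (Piece.arc x₁ y₁ :: Piece.arc x₂ y₂ :: L))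
    (hwide : Closed (Piece.wide x₁ x₂ y₁ y₂ :: L)) :
    Pb ⟨M, _, hpos⟩ = Pb ⟨M, _, hzero⟩ - (q ^ 2)⁻¹ * Pb ⟨M, _, hwide⟩ := by
  have := hpos.finite
  apply expansionHom_injective
  rw [map_sub, map_mul, expansionHom_q_sq_inv, expansionHom_Pb, expansionHom_Pb, expansionHom_Pb,
    stateSum_pos_cons]

theorem Pb_neg {M : Type} {x₁ x₂ y₁ y₂ : M} {L : List (Piece M)}
    (hneg : Closed (Piece.neg x₁ x₂ y₁ y₂ :: L))
    (hzero : Closed (Piece.arc x₁ y₁ :: Piece.arc x₂ y₂ :: L))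
    (hwide : Closed (Piece.wide x₁ x₂ y₁ y₂ :: L)) :
    Pb ⟨M, _, hneg⟩ = Pb ⟨M, _, hzero⟩ - Pb ⟨M, _, hwide⟩ := by
  have := hneg.finite
  apply expansionHom_injective
  rw [map_sub, expansionHom_Pb, expansionHom_Pb, expansionHom_Pb, stateSum_neg_cons]

/-- In the two resolutions the MOY vertex has the coefficients `-q · q⁻²` and `q⁻¹`, which cancel.
-/
theorem Pb_skein {M : Type} {x₁ x₂ y₁ y₂ : M} {L : List (Piece M)}
    (hpos : Closed (Piece.pos x₁ x₂ y₁ y₂ :: L)) (hneg : Closed (Piece.neg x₁ x₂ y₁ y₂ :: L))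
    (hzero : Closed (Piece.arc x₁ y₁ :: Piece.arc x₂ y₂ :: L)) :
    q * Pb ⟨M, _, hpos⟩ - q⁻¹ * Pb ⟨M, _, hneg⟩ = (q - q⁻¹) * Pb ⟨M, _, hzero⟩ := by
  -- Being closed depends only on the ends, and these are the same for a crossing and for a MOY
  -- vertex.
  have hwide : Closed (Piece.wide x₁ x₂ y₁ y₂ :: L) := ⟨hpos.1, hpos.2, hpos.3, hpos.4⟩
  rw [Pb_pos hpos hzero hwide, Pb_neg hneg hzero hwide]
  have := q_ne_zero
  field_simp
  ring

theorem Pb_unit_circle (h : Closed [Piece.arc () ()]) :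
    Pb ⟨Unit, _, h⟩ = (1 + a * q ^ 2) / (1 - q ^ 2) := by
  rw [eq_div_iff one_sub_q_sq_ne_zero, mul_comm]
  apply expansionHom_injective
  rw [map_mul, map_sub, map_add, map_one, expansionHom_q_sq, expansionHom_a_mul_q_pow,
    expansionHom_Pb]
  exact stateSum_unit_circle

theorem Pb_circle {M : Type} {L : List (Piece M)}
    (hcirc : Closed (Piece.arc none none :: L.map (Piece.map (some : M → Option M))))
    (h : Closed L) :
    Pb ⟨Option M, _, hcirc⟩ = (1 + a * q ^ 2) / (1 - q ^ 2) * Pb ⟨M, _, h⟩ := by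
  have := h.finite
  rw [div_mul_eq_mul_div, eq_div_iff one_sub_q_sq_ne_zero, mul_comm]
  apply expansionHom_injective
  rw [map_mul, map_mul, map_sub, map_add, map_one, expansionHom_q_sq, expansionHom_a_mul_q_pow,
    expansionHom_Pb, expansionHom_Pb]
  exact stateSum_circle L

theorem Pb_moyI {M : Type} {x y : M} {L : List (Piece M)}
    (hcurl : Closed (Piece.wide (some x) none (some y) none ::
      L.map (Piece.map (some : M → Option M))))
    (h : Closed (Piece.arc x y :: L)) :
    Pb ⟨Option M, _, hcurl⟩ = (1 + a * q ^ 4) / (1 - q ^ 2) * Pb ⟨M, _, h⟩ := by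
  have := h.finite
  rw [div_mul_eq_mul_div, eq_div_iff one_sub_q_sq_ne_zero, mul_comm]
  apply expansionHom_injective
  rw [map_mul, map_mul, map_sub, map_add, map_one, expansionHom_q_sq, expansionHom_a_mul_q_pow,
    expansionHom_Pb, expansionHom_Pb]
  exact stateSum_moyI x y L

theorem Pb_moyIIa {M : Type} {x₁ x₂ y₁ y₂ : M} {L : List (Piece M)}
    (htwo : Closed (Piece.wide (Sum.inl x₁) (Sum.inl x₂) (Sum.inr 0) (Sum.inr 1) ::
      Piece.wide (Sum.inr 0) (Sum.inr 1) (Sum.inl y₁) (Sum.inl y₂) ::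
      L.map (Piece.map (Sum.inl : M → M ⊕ Fin 2))))
    (hone : Closed (Piece.wide x₁ x₂ y₁ y₂ :: L)) :
    Pb ⟨M ⊕ Fin 2, _, htwo⟩ = (1 + q ^ 2) * Pb ⟨M, _, hone⟩ := by
  have := hone.finite
  apply expansionHom_injective
  rw [map_mul, map_add, map_one, expansionHom_q_sq, expansionHom_Pb, expansionHom_Pb]
  exact stateSum_moyIIa x₁ x₂ y₁ y₂ L

theorem Pb_moyIIb {M : Type} {x u y v : M} {L : List (Piece M)}
    (hww : Closed (Piece.wide (Sum.inl x) (Sum.inr 0) (Sum.inl y) (Sum.inr 1) ::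
      Piece.wide (Sum.inl u) (Sum.inr 1) (Sum.inl v) (Sum.inr 0) ::
      L.map (Piece.map (Sum.inl : M → M ⊕ Fin 2))))
    (hvw : Closed (virt (Sum.inl x) (Sum.inr 0) (Sum.inl y) (Sum.inr 1) ++
      Piece.wide (Sum.inl u) (Sum.inr 1) (Sum.inl v) (Sum.inr 0) ::
      L.map (Piece.map (Sum.inl : M → M ⊕ Fin 2))))
    (harcs : Closed (Piece.arc x y :: Piece.arc u v :: L)) :
    Pb ⟨M ⊕ Fin 2, _, hww⟩ = Pb ⟨M ⊕ Fin 2, _, hvw⟩ +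
      (q ^ 2 + a * q ^ 6) / (1 - q ^ 2) * Pb ⟨M, _, harcs⟩ := by
  have := harcs.finite
  have key : (1 - q ^ 2) * Pb ⟨M ⊕ Fin 2, _, hww⟩ = (1 - q ^ 2) * Pb ⟨M ⊕ Fin 2, _, hvw⟩ +
      (q ^ 2 + a * q ^ 6) * Pb ⟨M, _, harcs⟩ := by
    apply expansionHom_injective
    rw [map_add, map_mul, map_mul, map_mul, map_sub, map_add, map_one, expansionHom_q_sq,
      expansionHom_a_mul_q_pow, expansionHom_Pb, expansionHom_Pb, expansionHom_Pb]
    exact stateSum_moyIIb x u y v L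
  have := one_sub_q_sq_ne_zero
  field_simp
  linear_combination key

theorem Pb_moyIII {M : Type} {x₁ x₂ x₃ y₁ y₂ y₃ : M} {L : List (Piece M)}
    (ha : Closed (Piece.wide (Sum.inl x₁) (Sum.inl x₂) (Sum.inr 0) (Sum.inr 1) ::
      Piece.wide (Sum.inr 1) (Sum.inl x₃) (Sum.inr 2) (Sum.inl y₃) ::
      Piece.wide (Sum.inr 0) (Sum.inr 2) (Sum.inl y₁) (Sum.inl y₂) ::
      L.map (Piece.map (Sum.inl : M → M ⊕ Fin 3))))
    (hb : Closed (Piece.arc x₁ y₁ :: Piece.wide x₂ x₃ y₂ y₃ :: L))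
    (hc : Closed (Piece.wide x₁ x₂ y₁ y₂ :: Piece.arc x₃ y₃ :: L))
    (hd : Closed (Piece.wide (Sum.inl x₂) (Sum.inl x₃) (Sum.inr 0) (Sum.inr 1) ::
      Piece.wide (Sum.inl x₁) (Sum.inr 0) (Sum.inl y₁) (Sum.inr 2) ::
      Piece.wide (Sum.inr 2) (Sum.inr 1) (Sum.inl y₂) (Sum.inl y₃) ::
      L.map (Piece.map (Sum.inl : M → M ⊕ Fin 3)))) :
    Pb ⟨M ⊕ Fin 3, _, ha⟩ + q ^ 2 * Pb ⟨M, _, hb⟩ =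
      q ^ 2 * Pb ⟨M, _, hc⟩ + Pb ⟨M ⊕ Fin 3, _, hd⟩ := by
  have := hb.finite
  apply expansionHom_injective
  rw [map_add, map_add, map_mul, map_mul, expansionHom_q_sq, expansionHom_Pb, expansionHom_Pb,
    expansionHom_Pb, expansionHom_Pb]
  exact stateSum_moyIII x₁ x₂ x₃ y₁ y₂ y₃ L

end HomflyPT

theorem mainTheorem2 :
    -- `P^b(D)` is the Poincaré series at `t = -1`, a rational function
    (∀ D : Diagram, D.IsPoincareAtNegOne (Pb D)) ∧
    -- invariance under braidlike isotopy
    (∀ D D' : Diagram, BraidlikeIsotopic D D' → Pb D = Pb D') ∧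
    -- the skein relation
    (∀ (M : Type) (x₁ x₂ y₁ y₂ : M) (L : List (Piece M))
      (hpos : Closed (Piece.pos x₁ x₂ y₁ y₂ :: L))
      (hneg : Closed (Piece.neg x₁ x₂ y₁ y₂ :: L))
      (hzero : Closed (Piece.arc x₁ y₁ :: Piece.arc x₂ y₂ :: L)),
      q * Pb ⟨M, _, hpos⟩ - q⁻¹ * Pb ⟨M, _, hneg⟩ = (q - q⁻¹) * Pb ⟨M, _, hzero⟩) ∧
    -- resolution of a positive crossing
    (∀ (M : Type) (x₁ x₂ y₁ y₂ : M) (L : List (Piece M))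
      (hpos : Closed (Piece.pos x₁ x₂ y₁ y₂ :: L))
      (hzero : Closed (Piece.arc x₁ y₁ :: Piece.arc x₂ y₂ :: L))
      (hwide : Closed (Piece.wide x₁ x₂ y₁ y₂ :: L)),
      Pb ⟨M, _, hpos⟩ = Pb ⟨M, _, hzero⟩ - (q ^ 2)⁻¹ * Pb ⟨M, _, hwide⟩) ∧
    -- resolution of a negative crossing
    (∀ (M : Type) (x₁ x₂ y₁ y₂ : M) (L : List (Piece M))
      (hneg : Closed (Piece.neg x₁ x₂ y₁ y₂ :: L))
      (hzero : Closed (Piece.arc x₁ y₁ :: Piece.arc x₂ y₂ :: L))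
      (hwide : Closed (Piece.wide x₁ x₂ y₁ y₂ :: L)),
      Pb ⟨M, _, hneg⟩ = Pb ⟨M, _, hzero⟩ - Pb ⟨M, _, hwide⟩) ∧
    -- MOY 0, for a single circle and for a circle next to a diagram
    (∀ h : Closed [Piece.arc () ()], Pb ⟨Unit, _, h⟩ = (1 + a * q ^ 2) / (1 - q ^ 2)) ∧
    (∀ (M : Type) (L : List (Piece M))
      (hcirc : Closed (Piece.arc none none :: L.map (Piece.map (some : M → Option M))))
      (h : Closed L),
      Pb ⟨Option M, _, hcirc⟩ = (1 + a * q ^ 2) / (1 - q ^ 2) * Pb ⟨M, _, h⟩) ∧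
    -- MOY I
    (∀ (M : Type) (x y : M) (L : List (Piece M))
      (hcurl : Closed (Piece.wide (some x) none (some y) none ::
        L.map (Piece.map (some : M → Option M))))
      (h : Closed (Piece.arc x y :: L)),
      Pb ⟨Option M, _, hcurl⟩ = (1 + a * q ^ 4) / (1 - q ^ 2) * Pb ⟨M, _, h⟩) ∧
    -- MOY IIa
    (∀ (M : Type) (x₁ x₂ y₁ y₂ : M) (L : List (Piece M))
      (htwo : Closed (Piece.wide (Sum.inl x₁) (Sum.inl x₂) (Sum.inr 0) (Sum.inr 1) ::
        Piece.wide (Sum.inr 0) (Sum.inr 1) (Sum.inl y₁) (Sum.inl y₂) ::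
        L.map (Piece.map (Sum.inl : M → M ⊕ Fin 2))))
      (hone : Closed (Piece.wide x₁ x₂ y₁ y₂ :: L)),
      Pb ⟨M ⊕ Fin 2, _, htwo⟩ = (1 + q ^ 2) * Pb ⟨M, _, hone⟩) ∧
    -- MOY IIb*: the left vertex points up, the right one down; the strands come in at the bottom
    -- left `x` and the top right `u` and go out at the top left `y` and the bottom right `v`; the
    -- internal marks are `Sum.inr 0` (bottom) and `Sum.inr 1` (top)
    (∀ (M : Type) (x u y v : M) (L : List (Piece M))
      (hww : Closed (Piece.wide (Sum.inl x) (Sum.inr 0) (Sum.inl y) (Sum.inr 1) ::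
        Piece.wide (Sum.inl u) (Sum.inr 1) (Sum.inl v) (Sum.inr 0) ::
        L.map (Piece.map (Sum.inl : M → M ⊕ Fin 2))))
      (hvw : Closed (virt (Sum.inl x) (Sum.inr 0) (Sum.inl y) (Sum.inr 1) ++
        Piece.wide (Sum.inl u) (Sum.inr 1) (Sum.inl v) (Sum.inr 0) ::
        L.map (Piece.map (Sum.inl : M → M ⊕ Fin 2))))
      (harcs : Closed (Piece.arc x y :: Piece.arc u v :: L)),
      Pb ⟨M ⊕ Fin 2, _, hww⟩ = Pb ⟨M ⊕ Fin 2, _, hvw⟩ +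
        (q ^ 2 + a * q ^ 6) / (1 - q ^ 2) * Pb ⟨M, _, harcs⟩) ∧
    -- MOY III
    (∀ (M : Type) (x₁ x₂ x₃ y₁ y₂ y₃ : M) (L : List (Piece M))
      (ha : Closed (Piece.wide (Sum.inl x₁) (Sum.inl x₂) (Sum.inr 0) (Sum.inr 1) ::
        Piece.wide (Sum.inr 1) (Sum.inl x₃) (Sum.inr 2) (Sum.inl y₃) ::
        Piece.wide (Sum.inr 0) (Sum.inr 2) (Sum.inl y₁) (Sum.inl y₂) ::
        L.map (Piece.map (Sum.inl : M → M ⊕ Fin 3))))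
      (hb : Closed (Piece.arc x₁ y₁ :: Piece.wide x₂ x₃ y₂ y₃ :: L))
      (hc : Closed (Piece.wide x₁ x₂ y₁ y₂ :: Piece.arc x₃ y₃ :: L))
      (hd : Closed (Piece.wide (Sum.inl x₂) (Sum.inl x₃) (Sum.inr 0) (Sum.inr 1) ::
        Piece.wide (Sum.inl x₁) (Sum.inr 0) (Sum.inl y₁) (Sum.inr 2) ::
        Piece.wide (Sum.inr 2) (Sum.inr 1) (Sum.inl y₂) (Sum.inl y₃) ::
        L.map (Piece.map (Sum.inl : M → M ⊕ Fin 3)))),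
      Pb ⟨M ⊕ Fin 3, _, ha⟩ + q ^ 2 * Pb ⟨M, _, hb⟩ =
        q ^ 2 * Pb ⟨M, _, hc⟩ + Pb ⟨M ⊕ Fin 3, _, hd⟩) :=
  ⟨isPoincareAtNegOne_Pb, fun _ _ => Pb_eq_of_isotopic, fun _ _ _ _ _ _ => Pb_skein,
    fun _ _ _ _ _ _ => Pb_pos, fun _ _ _ _ _ _ => Pb_neg, Pb_unit_circle, fun _ _ => Pb_circle,
    fun _ _ _ _ => Pb_moyI, fun _ _ _ _ _ _ => Pb_moyIIa, fun _ _ _ _ _ _ => Pb_moyIIb,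
    fun _ _ _ _ _ _ _ _ => Pb_moyIII⟩
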